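/- Let $k$ be an algebraically closed field of characteristic $\neq 2$. For a $k$-scheme $S$ and $A=\mathbb Z$ or $\mathbb Z/2$, let $\mathfrak L_A(S)$ be the groupoid of $A$-graded invertible $\mathcal O_S$-modules: objects are pairs $(L,a)$ with $L$ an invertible $\mathcal O_S$-module and $a\colon S\to A$ locally constant; morphisms $(L,a)\to(M,b)$ exist only if $a=b$ and are the isomorphisms $L\to M$; and $(L,a)\otimes(M,b)=(L\otimes M,a+b)$. Let $\pi\colon\mathfrak L_{\mathbb Z}(S)\to\mathfrak L_{\mathbb Z/2}(S)$ be the reduction functor and $\Delta\colon\mathfrak L_{\mathbb Z/2}(S)\to\mathfrak L_{\mathbb Z/2}(S)$ the functor $[L]\mapsto[L]\otimes[L]$, $[f]\mapsto[f]\otimes[f]$. Let $\mathcal A(S)$ be the category whose objects are complexes $E^\bullet=(0\to E\xrightarrow{\alpha_E}E^*\to0)$ in degrees $0,1$, with $E$ a locally free $\mathcal O_S$-module of finite rank and $\alpha_E$ skew-symmetric, and whose morphisms are the morphisms of complexes $f=(f_0,f_1)\colon E^\bullet\to F^\bullet$ such that $f^*[-1]=(f_1^*,f_0^*)\colon F^\bullet\to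 E^\bullet$ is a homotopy inverse of $f$. Let $\mathrm{Det}\colon\mathcal A(S)\to\mathfrak L_{\mathbb Z}(S)$ be the determinant functor: $\mathrm{Det}(E^\bullet)=\det E\otimes(\det E^*)^{-1}$, where $\det V=(\Lambda^{\max}V,\operatorname{rank}V)$, and $\mathrm{Det}(f)$ is the isomorphism given by the acyclic complex $$0\to E\xrightarrow{\binom{\alpha_E}{-f_0}}E^*\oplus F\xrightarrow{(f_1\ \alpha_F)}F^*\to0,$$ that is, locally, by the determinant of $\begin{pmatrix}\alpha_E&u\\-f_0&v\end{pmatrix}\colon E\oplus F^*\to E^*\oplus F$ for any section $\binom uv$ of $(f_1\ \alpha_F)$. Then, for all $k$-schemes $S$, there are functors $\mathrm{Pf}=\mathrm{Pf}_S\colon\mathcal A(S)\to\mathfrak L_{\mathbb Z/2}(S)$, given on objects by $\mathrm{Pf}(E^\bullet)=(\Lambda^{\max}E,\ \operatorname{rank}E\bmod 2)$, and isomorphisms of functors $$\theta_S\colon\ \pi\circ\mathrm{Det}\ \xrightarrow{\ \sim\ }\ \Delta\circ\mathrm{Pf},$$ such that: 1. $\mathrm{Pf}$ commutes with base change: for every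 morphism $\varphi\colon S'\to S$ of $k$-schemes and every isomorphism $\varphi^*E^\bullet\simeq E'^\bullet$ of skew-symmetric complexes on $S'$ there is an isomorphism $\varphi^*\mathrm{Pf}_S(E^\bullet)\simeq\mathrm{Pf}_{S'}(E'^\bullet)$; these isomorphisms are natural in the morphisms of $\mathcal A$, compatible with composition of base changes, and compatible with $\theta$. 2. If a morphism $f\colon E^\bullet\to E^\bullet$ of $\mathcal A(S)$ is homotopic to the identity, then $\mathrm{Pf}_S(f)=\mathrm{id}$. -/

import Mathlib

open CategoryTheory AlgebraicGeometry TopologicalSpace Opposite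

universe u

namespace Pfaff

noncomputable section

variable {S : Scheme.{u}}

/-- Restriction of functions to a smaller open set. -/
def res {U V : S.Opens} (h : V ≤ U) : Γ(S, U) →+* Γ(S, V) :=
  (S.presheaf.map (homOfLE h).op).hom

/-- Restriction of sections of an `𝒪_S`-module to a smaller open set. -/
def mres (M : S.Modules) {U V : S.Opens} (h : V ≤ U) : Γ(M, U) →+ Γ(M, V) :=
  (M.presheaf.map (homOfLE h).op).hom

theorem res_self {U : S.Opens} (r : Γ(S, U)) : res le_rfl r = r := by
  simp [res]

theorem res_res {U V W : S.Opens} (h : V ≤ U) (h' : W ≤ V) (r : Γ(S, U)) :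
    res h' (res h r) = res (h'.trans h) r := by
  simp only [res]
  rw [← CommRingCat.comp_apply, ← S.presheaf.map_comp]
  rfl

theorem mres_self (M : S.Modules) {U : S.Opens} (s : Γ(M, U)) : mres M le_rfl s = s := by
  simp [mres]

theorem mres_mres (M : S.Modules) {U V W : S.Opens} (h : V ≤ U) (h' : W ≤ V) (s : Γ(M, U)) :
    mres M h' (mres M h s) = mres M (h'.trans h) s := by
  simp only [mres]
  rw [← AddCommGrpCat.comp_apply, ← M.presheaf.map_comp]
  rfl

theorem mres_smul (M : S.Modules) {U V : S.Opens} (h : V ≤ U) (a : Γ(S, U)) (s : Γ(M, U)) :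
    mres M h (a • s) = res h a • mres M h s :=
  M.map_smul (homOfLE h) a s

theorem app_mres {M N : S.Modules} (f : M ⟶ N) {U V : S.Opens} (h : V ≤ U) (s : Γ(M, U)) :
    f.app V (mres M h s) = mres N h (f.app U s) := by
  have := congr($(f.mapPresheaf.naturality (homOfLE h).op) s)
  exact this

theorem res_ext {V : S.Opens} {r r' : Γ(S, V)}
    (h : ∀ x ∈ V, ∃ (W : S.Opens) (hW : W ≤ V), x ∈ W ∧ res hW r = res hW r') : r = r' := by
  choose W hW hx he using h
  refine S.sheaf.eq_of_locally_eq' (fun x : V => W x x.2) V (fun x => homOfLE (hW x x.2)) ?_ _ _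
    (fun x => he x x.2)
  intro x hxV
  exact Opens.mem_iSup.2 ⟨⟨x, hxV⟩, hx x hxV⟩

theorem res_glue {V : S.Opens} {ι : Type*} (W : ι → S.Opens) (hW : ∀ i, W i ≤ V)
    (hc : ∀ x ∈ V, ∃ i, x ∈ W i) (r : ∀ i, Γ(S, W i))
    (hr : ∀ i j, res (inf_le_left : W i ⊓ W j ≤ W i) (r i) = res inf_le_right (r j)) :
    ∃ s : Γ(S, V), ∀ i, res (hW i) s = r i := by
  obtain ⟨s, hs, -⟩ := S.sheaf.existsUnique_gluing' W V (fun i => homOfLE (hW i))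
    (fun x hx => Opens.mem_iSup.2 (hc x hx)) r (fun i j => hr i j)
  exact ⟨s, hs⟩

theorem mres_ext (M : S.Modules) {V : S.Opens} {s s' : Γ(M, V)}
    (h : ∀ x ∈ V, ∃ (W : S.Opens) (hW : W ≤ V), x ∈ W ∧ mres M hW s = mres M hW s') : s = s' := by
  choose W hW hx he using h
  refine TopCat.Sheaf.eq_of_locally_eq' ⟨M.presheaf, M.isSheaf⟩ (fun x : V => W x x.2) V
    (fun x => homOfLE (hW x x.2)) ?_ _ _ (fun x => he x x.2)
  intro x hxV
  exact Opens.mem_iSup.2 ⟨⟨x, hxV⟩, hx x hxV⟩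

/-- A frame of `M` over `U`: sections `e₁, …, eₙ` that define an isomorphism of the free module
`𝒪_Uⁿ` with `M|_U`. -/
def IsFrame (M : S.Modules) {U : S.Opens} {n : ℕ} (e : Fin n → Γ(M, U)) : Prop :=
  ∀ (V : S.Opens) (h : V ≤ U),
    Function.Bijective fun c : Fin n → Γ(S, V) => ∑ i, c i • mres M h (e i)

/-- A generator of `M` over `U`: a section that defines an isomorphism `𝒪_U ≃ M|_U`. -/
def IsGen (M : S.Modules) {U : S.Opens} (s : Γ(M, U)) : Prop :=
  ∀ (V : S.Opens) (h : V ≤ U), Function.Bijective fun c : Γ(S, V) => c • mres M h s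

/-- `M` is locally free of finite rank. -/
def IsVectorBundle (M : S.Modules) : Prop :=
  ∀ x : S, ∃ (U : S.Opens) (_ : x ∈ U) (n : ℕ) (e : Fin n → Γ(M, U)), IsFrame M e

/-- `M` is invertible, that is, locally isomorphic to `𝒪_S`. -/
def IsInvertible (M : S.Modules) : Prop :=
  ∀ x : S, ∃ (U : S.Opens) (_ : x ∈ U) (s : Γ(M, U)), IsGen M s

theorem IsFrame.restrict {M : S.Modules} {U V : S.Opens} {n : ℕ} {e : Fin n → Γ(M, U)}
    (he : IsFrame M e) (h : V ≤ U) : IsFrame M fun i => mres M h (e i) := by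
  intro W hW
  simpa only [mres_mres] using he W (hW.trans h)

/-- The basis of `M(V)` given by a frame over `U ⊇ V`. -/
def IsFrame.basis {M : S.Modules} {U : S.Opens} {n : ℕ} {e : Fin n → Γ(M, U)}
    (he : IsFrame M e) : Module.Basis (Fin n) Γ(S, U) Γ(M, U) :=
  Module.Basis.mk (v := e)
    (by
      rw [Fintype.linearIndependent_iff]
      intro g hg
      have h0 : g = 0 := (he U le_rfl).1 (by simpa [mres_self] using hg)
      simp [h0])
    (by
      intro s _
      obtain ⟨c, rfl⟩ := (he U le_rfl).2 s
      refine Submodule.sum_mem _ fun i _ => Submodule.smul_mem _ _ (Submodule.subset_span ?_)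
      exact ⟨i, (mres_self M (e i)).symm⟩)

theorem IsFrame.basis_apply {M : S.Modules} {U : S.Opens} {n : ℕ} {e : Fin n → Γ(M, U)}
    (he : IsFrame M e) (i : Fin n) : he.basis i = e i := by
  simp [IsFrame.basis]

theorem nontrivial_of_mem {U : S.Opens} {x : S} (hx : x ∈ U) : Nontrivial Γ(S, U) := by
  have : Nonempty U := ⟨⟨x, hx⟩⟩
  infer_instance

theorem IsFrame.card_eq {M : S.Modules} {U V : S.Opens} {n m : ℕ} {e : Fin n → Γ(M, U)}
    {f : Fin m → Γ(M, V)} (he : IsFrame M e) (hf : IsFrame M f) {x : S} (hU : x ∈ U)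
    (hV : x ∈ V) : n = m := by
  have : Nontrivial Γ(S, U ⊓ V) := nontrivial_of_mem (x := x) ⟨hU, hV⟩
  simpa using Fintype.card_congr
    ((he.restrict (inf_le_left : U ⊓ V ≤ U)).basis.indexEquiv (hf.restrict inf_le_right).basis)

/-- The rank of a vector bundle at a point. -/
def rankAt {M : S.Modules} (hM : IsVectorBundle M) (x : S) : ℕ :=
  (hM x).choose_spec.choose_spec.choose

theorem rankAt_eq {M : S.Modules} (hM : IsVectorBundle M) {U : S.Opens} {n : ℕ}
    {e : Fin n → Γ(M, U)} (he : IsFrame M e) {x : S} (hx : x ∈ U) : rankAt hM x = n :=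
  IsFrame.card_eq (hM x).choose_spec.choose_spec.choose_spec.choose_spec he
    (hM x).choose_spec.choose hx

/-- The rank of a vector bundle as a locally constant function. -/
def rank {M : S.Modules} (hM : IsVectorBundle M) : LocallyConstant S ℕ where
  toFun := rankAt hM
  isLocallyConstant := by
    rw [IsLocallyConstant.iff_exists_open]
    intro x
    obtain ⟨U, hx, n, e, he⟩ := hM x
    exact ⟨U, U.isOpen, hx, fun y hy => by rw [rankAt_eq hM he hy, rankAt_eq hM he hx]⟩

theorem rank_apply {M : S.Modules} (hM : IsVectorBundle M) {U : S.Opens} {n : ℕ}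
    {e : Fin n → Γ(M, U)} (he : IsFrame M e) {x : S} (hx : x ∈ U) : rank hM x = n :=
  rankAt_eq hM he hx

/-! ### Sheafification -/

instance (P : S.PresheafOfModules) (U : S.Opens) : Module Γ(S, U) (P.presheaf.obj (op U)) :=
  (P.obj (op U)).isModule

/-- Restriction of sections of a presheaf of modules. -/
def pres (P : S.PresheafOfModules) {U V : S.Opens} (h : V ≤ U) :
    P.presheaf.obj (op U) →+ P.presheaf.obj (op V) :=
  (P.presheaf.map (homOfLE h).op).hom

/-- The sheaf of modules associated with a presheaf of modules. -/
def shf (P : S.PresheafOfModules) : S.Modules :=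
  (PresheafOfModules.sheafification (𝟙 S.ringCatSheaf.obj)).obj P

/-- The canonical map from a presheaf of modules to the associated sheaf. -/
def toShf (P : S.PresheafOfModules) (U : S.Opens) : P.presheaf.obj (op U) →+ Γ(shf P, U) :=
  ((CategoryTheory.toSheafify (Opens.grothendieckTopology S) P.presheaf).app (op U)).hom

theorem toShf_pres (P : S.PresheafOfModules) {U V : S.Opens} (h : V ≤ U)
    (s : P.presheaf.obj (op U)) : toShf P V (pres P h s) = mres (shf P) h (toShf P U s) :=
  congr($((CategoryTheory.toSheafify (Opens.grothendieckTopology S) P.presheaf).naturality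
    (homOfLE h).op) s)

theorem toShf_smul (P : S.PresheafOfModules) {U : S.Opens} (r : Γ(S, U))
    (s : P.presheaf.obj (op U)) : toShf P U (r • s) = r • toShf P U s :=
  (((PresheafOfModules.sheafificationAdjunction (𝟙 S.ringCatSheaf.obj)).unit.app P).app
    (op U)).hom.map_smul r s

theorem toShf_inj (P : S.PresheafOfModules) {U : S.Opens} {s t : P.presheaf.obj (op U)}
    (h : toShf P U s = toShf P U t) {x : S} (hx : x ∈ U) :
    ∃ (V : S.Opens) (hV : V ≤ U), x ∈ V ∧ pres P hV s = pres P hV t := by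
  have := CategoryTheory.Presheaf.equalizerSieve_mem (Opens.grothendieckTopology S)
    (CategoryTheory.toSheafify (Opens.grothendieckTopology S) P.presheaf) s t h
  obtain ⟨V, f, hf, hxV⟩ := this x hx
  exact ⟨V, leOfHom f, hxV, hf⟩

theorem toShf_surj (P : S.PresheafOfModules) {U : S.Opens} (s : Γ(shf P, U)) {x : S}
    (hx : x ∈ U) : ∃ (V : S.Opens) (hV : V ≤ U) (t : P.presheaf.obj (op V)), x ∈ V ∧
      toShf P V t = mres (shf P) hV s := by
  have := CategoryTheory.Presheaf.imageSieve_mem (Opens.grothendieckTopology S)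
    (CategoryTheory.toSheafify (Opens.grothendieckTopology S) P.presheaf) s
  obtain ⟨V, f, ⟨t, ht⟩, hxV⟩ := this x hx
  exact ⟨V, leOfHom f, t, hxV, ht⟩

theorem isGen_toShf (P : S.PresheafOfModules) {U : S.Opens} (s : P.presheaf.obj (op U))
    (hs : ∀ (V : S.Opens) (h : V ≤ U), Function.Bijective fun c : Γ(S, V) => c • pres P h s) :
    IsGen (shf P) (toShf P U s) := by
  have inj : ∀ (V : S.Opens) (h : V ≤ U),
      Function.Injective fun c : Γ(S, V) => c • mres (shf P) h (toShf P U s) := by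
    intro V h r r' hr
    simp only [← toShf_pres, ← toShf_smul] at hr
    refine res_ext fun x hx => ?_
    obtain ⟨W, hW, hxW, e⟩ := toShf_inj P hr hx
    refine ⟨W, hW, hxW, (hs W (hW.trans h)).1 ?_⟩
    have key : ∀ c : Γ(S, V), pres P hW (c • pres P h s) = res hW c • pres P (hW.trans h) s := by
      intro c
      have h1 : pres P hW (c • pres P h s) = res hW c • pres P hW (pres P h s) :=
        PresheafOfModules.map_smul P (homOfLE hW).op c (pres P h s)
      rw [h1]
      congr 1
      simp only [pres]
      rw [← AddCommGrpCat.comp_apply, ← P.presheaf.map_comp]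
      rfl
    simpa only [key] using e
  intro V h
  refine ⟨inj V h, fun t => ?_⟩
  have loc : ∀ x : V, ∃ (W : S.Opens) (hW : W ≤ V) (c : Γ(S, W)), x.1 ∈ W ∧
      c • mres (shf P) (hW.trans h) (toShf P U s) = mres (shf P) hW t := by
    intro x
    obtain ⟨W, hW, p, hxW, hp⟩ := toShf_surj P t x.2
    obtain ⟨c, rfl⟩ := (hs W (hW.trans h)).2 p
    refine ⟨W, hW, c, hxW, ?_⟩
    rw [← hp, ← toShf_pres, ← toShf_smul]
  choose W hW c hx hc using loc
  obtain ⟨r, hr⟩ := res_glue W hW (fun x hxV => ⟨⟨x, hxV⟩, hx _⟩) c (by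
    intro i j
    refine inj (W i ⊓ W j) ((inf_le_left.trans (hW i)).trans h) ?_
    have h1 := congrArg (mres (shf P) (inf_le_left : W i ⊓ W j ≤ W i)) (hc i)
    have h2 := congrArg (mres (shf P) (inf_le_right : W i ⊓ W j ≤ W j)) (hc j)
    rw [mres_smul, mres_mres, mres_mres] at h1 h2
    exact h1.trans h2.symm)
  refine ⟨r, mres_ext _ fun x hxV => ⟨W ⟨x, hxV⟩, hW _, hx _, ?_⟩⟩
  rw [← hc, ← hr, mres_smul, mres_mres]

/-! ### The dual of a sheaf of modules -/

/-- The sections over `U` of the dual of `E`: the `𝒪_U`-linear morphisms `E|_U → 𝒪_U`. -/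
def DualSec (E : S.Modules) (U : S.Opens) :
    AddSubgroup (∀ V : {V : S.Opens // V ≤ U}, Γ(E, V.1) → Γ(S, V.1)) where
  carrier := {φ | (∀ V hV x y, φ ⟨V, hV⟩ (x + y) = φ ⟨V, hV⟩ x + φ ⟨V, hV⟩ y) ∧
    (∀ V hV (a : Γ(S, V)) x, φ ⟨V, hV⟩ (a • x) = a * φ ⟨V, hV⟩ x) ∧
    ∀ V hV W (hW : W ≤ V) x, φ ⟨W, hW.trans hV⟩ (mres E hW x) = res hW (φ ⟨V, hV⟩ x)}
  add_mem' := by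
    rintro φ ψ ⟨h1, h2, h3⟩ ⟨k1, k2, k3⟩
    refine ⟨fun V hV x y => ?_, fun V hV a x => ?_, fun V hV W hW x => ?_⟩
    · simp only [Pi.add_apply, h1, k1]; abel
    · simp only [Pi.add_apply, h2, k2, mul_add]
    · simp only [Pi.add_apply, h3 V hV W hW, k3 V hV W hW, map_add]
  zero_mem' := by simp
  neg_mem' := by
    rintro φ ⟨h1, h2, h3⟩
    refine ⟨fun V hV x y => ?_, fun V hV a x => ?_, fun V hV W hW x => ?_⟩
    · simp only [Pi.neg_apply, h1]; abel
    · simp only [Pi.neg_apply, h2, mul_neg]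
    · simp only [Pi.neg_apply, h3 V hV W hW, map_neg]

instance (E : S.Modules) (U : S.Opens) : Module Γ(S, U) (DualSec E U) where
  smul a φ := ⟨fun V x => res V.2 a * φ.1 V x, by
    obtain ⟨φ, h1, h2, h3⟩ := φ
    refine ⟨fun V hV x y => ?_, fun V hV a x => ?_, fun V hV W hW x => ?_⟩
    · simp only [h1, mul_add]
    · simp only [h2]; ring
    · change res (hW.trans hV) a * φ ⟨W, hW.trans hV⟩ (mres E hW x) = res hW (res hV a * φ ⟨V, hV⟩ x)
      rw [h3 V hV W hW, map_mul, res_res]⟩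
  one_smul φ := Subtype.ext <| by
    funext ⟨V, hV⟩ x; exact (congrArg (· * φ.1 ⟨V, hV⟩ x) (map_one (res hV))).trans (one_mul _)
  mul_smul a b φ := Subtype.ext <| by
    funext ⟨V, hV⟩ x
    change res hV (a * b) * φ.1 ⟨V, hV⟩ x = res hV a * (res hV b * φ.1 ⟨V, hV⟩ x)
    rw [map_mul, mul_assoc]
  smul_zero a := Subtype.ext <| by
    funext ⟨V, hV⟩ x; exact mul_zero (res hV a)
  smul_add a φ ψ := Subtype.ext <| by
    funext ⟨V, hV⟩ x; exact mul_add (res hV a) _ _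
  add_smul a b φ := Subtype.ext <| by
    funext ⟨V, hV⟩ x
    change res hV (a + b) * φ.1 ⟨V, hV⟩ x = res hV a * φ.1 ⟨V, hV⟩ x + res hV b * φ.1 ⟨V, hV⟩ x
    rw [map_add, add_mul]
  zero_smul φ := Subtype.ext <| by
    funext ⟨V, hV⟩ x; exact (congrArg (· * φ.1 ⟨V, hV⟩ x) (map_zero (res hV))).trans (zero_mul _)

/-- Restriction of sections of the dual. -/
def dualRes (E : S.Modules) {U V : S.Opens} (h : V ≤ U) : DualSec E U →+ DualSec E V where
  toFun φ := ⟨fun W => φ.1 ⟨W.1, W.2.trans h⟩, fun W hW => φ.2.1 W (hW.trans h),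
    fun W hW => φ.2.2.1 W (hW.trans h), fun W hW => φ.2.2.2 W (hW.trans h)⟩
  map_zero' := rfl
  map_add' _ _ := rfl

/-- The dual of `E` as a presheaf of abelian groups. -/
def dualPresheaf (E : S.Modules) : TopCat.Presheaf Ab.{u} S where
  obj U := AddCommGrpCat.of (DualSec E U.unop)
  map f := AddCommGrpCat.ofHom (dualRes E (leOfHom f.unop))
  map_id _ := rfl
  map_comp _ _ := rfl

theorem dualPresheaf_isSheaf (E : S.Modules) : (dualPresheaf E).IsSheaf := by
  rw [TopCat.Presheaf.isSheaf_iff_isSheafUniqueGluing]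
  intro ι U sf hsf
  let sf' : ∀ i, DualSec E (U i) := sf
  have hsf' : ∀ i j V (hi : V ≤ U i) (hj : V ≤ U j) x, (sf' i).1 ⟨V, hi⟩ x = (sf' j).1 ⟨V, hj⟩ x := by
    intro i j V hi hj x
    have h1 : dualRes E (inf_le_left : U i ⊓ U j ≤ U i) (sf' i) =
      dualRes E (inf_le_right : U i ⊓ U j ≤ U j) (sf' j) := hsf i j
    exact congrFun (congrFun (congrArg Subtype.val h1) ⟨V, le_inf hi hj⟩) x
  have hU : ∀ {V : S.Opens}, V ≤ iSup U → ∀ x ∈ V, ∃ i, x ∈ V ⊓ U i := by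
    intro V hV x hx
    obtain ⟨i, hi⟩ := Opens.mem_iSup.1 (hV hx)
    exact ⟨i, hx, hi⟩
  have ext : ∀ {V : S.Opens} (hV : V ≤ iSup U) {r r' : Γ(S, V)},
      (∀ i, res (inf_le_left : V ⊓ U i ≤ V) r = res inf_le_left r') → r = r' := by
    intro V hV r r' h
    refine res_ext fun x hx => ?_
    obtain ⟨i, hi⟩ := hU hV x hx
    exact ⟨_, inf_le_left, hi, h i⟩
  have glue : ∀ (V : S.Opens) (_ : V ≤ iSup U) (x : Γ(E, V)), ∃ r : Γ(S, V), ∀ i,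
      res (inf_le_left : V ⊓ U i ≤ V) r = (sf' i).1 ⟨V ⊓ U i, inf_le_right⟩ (mres E inf_le_left x) := by
    intro V hV x
    refine res_glue (fun i => V ⊓ U i) (fun i => inf_le_left) (hU hV) _ fun i j => ?_
    rw [← (sf' i).2.2.2, ← (sf' j).2.2.2, mres_mres, mres_mres]
    exact hsf' i j _ _ _ _
  choose s hs using glue
  refine ⟨⟨fun V => s V.1 V.2, fun V hV x y => ext hV fun i => ?_, fun V hV a x => ext hV fun i => ?_,
    fun V hV W hW x => ext (hW.trans hV) fun i => ?_⟩, fun i => ?_, fun t ht => ?_⟩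
  · rw [hs, map_add, map_add, hs, hs, (sf' i).2.1]
  · rw [hs, map_mul, hs, mres_smul, (sf' i).2.2.1]
  · rw [hs, res_res, ← res_res inf_le_left (inf_le_inf_right (U i) hW), hs, ← (sf' i).2.2.2,
      mres_mres, mres_mres]
  · refine Subtype.ext ?_
    funext ⟨V, hV⟩ x
    change s V (hV.trans (le_iSup U i)) x = (sf' i).1 ⟨V, hV⟩ x
    refine ext (hV.trans (le_iSup U i)) fun j => ?_
    rw [hs, ← (sf' i).2.2.2]
    exact hsf' j i _ _ _ _
  · refine Subtype.ext ?_
    funext ⟨V, hV⟩ x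
    let t' : DualSec E (iSup U) := t
    change t'.1 ⟨V, hV⟩ x = s V hV x
    refine ext hV fun i => ?_
    rw [hs, ← t'.2.2.2 V hV]
    have h1 : dualRes E (le_iSup U i) t' = sf' i := ht i
    rw [← h1]
    rfl

/-- The dual `E* = Hom(E, 𝒪_S)` of an `𝒪_S`-module. -/
def dual (E : S.Modules) : S.Modules where
  val :=
    letI : ∀ U : S.Opensᵒᵖ, Module (S.ringCatSheaf.obj.obj U) ((dualPresheaf E).obj U) :=
      fun U => inferInstanceAs (Module Γ(S, U.unop) (DualSec E U.unop))
    PresheafOfModules.ofPresheaf (dualPresheaf E) (by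
      intro U V f r φ
      refine Subtype.ext ?_
      funext ⟨W, hW⟩ x
      exact congrArg (· * _) (res_res (leOfHom f.unop) hW r).symm)
  isSheaf := dualPresheaf_isSheaf E

/-- A section of the dual as a linear form. -/
def toDualSec {E : S.Modules} {U : S.Opens} (l : Γ(dual E, U)) : DualSec E U := l

/-- The value `⟨ℓ, x⟩` of a linear form at a section. -/
def pair {E : S.Modules} {U : S.Opens} (l : Γ(dual E, U)) (x : Γ(E, U)) : Γ(S, U) :=
  (toDualSec l).1 ⟨U, le_rfl⟩ x

theorem pair_add_right {E : S.Modules} {U : S.Opens} (l : Γ(dual E, U)) (x y : Γ(E, U)) :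
    pair l (x + y) = pair l x + pair l y :=
  (toDualSec l).2.1 U le_rfl x y

theorem pair_smul_right {E : S.Modules} {U : S.Opens} (l : Γ(dual E, U)) (a : Γ(S, U))
    (x : Γ(E, U)) : pair l (a • x) = a * pair l x :=
  (toDualSec l).2.2.1 U le_rfl a x

theorem pair_add_left {E : S.Modules} {U : S.Opens} (l m : Γ(dual E, U)) (x : Γ(E, U)) :
    pair (l + m) x = pair l x + pair m x :=
  rfl

theorem pair_smul_left {E : S.Modules} {U : S.Opens} (a : Γ(S, U)) (l : Γ(dual E, U))
    (x : Γ(E, U)) : pair (a • l) x = a * pair l x := by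
  change res le_rfl a * pair l x = _
  rw [res_self]

theorem pair_mres {E : S.Modules} {U V : S.Opens} (h : V ≤ U) (l : Γ(dual E, U)) (x : Γ(E, U)) :
    pair (mres (dual E) h l) (mres E h x) = res h (pair l x) :=
  (toDualSec l).2.2.2 U le_rfl V h x

theorem dual_ext {E : S.Modules} {U : S.Opens} {l m : Γ(dual E, U)}
    (h : ∀ (V : S.Opens) (hV : V ≤ U) (x : Γ(E, V)),
      pair (mres (dual E) hV l) x = pair (mres (dual E) hV m) x) : l = m := by
  refine Subtype.ext (a1 := (toDualSec l)) (a2 := (toDualSec m)) ?_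
  funext ⟨V, hV⟩ x
  exact h V hV x

/-- A linear form on `E|_U` from its values on sections. -/
def mkDual {E : S.Modules} {U : S.Opens} (φ : ∀ V : {V : S.Opens // V ≤ U}, Γ(E, V.1) → Γ(S, V.1))
    (h : φ ∈ DualSec E U) : Γ(dual E, U) :=
  (show DualSec E U from ⟨φ, h⟩)

theorem pair_mres_mkDual {E : S.Modules} {U : S.Opens}
    (φ : ∀ V : {V : S.Opens // V ≤ U}, Γ(E, V.1) → Γ(S, V.1))
    (h : φ ∈ DualSec E U) {V : S.Opens} (hV : V ≤ U) (x : Γ(E, V)) :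
    pair (mres (dual E) hV (mkDual φ h)) x = φ ⟨V, hV⟩ x :=
  rfl

theorem pair_zero_left {E : S.Modules} {U : S.Opens} (x : Γ(E, U)) :
    pair (0 : Γ(dual E, U)) x = 0 := rfl

theorem pair_sum_left {E : S.Modules} {U : S.Opens} {ι : Type*} (t : Finset ι)
    (l : ι → Γ(dual E, U)) (x : Γ(E, U)) : pair (∑ i ∈ t, l i) x = ∑ i ∈ t, pair (l i) x :=
  map_sum (AddMonoidHom.mk' (fun l : Γ(dual E, U) => pair l x)
    fun a b => pair_add_left a b x) l t

theorem pair_sum_right {E : S.Modules} {U : S.Opens} {ι : Type*} (t : Finset ι)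
    (l : Γ(dual E, U)) (x : ι → Γ(E, U)) : pair l (∑ i ∈ t, x i) = ∑ i ∈ t, pair l (x i) :=
  map_sum (AddMonoidHom.mk' (fun x : Γ(E, U) => pair l x) (pair_add_right l)) x t

/-- A frame of `E` has a dual frame. -/
theorem IsFrame.exists_dual {E : S.Modules} {U : S.Opens} {n : ℕ} {e : Fin n → Γ(E, U)}
    (he : IsFrame E e) : ∃ l : Fin n → Γ(dual E, U), IsFrame (dual E) l ∧
      ∀ i j, pair (l i) (e j) = if i = j then 1 else 0 := by
  let b : ∀ (V : S.Opens) (_ : V ≤ U), Module.Basis (Fin n) Γ(S, V) Γ(E, V) :=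
    fun V hV => (he.restrict hV).basis
  have hb : ∀ V hV i, b V hV i = mres E hV (e i) := fun V hV i => IsFrame.basis_apply _ i
  have hmem : ∀ i, (fun (V : {V : S.Opens // V ≤ U}) (x : Γ(E, V.1)) => (b V.1 V.2).repr x i) ∈ DualSec E U := by
    intro i
    refine ⟨fun V hV x y => by simp, fun V hV a x => by simp, fun V hV W hW x => ?_⟩
    have h1 : mres E hW x = ∑ j, res hW ((b V hV).repr x j) • b W (hW.trans hV) j := by
      conv_lhs => rw [← (b V hV).sum_repr x]
      rw [map_sum]
      refine Finset.sum_congr rfl fun j _ => ?_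
      rw [mres_smul, hb, hb, mres_mres]
    simp only [h1]
    rw [Module.Basis.repr_sum_self]
  have hp : ∀ i (V : S.Opens) (hV : V ≤ U) x,
      pair (mres (dual E) hV (mkDual _ (hmem i))) x = (b V hV).repr x i := fun i V hV x => rfl
  have hpb : ∀ (V : S.Opens) (hV : V ≤ U) (c : Fin n → Γ(S, V)) j,
      pair (∑ i, c i • mres (dual E) hV (mkDual _ (hmem i))) (b V hV j) = c j := by
    intro V hV c j
    rw [pair_sum_left]
    simp only [pair_smul_left, hp, Module.Basis.repr_self]
    simp [Finsupp.single_apply]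
  refine ⟨fun i => mkDual _ (hmem i), fun V hV => ⟨fun c d hcd => ?_, fun l => ?_⟩, fun i j => ?_⟩
  · funext j
    have := congrArg (fun l => pair l (b V hV j)) hcd
    simpa only [hpb] using this
  · refine ⟨fun i => pair l (b V hV i), dual_ext fun W hW x => ?_⟩
    have hx : x = ∑ j, (b W (hW.trans hV)).repr x j • mres E hW (b V hV j) := by
      conv_lhs => rw [← (b W (hW.trans hV)).sum_repr x]
      refine Finset.sum_congr rfl fun j _ => ?_
      rw [hb, hb, mres_mres]
    rw [hx, pair_sum_right, pair_sum_right]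
    refine Finset.sum_congr rfl fun j _ => ?_
    rw [pair_smul_right, pair_smul_right, pair_mres, pair_mres, hpb]
  · have := hpb U le_rfl (Pi.single i 1) j
    rw [Finset.sum_eq_single i (by intro k _ hk; simp [hk]) (by simp), Pi.single_eq_same,
      one_smul, mres_self, hb, mres_self] at this
    rw [this, Pi.single_apply]
    simp [eq_comm]

theorem isVectorBundle_dual {E : S.Modules} (hE : IsVectorBundle E) : IsVectorBundle (dual E) := by
  intro x
  obtain ⟨U, hx, n, e, he⟩ := hE x
  obtain ⟨l, hl, -⟩ := he.exists_dual
  exact ⟨U, hx, n, l, hl⟩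

theorem isGen_iff_isFrame {M : S.Modules} {U : S.Opens} (s : Γ(M, U)) :
    IsGen M s ↔ IsFrame M (fun _ : Fin 1 => s) := by
  refine forall_congr' fun V => forall_congr' fun h => ?_
  simp only [Finset.univ_unique, Finset.sum_singleton]
  have : (fun c : Fin 1 → Γ(S, V) => c default • mres M h s) =
    (fun c : Γ(S, V) => c • mres M h s) ∘ (Equiv.funUnique (Fin 1) Γ(S, V)) := rfl
  rw [this]
  exact ((Equiv.funUnique (Fin 1) Γ(S, V)).bijective.of_comp_iff _).symm

theorem isInvertible_dual {L : S.Modules} (hL : IsInvertible L) : IsInvertible (dual L) := by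
  intro x
  obtain ⟨U, hx, s, hs⟩ := hL x
  obtain ⟨l, hl, -⟩ := ((isGen_iff_isFrame s).1 hs).exists_dual
  refine ⟨U, hx, l 0, (isGen_iff_isFrame _).2 ?_⟩
  convert hl using 2 with i
  rw [Subsingleton.elim i 0]

/-! ### The determinant of a vector bundle -/

/-- The ring homomorphism `Λ_R M → Λ_R' M'` induced by a semilinear map. -/
def extMap {R R' M M' : Type*} [CommRing R] [CommRing R'] [AddCommGroup M] [AddCommGroup M']
    [Module R M] [Module R' M'] (φ : R →+* R') (f : M →+ M') (hf : ∀ a x, f (a • x) = φ a • f x) :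
    ExteriorAlgebra R M →+* ExteriorAlgebra R' M' :=
  letI : Algebra R (ExteriorAlgebra R' M') := Algebra.compHom (ExteriorAlgebra R' M') φ
  (ExteriorAlgebra.lift R (A := ExteriorAlgebra R' M')
    ⟨{ toFun := fun x => ExteriorAlgebra.ι R' (f x)
       map_add' := fun x y => by rw [map_add, map_add]
       map_smul' := fun a x => by rw [hf, map_smul]; rfl },
     fun x => ExteriorAlgebra.ι_sq_zero (f x)⟩).toRingHom

section extMap

variable {R R' R'' M M' M'' : Type*} [CommRing R] [CommRing R'] [CommRing R''] [AddCommGroup M]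
  [AddCommGroup M'] [AddCommGroup M''] [Module R M] [Module R' M'] [Module R'' M'']
  (φ : R →+* R') (f : M →+ M') (hf : ∀ a x, f (a • x) = φ a • f x)

theorem extMap_ι (x : M) : extMap φ f hf (ExteriorAlgebra.ι R x) = ExteriorAlgebra.ι R' (f x) := by
  let := Algebra.compHom (ExteriorAlgebra R' M') φ
  exact ExteriorAlgebra.lift_ι_apply R _ _ x

theorem extMap_algebraMap (a : R) :
    extMap φ f hf (algebraMap R _ a) = algebraMap R' _ (φ a) := by
  let := Algebra.compHom (ExteriorAlgebra R' M') φ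
  exact AlgHom.commutes (ExteriorAlgebra.lift R (A := ExteriorAlgebra R' M') _) a

theorem extMap_smul (a : R) (ω : ExteriorAlgebra R M) :
    extMap φ f hf (a • ω) = φ a • extMap φ f hf ω := by
  rw [Algebra.smul_def, map_mul, extMap_algebraMap, ← Algebra.smul_def]

theorem extMap_ιMulti {n : ℕ} (v : Fin n → M) :
    extMap φ f hf (ExteriorAlgebra.ιMulti R n v) =
      ExteriorAlgebra.ιMulti R' n (fun i => f (v i)) := by
  rw [ExteriorAlgebra.ιMulti_apply, ExteriorAlgebra.ιMulti_apply, map_list_prod, List.map_ofFn]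
  congr 2
  funext i
  exact extMap_ι φ f hf (v i)

theorem extMap_mem {n : ℕ} {ω : ExteriorAlgebra R M} (hω : ω ∈ ⋀[R]^n M) :
    extMap φ f hf ω ∈ ⋀[R']^n M' := by
  rw [← ExteriorAlgebra.ιMulti_span_fixedDegree] at hω
  induction hω using Submodule.span_induction with
  | mem x h =>
    obtain ⟨v, rfl⟩ := h
    rw [extMap_ιMulti, ← ExteriorAlgebra.ιMulti_span_fixedDegree]
    exact Submodule.subset_span ⟨_, rfl⟩
  | zero => rw [map_zero]; exact Submodule.zero_mem _
  | add x y _ _ hx hy => rw [map_add]; exact Submodule.add_mem _ hx hy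
  | smul a x _ hx => rw [extMap_smul]; exact Submodule.smul_mem _ _ hx

theorem extMap_extMap (ψ : R' →+* R'') (g : M' →+ M'') (hg : ∀ a x, g (a • x) = ψ a • g x)
    (χ : R →+* R'') (k : M →+ M'') (hk : ∀ a x, k (a • x) = χ a • k x)
    (h1 : ∀ a, ψ (φ a) = χ a) (h2 : ∀ x, g (f x) = k x) (ω : ExteriorAlgebra R M) :
    extMap ψ g hg (extMap φ f hf ω) = extMap χ k hk ω := by
  induction ω using ExteriorAlgebra.induction with
  | algebraMap r => simp only [extMap_algebraMap, h1]
  | ι x => simp only [extMap_ι, h2]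
  | mul a b ha hb => simp only [map_mul, ha, hb]
  | add a b ha hb => simp only [map_add, ha, hb]

theorem extMap_id (φ : R →+* R) (f : M →+ M) (hf : ∀ a x, f (a • x) = φ a • f x)
    (h1 : ∀ a, φ a = a) (h2 : ∀ x, f x = x) (ω : ExteriorAlgebra R M) : extMap φ f hf ω = ω := by
  induction ω using ExteriorAlgebra.induction with
  | algebraMap r => simp only [extMap_algebraMap, h1]
  | ι x => simp only [extMap_ι, h2]
  | mul a b ha hb => simp only [map_mul, ha, hb]
  | add a b ha hb => simp only [map_add, ha, hb]

end extMap

/-- For an open set `U` on which `E` has constant rank `n`, this is `Λⁿ E(U)`; it is zero if the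
rank of `E` on `U` is not constant. -/
def DetSec {E : S.Modules} (hE : IsVectorBundle E) (U : S.Opens) :
    Submodule Γ(S, U) (ExteriorAlgebra Γ(S, U) Γ(E, U)) :=
  ⨆ (n : ℕ) (_ : ∀ x ∈ U, rank hE x = n), ⋀[Γ(S, U)]^n Γ(E, U)

/-- Restriction `Λ E(U) → Λ E(V)`. -/
def extRes (E : S.Modules) {U V : S.Opens} (h : V ≤ U) :
    ExteriorAlgebra Γ(S, U) Γ(E, U) →+* ExteriorAlgebra Γ(S, V) Γ(E, V) :=
  extMap (res h) (mres E h) (mres_smul E h)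

theorem extRes_mem {E : S.Modules} (hE : IsVectorBundle E) {U V : S.Opens} (h : V ≤ U)
    {ω : ExteriorAlgebra Γ(S, U) Γ(E, U)} (hω : ω ∈ DetSec hE U) :
    extRes E h ω ∈ DetSec hE V := by
  induction hω using Submodule.iSup_induction' with
  | mem n x hx =>
    induction hx using Submodule.iSup_induction' with
    | mem hn x hx =>
      exact Submodule.mem_iSup_of_mem n (Submodule.mem_iSup_of_mem (fun y hy => hn y (h hy))
        (extMap_mem _ _ _ hx))
    | zero => rw [map_zero]; exact Submodule.zero_mem _
    | add x y _ _ hx hy => rw [map_add]; exact Submodule.add_mem _ hx hy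
  | zero => rw [map_zero]; exact Submodule.zero_mem _
  | add x y _ _ hx hy => rw [map_add]; exact Submodule.add_mem _ hx hy

/-- Restriction of sections of `DetSec`. -/
def detRes {E : S.Modules} (hE : IsVectorBundle E) {U V : S.Opens} (h : V ≤ U) :
    DetSec hE U →+ DetSec hE V where
  toFun ω := ⟨extRes E h ω.1, extRes_mem hE _ ω.2⟩
  map_zero' := Subtype.ext (map_zero _)
  map_add' _ _ := Subtype.ext (map_add _ _ _)

theorem detRes_self {E : S.Modules} (hE : IsVectorBundle E) {U : S.Opens} (ω : DetSec hE U) :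
    detRes hE le_rfl ω = ω :=
  Subtype.ext (extMap_id _ _ (mres_smul E le_rfl) res_self (mres_self E) ω.1)

theorem detRes_detRes {E : S.Modules} (hE : IsVectorBundle E) {U V W : S.Opens} (h : V ≤ U)
    (h' : W ≤ V) (ω : DetSec hE U) : detRes hE h' (detRes hE h ω) = detRes hE (h'.trans h) ω :=
  Subtype.ext (extMap_extMap _ _ (mres_smul E h) _ _ (mres_smul E h') _ _
    (mres_smul E (h'.trans h)) (res_res h h') (mres_mres E h h') ω.1)

/-- The presheaf of abelian groups `U ↦ Λⁿ E(U)`, `n` the rank of `E` on `U`. -/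
def detAb {E : S.Modules} (hE : IsVectorBundle E) : TopCat.Presheaf Ab.{u} S where
  obj U := AddCommGrpCat.of (DetSec hE U.unop)
  map f := AddCommGrpCat.ofHom (detRes hE (leOfHom f.unop))
  map_id _ := by
    ext ω
    exact congrArg Subtype.val (detRes_self hE ω)
  map_comp f g := by
    ext ω
    exact congrArg Subtype.val (detRes_detRes hE (leOfHom f.unop) (leOfHom g.unop) ω).symm

/-- The presheaf of modules `U ↦ Λⁿ E(U)`, `n` the rank of `E` on `U`. -/
def detPresheaf {E : S.Modules} (hE : IsVectorBundle E) : S.PresheafOfModules :=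
  letI : ∀ U : S.Opensᵒᵖ, Module (S.ringCatSheaf.obj.obj U) ((detAb hE).obj U) :=
    fun U => inferInstanceAs (Module Γ(S, U.unop) (DetSec hE U.unop))
  PresheafOfModules.ofPresheaf (detAb hE) fun _ _ f r ω =>
    Subtype.ext (extMap_smul _ _ (mres_smul E (leOfHom f.unop)) r ω.1)

/-- The determinant `Λ^max E` of a vector bundle. -/
def det {E : S.Modules} (hE : IsVectorBundle E) : S.Modules :=
  shf (detPresheaf hE)

theorem ιMulti_mem_detSec {E : S.Modules} (hE : IsVectorBundle E) {U : S.Opens} {n : ℕ}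
    {e : Fin n → Γ(E, U)} (he : IsFrame E e) :
    ExteriorAlgebra.ιMulti Γ(S, U) n e ∈ DetSec hE U := by
  refine Submodule.mem_iSup_of_mem n (Submodule.mem_iSup_of_mem (fun x hx => rank_apply hE he hx) ?_)
  rw [← ExteriorAlgebra.ιMulti_span_fixedDegree]
  exact Submodule.subset_span ⟨_, rfl⟩

/-- The section `e₁ ∧ ⋯ ∧ eₙ` of the presheaf `detPresheaf` given by a frame. -/
def preWedge {E : S.Modules} (hE : IsVectorBundle E) {U : S.Opens} {n : ℕ}
    {e : Fin n → Γ(E, U)} (he : IsFrame E e) : (detPresheaf hE).presheaf.obj (op U) :=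
  (⟨ExteriorAlgebra.ιMulti Γ(S, U) n e, ιMulti_mem_detSec hE he⟩ : DetSec hE U)

/-- The generator `e₁ ∧ ⋯ ∧ eₙ` of `det E` given by a frame of `E`. -/
def wedge {E : S.Modules} (hE : IsVectorBundle E) {U : S.Opens} {n : ℕ}
    {e : Fin n → Γ(E, U)} (he : IsFrame E e) : Γ(det hE, U) :=
  toShf (detPresheaf hE) U (preWedge hE he)

theorem ιMulti_bijective {R M : Type*} [CommRing R] [AddCommGroup M] [Module R M] {n : ℕ}
    (b : Module.Basis (Fin n) R M) :
    Function.Bijective fun c : R => (c • exteriorPower.ιMulti R n b : ⋀[R]^n M) := by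
  let B := b.exteriorPower n
  have hcard : Nat.card (Set.powersetCard (Fin n) n) = 1 := by
    rw [Set.powersetCard.card]; simp
  obtain ⟨hs, ⟨s₀⟩⟩ := Nat.card_eq_one_iff_unique.1 hcard
  let _ : Unique (Set.powersetCard (Fin n) n) := ⟨⟨s₀⟩, fun s => Subsingleton.elim _ _⟩
  have hw : B s₀ = exteriorPower.ιMulti R n b := by
    rw [exteriorPower.basis_apply, exteriorPower.ιMulti_family]
    congr 1
    have h1 : (Set.powersetCard.ofFinEmbEquiv.symm s₀ : Fin n → Fin n) = id := 
      StrictMono.eq_id (OrderEmbedding.strictMono _)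
    rw [h1]
    rfl
  let φ : ⋀[R]^n M ≃ₗ[R] R := B.repr.trans (Finsupp.uniqueLinearEquiv R R s₀)
  have hφ : ∀ c : R, φ.symm c = c • exteriorPower.ιMulti R n b := by
    intro c
    rw [LinearEquiv.symm_apply_eq, map_smul, ← hw]
    have : φ (B s₀) = 1 := by
      simp only [φ, LinearEquiv.trans_apply, Module.Basis.repr_self]
      exact Finsupp.single_eq_same
    rw [this, smul_eq_mul, mul_one]
  have := φ.symm.bijective
  convert this using 1
  funext c
  exact (hφ c).symm

theorem isGen_wedge {E : S.Modules} (hE : IsVectorBundle E) {U : S.Opens} {n : ℕ}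
    {e : Fin n → Γ(E, U)} (he : IsFrame E e) : IsGen (det hE) (wedge hE he) := by
  refine isGen_toShf _ _ fun V h => ?_
  have key : Function.Bijective fun c : Γ(S, V) =>
      (c • ⟨_, ιMulti_mem_detSec hE (he.restrict h)⟩ : DetSec hE V) := by
    have hb : ⇑(he.restrict h).basis = fun i => mres E h (e i) :=
      funext fun i => IsFrame.basis_apply _ i
    have hbij := ιMulti_bijective (he.restrict h).basis
    rw [hb] at hbij
    by_cases hV : ∃ x, x ∈ V
    · obtain ⟨x, hx⟩ := hV
      have hle : DetSec hE V ≤ ⋀[Γ(S, V)]^n Γ(E, V) := by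
        refine iSup_le fun m => iSup_le fun hm => ?_
        rw [← hm x hx, rank_apply hE he (h hx)]
      refine ⟨fun c d hcd => hbij.1 (Subtype.ext ?_), fun ω => ?_⟩
      · simpa using congrArg Subtype.val hcd
      · obtain ⟨c, hc⟩ := hbij.2 ⟨ω.1, hle ω.2⟩
        refine ⟨c, Subtype.ext ?_⟩
        simpa using congrArg Subtype.val hc
    · have : Subsingleton Γ(S, V) :=
        ⟨fun a b => res_ext fun x hx => (hV ⟨x, hx⟩).elim⟩
      have : Subsingleton (DetSec hE V) := Module.subsingleton Γ(S, V) _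
      exact ⟨fun c d _ => Subsingleton.elim c d, fun ω => ⟨0, Subsingleton.elim _ _⟩⟩
  have h1 : pres (detPresheaf hE) h (preWedge hE he) =
      (⟨_, ιMulti_mem_detSec hE (he.restrict h)⟩ : DetSec hE V) :=
    Subtype.ext (extMap_ιMulti _ _ _ _)
  rw [h1]
  exact key

theorem isInvertible_det {E : S.Modules} (hE : IsVectorBundle E) : IsInvertible (det hE) := by
  intro x
  obtain ⟨U, hx, n, e, he⟩ := hE x
  exact ⟨U, hx, wedge hE he, isGen_wedge hE he⟩

/-! ### Tensor products of sheaves of modules -/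

/-- The presheaf tensor product `U ↦ L(U) ⊗ M(U)`. -/
def preTensor (L M : S.Modules) : S.PresheafOfModules :=
  PresheafOfModules.Monoidal.tensorObj (R := S.presheaf) L.val M.val

/-- The tensor product of `𝒪_S`-modules. -/
def tensor (L M : S.Modules) : S.Modules :=
  shf (preTensor L M)

/-- The tensor product of morphisms of `𝒪_S`-modules. -/
def tensorMap {L L' M M' : S.Modules} (f : L ⟶ L') (g : M ⟶ M') : tensor L M ⟶ tensor L' M' :=
  (PresheafOfModules.sheafification (𝟙 S.ringCatSheaf.obj)).map
    (PresheafOfModules.Monoidal.tensorHom (R := S.presheaf) f.val g.val)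

theorem tensorMap_id (L M : S.Modules) : tensorMap (𝟙 L) (𝟙 M) = 𝟙 (tensor L M) := by
  have : PresheafOfModules.Monoidal.tensorHom (R := S.presheaf) (𝟙 L.val) (𝟙 M.val) =
      𝟙 (preTensor L M) := by
    exact MonoidalCategory.id_tensorHom_id (C := PresheafOfModules (S.presheaf ⋙ forget₂ CommRingCat RingCat)) L.val M.val
  exact (congrArg _ this).trans (CategoryTheory.Functor.map_id _ _)

theorem tensorMap_comp {L L' L'' M M' M'' : S.Modules} (f : L ⟶ L') (f' : L' ⟶ L'')
    (g : M ⟶ M') (g' : M' ⟶ M'') :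
    tensorMap (f ≫ f') (g ≫ g') = tensorMap f g ≫ tensorMap f' g' := by
  have : PresheafOfModules.Monoidal.tensorHom (R := S.presheaf) (f.val ≫ f'.val) (g.val ≫ g'.val) =
      PresheafOfModules.Monoidal.tensorHom (R := S.presheaf) f.val g.val ≫
        PresheafOfModules.Monoidal.tensorHom (R := S.presheaf) f'.val g'.val := by
    exact (MonoidalCategory.tensorHom_comp_tensorHom (C := PresheafOfModules (S.presheaf ⋙ forget₂ CommRingCat RingCat)) f.val g.val f'.val g'.val).symm
  exact (congrArg _ this).trans (CategoryTheory.Functor.map_comp _ _ _)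

/-- The tensor product of isomorphisms of `𝒪_S`-modules. -/
def tensorIso {L L' M M' : S.Modules} (f : L ≅ L') (g : M ≅ M') : tensor L M ≅ tensor L' M' where
  hom := tensorMap f.hom g.hom
  inv := tensorMap f.inv g.inv
  hom_inv_id := by rw [← tensorMap_comp, f.hom_inv_id, g.hom_inv_id, tensorMap_id]
  inv_hom_id := by rw [← tensorMap_comp, f.inv_hom_id, g.inv_hom_id, tensorMap_id]

/-- The section `s ⊗ t` of the presheaf tensor product. -/
def preTmul {L M : S.Modules} {U : S.Opens} (s : Γ(L, U)) (t : Γ(M, U)) :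
    (preTensor L M).presheaf.obj (op U) :=
  (TensorProduct.tmul Γ(S, U) s t : TensorProduct Γ(S, U) Γ(L, U) Γ(M, U))

/-- The section `s ⊗ t` of `L ⊗ M`. -/
def tmul {L M : S.Modules} {U : S.Opens} (s : Γ(L, U)) (t : Γ(M, U)) : Γ(tensor L M, U) :=
  toShf (preTensor L M) U (preTmul s t)

theorem mres_tmul {L M : S.Modules} {U V : S.Opens} (h : V ≤ U) (s : Γ(L, U)) (t : Γ(M, U)) :
    mres (tensor L M) h (tmul s t) = tmul (mres L h s) (mres M h t) :=
  (toShf_pres (preTensor L M) h (preTmul s t)).symm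

theorem tensorMap_tmul {L L' M M' : S.Modules} (f : L ⟶ L') (g : M ⟶ M') {U : S.Opens}
    (s : Γ(L, U)) (t : Γ(M, U)) :
    (tensorMap f g).app U (tmul s t) = tmul (f.app U s) (g.app U t) := by
  have := (PresheafOfModules.sheafificationAdjunction (𝟙 S.ringCatSheaf.obj)).unit.naturality
    (PresheafOfModules.Monoidal.tensorHom (R := S.presheaf) f.val g.val)
  have h2 := congrArg (fun φ => (PresheafOfModules.Hom.app φ (op U)).hom (preTmul s t)) this
  exact h2.symm

theorem tmul_bijective {R M N : Type*} [CommRing R] [AddCommGroup M] [AddCommGroup N] [Module R M]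
    [Module R N] {s : M} {t : N} (hs : Function.Bijective fun c : R => c • s)
    (ht : Function.Bijective fun c : R => c • t) :
    Function.Bijective fun c : R => (c • TensorProduct.tmul R s t : TensorProduct R M N) := by
  let φ : R ≃ₗ[R] M := LinearEquiv.ofBijective (LinearMap.toSpanSingleton R M s) hs
  let ψ : R ≃ₗ[R] N := LinearEquiv.ofBijective (LinearMap.toSpanSingleton R N t) ht
  have := ((TensorProduct.lid R R).symm.trans (TensorProduct.congr φ ψ)).bijective
  convert this using 1
  funext c
  simp [φ, ψ, TensorProduct.smul_tmul', TensorProduct.tmul_smul, LinearMap.toSpanSingleton]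

theorem IsGen.tmul {L M : S.Modules} {U : S.Opens} {s : Γ(L, U)} {t : Γ(M, U)} (hs : IsGen L s)
    (ht : IsGen M t) : IsGen (tensor L M) (tmul s t) :=
  isGen_toShf _ _ fun V h => tmul_bijective (hs V h) (ht V h)

theorem IsGen.restrict {L : S.Modules} {U V : S.Opens} {s : Γ(L, U)} (hs : IsGen L s)
    (h : V ≤ U) : IsGen L (mres L h s) := by
  intro W hW
  simpa only [mres_mres] using hs W (hW.trans h)

theorem isInvertible_tensor {L M : S.Modules} (hL : IsInvertible L) (hM : IsInvertible M) :
    IsInvertible (tensor L M) := by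
  intro x
  obtain ⟨U, hU, s, hs⟩ := hL x
  obtain ⟨V, hV, t, ht⟩ := hM x
  exact ⟨U ⊓ V, ⟨hU, hV⟩, _, (hs.restrict inf_le_left).tmul (ht.restrict inf_le_right)⟩

/-! ### Graded line bundles -/

/-- An `A`-graded invertible `𝒪_S`-module `[L] = (L, a)`. -/
structure GradedLine (A : Type) (S : Scheme.{u}) where
  /-- The underlying sheaf of modules. -/
  mod : S.Modules
  isInvertible : IsInvertible mod
  /-- The degree, a locally constant function. -/
  deg : LocallyConstant S A

/-- Morphisms `(L, a) → (M, b)` exist only if `a = b`, and are then isomorphisms `L ≃ M`. -/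
@[ext]
structure GradedLine.Hom {A : Type} (L M : GradedLine A S) where
  /-- The underlying isomorphism. -/
  iso : L.mod ≅ M.mod
  deg_eq : L.deg = M.deg

instance (A : Type) : Category (GradedLine A S) where
  Hom L M := GradedLine.Hom L M
  id L := ⟨Iso.refl _, rfl⟩
  comp f g := ⟨f.iso ≪≫ g.iso, f.deg_eq.trans g.deg_eq⟩
  id_comp f := GradedLine.Hom.ext (Iso.refl_trans f.iso)
  comp_id f := GradedLine.Hom.ext (Iso.trans_refl f.iso)
  assoc f g h := GradedLine.Hom.ext (Iso.trans_assoc f.iso g.iso h.iso)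

/-- The action of a morphism of graded line bundles on sections. -/
def GradedLine.Hom.app {A : Type} {L M : GradedLine A S} (f : L ⟶ M) {U : S.Opens}
    (s : Γ(L.mod, U)) : Γ(M.mod, U) :=
  (GradedLine.Hom.iso f).hom.app U s

/-- The tensor product `[L] ⊗ [M] = (L ⊗ M, a + b)`. -/
def GradedLine.tensor {A : Type} [Add A] (L M : GradedLine A S) : GradedLine A S where
  mod := Pfaff.tensor L.mod M.mod
  isInvertible := isInvertible_tensor L.isInvertible M.isInvertible
  deg := L.deg + M.deg

/-- The inverse `[L]⁻¹ = (L*, -a)`. -/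
def GradedLine.dual {A : Type} [Neg A] (L : GradedLine A S) : GradedLine A S where
  mod := Pfaff.dual L.mod
  isInvertible := isInvertible_dual L.isInvertible
  deg := -L.deg

/-- The functor `Δ : [L] ↦ [L] ⊗ [L]`, `[f] ↦ [f] ⊗ [f]`. -/
def squareFunctor (A : Type) [Add A] (S : Scheme.{u}) : GradedLine A S ⥤ GradedLine A S where
  obj L := L.tensor L
  map {L M} f :=
    { iso := tensorIso (GradedLine.Hom.iso f) (GradedLine.Hom.iso f)
      deg_eq := congrArg (fun a => a + a) (GradedLine.Hom.deg_eq f) }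
  map_id L := GradedLine.Hom.ext (Iso.ext (tensorMap_id L.mod L.mod))
  map_comp f g := GradedLine.Hom.ext (Iso.ext (tensorMap_comp _ _ _ _))

/-- The projection `π` from `ℤ`-graded to `ℤ/2`-graded line bundles. -/
def modTwo (S : Scheme.{u}) : GradedLine ℤ S ⥤ GradedLine (ZMod 2) S where
  obj L := ⟨L.mod, L.isInvertible, L.deg.map (fun a : ℤ => (a : ZMod 2))⟩
  map {L M} f :=
    { iso := GradedLine.Hom.iso (L := L) (M := M) f
      deg_eq := congrArg (LocallyConstant.map fun a : ℤ => (a : ZMod 2))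
        (GradedLine.Hom.deg_eq f) }
  map_id _ := rfl
  map_comp _ _ := rfl

/-- The graded determinant `(Λ^max E, rank E)` of a vector bundle. -/
def gradedDet (A : Type) [NatCast A] {E : S.Modules} (hE : IsVectorBundle E) : GradedLine A S where
  mod := det hE
  isInvertible := isInvertible_det hE
  deg := (rank hE).map (fun n : ℕ => (n : A))

/-! ### The category of skew-symmetric complexes of length one -/

/-- The transpose on sections: `ℓ ↦ ℓ ∘ f`. -/
def dualSecMap {E F : S.Modules} (f : E ⟶ F) (U : S.Opens) : DualSec F U →+ DualSec E U where
  toFun φ := ⟨fun V x => φ.1 V (f.app V.1 x),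
    fun V hV x y => (congrArg (φ.1 ⟨V, hV⟩) (map_add (f.app V).hom x y)).trans (φ.2.1 V hV _ _),
    fun V hV a x => (congrArg (φ.1 ⟨V, hV⟩) (f.app_smul a x)).trans (φ.2.2.1 V hV _ _),
    fun V hV W hW x => (congrArg (φ.1 ⟨W, hW.trans hV⟩) (app_mres f hW x)).trans
      (φ.2.2.2 V hV W hW _)⟩
  map_zero' := rfl
  map_add' _ _ := rfl

/-- The transpose `f* : F* → E*` of a morphism `f : E → F`. -/
def dualMap {E F : S.Modules} (f : E ⟶ F) : dual F ⟶ dual E :=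
  SheafOfModules.Hom.mk <| PresheafOfModules.homMk
    { app := fun U => AddCommGrpCat.ofHom (dualSecMap f U.unop)
      naturality := fun _ _ _ => rfl }
    fun _ _ _ => rfl

theorem pair_dualMap {E F : S.Modules} (f : E ⟶ F) {U : S.Opens} (l : Γ(dual F, U))
    (x : Γ(E, U)) : pair ((dualMap f).app U l) x = pair l (f.app U x) := rfl

theorem dualMap_id (E : S.Modules) : dualMap (𝟙 E) = 𝟙 (dual E) := rfl

theorem dualMap_comp {E F G : S.Modules} (f : E ⟶ F) (g : F ⟶ G) :
    dualMap (f ≫ g) = dualMap g ≫ dualMap f := rfl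

/-- A complex `0 → E → E* → 0` in degrees `0` and `1`, with `E` a vector bundle and `α : E → E*`
skew-symmetric. -/
structure SkewComplex (S : Scheme.{u}) where
  /-- The bundle in degree `0`. -/
  E : S.Modules
  isVectorBundle : IsVectorBundle E
  /-- The differential. -/
  α : E ⟶ dual E
  skew : ∀ (U : S.Opens) (x y : Γ(E, U)), pair (α.app U x) y = -pair (α.app U y) x

namespace SkewComplex

/-- Morphisms of complexes. -/
@[ext]
structure ChainMap (X Y : SkewComplex S) where
  /-- The component in degree `0`. -/
  f₀ : X.E ⟶ Y.E
  /-- The component in degree `1`. -/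
  f₁ : dual X.E ⟶ dual Y.E
  comm : X.α ≫ f₁ = f₀ ≫ Y.α

namespace ChainMap

/-- The identity. -/
def id (X : SkewComplex S) : ChainMap X X := ⟨𝟙 _, 𝟙 _, by simp⟩

/-- Composition, in diagrammatic order. -/
def comp {X Y Z : SkewComplex S} (f : ChainMap X Y) (g : ChainMap Y Z) : ChainMap X Z :=
  ⟨f.f₀ ≫ g.f₀, f.f₁ ≫ g.f₁, by
    rw [← Category.assoc, f.comm, Category.assoc, g.comm, Category.assoc]⟩

/-- Homotopy of morphisms of complexes. -/
def Homotopic {X Y : SkewComplex S} (f g : ChainMap X Y) : Prop :=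
  ∃ h : dual X.E ⟶ Y.E, f.f₀ - g.f₀ = X.α ≫ h ∧ f.f₁ - g.f₁ = h ≫ Y.α

/-- `g : Y → X` is the shifted dual `f*[-1]` of `f : X → Y`: in degree `1` it is the transpose of
`f₀`, and in degree `0` it is the transpose of `f₁` under the identifications `E** = E` and
`F** = F`, that is, the morphism whose transpose is `f₁`. -/
def IsShiftedDual {X Y : SkewComplex S} (f : ChainMap X Y) (g : ChainMap Y X) : Prop :=
  g.f₁ = dualMap f.f₀ ∧ f.f₁ = dualMap g.f₀

/-- The shifted dual `f*[-1]` is a homotopy inverse of `f`. -/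
def IsIsometry {X Y : SkewComplex S} (f : ChainMap X Y) : Prop :=
  ∃ g : ChainMap Y X, f.IsShiftedDual g ∧ (f.comp g).Homotopic (ChainMap.id X) ∧
    (g.comp f).Homotopic (ChainMap.id Y)

theorem Homotopic.refl {X Y : SkewComplex S} (f : ChainMap X Y) : f.Homotopic f :=
  ⟨0, by simp, by simp⟩

theorem Homotopic.trans {X Y : SkewComplex S} {f g k : ChainMap X Y} (h : f.Homotopic g)
    (h' : g.Homotopic k) : f.Homotopic k := by
  obtain ⟨a, ha, ha'⟩ := h
  obtain ⟨b, hb, hb'⟩ := h'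
  refine ⟨a + b, ?_, ?_⟩
  · rw [Preadditive.comp_add, ← ha, ← hb]; abel
  · rw [Preadditive.add_comp, ← ha', ← hb']; abel

theorem Homotopic.comp_left {X Y Z : SkewComplex S} (k : ChainMap X Y) {f g : ChainMap Y Z}
    (h : f.Homotopic g) : (k.comp f).Homotopic (k.comp g) := by
  obtain ⟨a, ha, ha'⟩ := h
  refine ⟨k.f₁ ≫ a, ?_, ?_⟩
  · change k.f₀ ≫ f.f₀ - k.f₀ ≫ g.f₀ = _
    rw [← Preadditive.comp_sub, ha, ← Category.assoc, ← Category.assoc, k.comm]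
  · change k.f₁ ≫ f.f₁ - k.f₁ ≫ g.f₁ = _
    rw [← Preadditive.comp_sub, ha', Category.assoc]

theorem Homotopic.comp_right {X Y Z : SkewComplex S} {f g : ChainMap X Y}
    (h : f.Homotopic g) (k : ChainMap Y Z) : (f.comp k).Homotopic (g.comp k) := by
  obtain ⟨a, ha, ha'⟩ := h
  refine ⟨a ≫ k.f₀, ?_, ?_⟩
  · change f.f₀ ≫ k.f₀ - g.f₀ ≫ k.f₀ = _
    rw [← Preadditive.sub_comp, ha, Category.assoc]
  · change f.f₁ ≫ k.f₁ - g.f₁ ≫ k.f₁ = _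
    rw [← Preadditive.sub_comp, ha', Category.assoc, Category.assoc, k.comm]

theorem assoc {X Y Z W : SkewComplex S} (f : ChainMap X Y) (g : ChainMap Y Z)
    (h : ChainMap Z W) : (f.comp g).comp h = f.comp (g.comp h) :=
  ChainMap.ext (Category.assoc _ _ _) (Category.assoc _ _ _)

theorem id_comp {X Y : SkewComplex S} (f : ChainMap X Y) : (ChainMap.id X).comp f = f :=
  ChainMap.ext (Category.id_comp _) (Category.id_comp _)

theorem comp_id {X Y : SkewComplex S} (f : ChainMap X Y) : f.comp (ChainMap.id Y) = f :=
  ChainMap.ext (Category.comp_id _) (Category.comp_id _)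

theorem isIsometry_id (X : SkewComplex S) : (ChainMap.id X).IsIsometry := by
  refine ⟨ChainMap.id X, ⟨(dualMap_id _).symm, (dualMap_id _).symm⟩, ?_, ?_⟩ <;>
  · rw [id_comp]; exact Homotopic.refl _

theorem Homotopic.comp_inverse {X Y Z : SkewComplex S} {f : ChainMap X Y} {f' : ChainMap Y X}
    {g : ChainMap Y Z} {g' : ChainMap Z Y} (hf : (f.comp f').Homotopic (ChainMap.id X))
    (hg : (g.comp g').Homotopic (ChainMap.id Y)) :
    ((f.comp g).comp (g'.comp f')).Homotopic (ChainMap.id X) := by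
  have h1 := Homotopic.comp_left f (Homotopic.comp_right hg f')
  rw [id_comp] at h1
  have h2 := h1.trans hf
  rwa [assoc, ← assoc g]

theorem IsIsometry.comp {X Y Z : SkewComplex S} {f : ChainMap X Y} {g : ChainMap Y Z}
    (hf : f.IsIsometry) (hg : g.IsIsometry) : (f.comp g).IsIsometry := by
  obtain ⟨f', ⟨hf1, hf2⟩, hf3, hf4⟩ := hf
  obtain ⟨g', ⟨hg1, hg2⟩, hg3, hg4⟩ := hg
  refine ⟨g'.comp f', ⟨?_, ?_⟩, hf3.comp_inverse hg3, hg4.comp_inverse hf4⟩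
  · change g'.f₁ ≫ f'.f₁ = dualMap (f.f₀ ≫ g.f₀)
    rw [hf1, hg1, dualMap_comp]
  · change f.f₁ ≫ g.f₁ = dualMap (g'.f₀ ≫ f'.f₀)
    rw [hf2, hg2, dualMap_comp]

end ChainMap

/-- Morphisms of skew-symmetric complexes: the morphisms of complexes `f` such that `f*[-1]` is a
homotopy inverse of `f`. -/
@[ext]
structure Hom (X Y : SkewComplex S) extends ChainMap X Y where
  isIsometry : toChainMap.IsIsometry

instance : Category (SkewComplex S) where
  Hom X Y := Hom X Y
  id X := ⟨ChainMap.id X, ChainMap.isIsometry_id X⟩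
  comp f g := ⟨f.toChainMap.comp g.toChainMap, f.isIsometry.comp g.isIsometry⟩
  id_comp f := Hom.ext (Category.id_comp _) (Category.id_comp _)
  comp_id f := Hom.ext (Category.comp_id _) (Category.comp_id _)
  assoc f g h := Hom.ext (Category.assoc _ _ _) (Category.assoc _ _ _)

/-- The morphism of complexes underlying a morphism of skew-symmetric complexes. -/
def Hom.chain {X Y : SkewComplex S} (f : X ⟶ Y) : ChainMap X Y :=
  Hom.toChainMap f

/-- `f` is homotopic to the identity. -/
def HomotopicToId {X : SkewComplex S} (f : X ⟶ X) : Prop :=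
  (Hom.chain f).Homotopic (ChainMap.id X)

/-! ### The determinant of a complex -/

/-- The determinant `det E ⊗ (det E*)⁻¹` of the complex `E → E*`. -/
def detLine (X : SkewComplex S) : GradedLine ℤ S :=
  (gradedDet ℤ X.isVectorBundle).tensor (gradedDet ℤ (isVectorBundle_dual X.isVectorBundle)).dual

/-- The matrix, in frames `e` of `E`, `ε` of `E*`, `φ` of `F` and `ψ` of `F*`, of the morphism
`(α_E  u ; -f₀  v) : E ⊕ F* → E* ⊕ F`, where `u` and `v` are given by their values on `ψ`. -/
def coneMatrix {X Y : SkewComplex S} (f : X ⟶ Y) {U : S.Opens} {n m : ℕ}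
    (e : Fin n → Γ(X.E, U)) {ε : Fin n → Γ(dual X.E, U)} (hε : IsFrame (dual X.E) ε)
    {φ : Fin m → Γ(Y.E, U)} (hφ : IsFrame Y.E φ) (u : Fin m → Γ(dual X.E, U))
    (v : Fin m → Γ(Y.E, U)) : Matrix (Fin n ⊕ Fin m) (Fin n ⊕ Fin m) Γ(S, U) :=
  Matrix.fromBlocks
    (Matrix.of fun i j => hε.basis.repr (X.α.app U (e j)) i)
    (Matrix.of fun i j => hε.basis.repr (u j) i)
    (Matrix.of fun i j => -hφ.basis.repr ((Hom.chain f).f₀.app U (e j)) i)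
    (Matrix.of fun i j => hφ.basis.repr (v j) i)

/-- `d : Det X → Det Y` is the determinant of `f : X → Y`: the isomorphism
`det E ⊗ (det E*)⁻¹ ≃ det F ⊗ (det F*)⁻¹` that comes from the acyclic complex
`0 → E → E* ⊕ F → F* → 0` with differentials `(α_E, -f₀)` and `(f₁  α_F)`. Locally, one chooses a
section `(u, v)` of `(f₁  α_F)`; then `d` is multiplication by the determinant of
`(α_E  u ; -f₀  v) : E ⊕ F* → E* ⊕ F`. -/
def IsDeterminant {X Y : SkewComplex S} (f : X ⟶ Y) (d : X.detLine ⟶ Y.detLine) : Prop :=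
  ∀ (U : S.Opens) (n m : ℕ) (e : Fin n → Γ(X.E, U)) (ε : Fin n → Γ(dual X.E, U))
    (φ : Fin m → Γ(Y.E, U)) (ψ : Fin m → Γ(dual Y.E, U))
    (he : IsFrame X.E e) (hε : IsFrame (dual X.E) ε) (hφ : IsFrame Y.E φ)
    (hψ : IsFrame (dual Y.E) ψ)
    (u : Fin m → Γ(dual X.E, U)) (v : Fin m → Γ(Y.E, U))
    (_ : ∀ j, (Hom.chain f).f₁.app U (u j) + Y.α.app U (v j) = ψ j)
    (σ : Γ(dual (det (isVectorBundle_dual X.isVectorBundle)), U))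
    (τ : Γ(dual (det (isVectorBundle_dual Y.isVectorBundle)), U))
    (_ : pair σ (wedge (isVectorBundle_dual X.isVectorBundle) hε) = 1)
    (_ : pair τ (wedge (isVectorBundle_dual Y.isVectorBundle) hψ) = 1),
    GradedLine.Hom.app d (tmul (wedge X.isVectorBundle he) σ) =
      (coneMatrix f e hε hφ u v).det • tmul (wedge Y.isVectorBundle hφ) τ

end SkewComplex

/-- The determinant functor on skew-symmetric complexes. -/
structure DeterminantFunctor (S : Scheme.{u}) where
  /-- The determinant of a morphism. -/
  map : ∀ {X Y : SkewComplex S}, (X ⟶ Y) → (X.detLine ⟶ Y.detLine)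
  isDeterminant : ∀ {X Y : SkewComplex S} (f : X ⟶ Y), SkewComplex.IsDeterminant f (map f)
  map_id : ∀ X : SkewComplex S, map (𝟙 X) = 𝟙 X.detLine
  map_comp : ∀ {X Y Z : SkewComplex S} (f : X ⟶ Y) (g : Y ⟶ Z), map (f ≫ g) = map f ≫ map g

/-- The underlying functor, `X ↦ det E ⊗ (det E*)⁻¹` on objects. -/
def DeterminantFunctor.toFunctor (D : DeterminantFunctor S) : SkewComplex S ⥤ GradedLine ℤ S where
  obj X := X.detLine
  map f := D.map f
  map_id X := D.map_id X
  map_comp f g := D.map_comp f g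

/-! ### Base change -/

section BaseChange

variable {S' : Scheme.{u}} (f : S' ⟶ S)

/-- The action on sections of a morphism `M → f_* M'`. -/
def pushApp {f : S' ⟶ S} {M : S.Modules} {M' : S'.Modules}
    (p : M ⟶ (Scheme.Modules.pushforward f).obj M') {U : S.Opens} (s : Γ(M, U)) :
    Γ(M', f ⁻¹ᵁ U) :=
  p.app U s

/-- `M → f_* M'` exhibits `M'` as the pullback of `M`: the adjoint morphism `f^* M → M'` is an
isomorphism. -/
def IsCartesian {f : S' ⟶ S} {M : S.Modules} {M' : S'.Modules}
    (p : M ⟶ (Scheme.Modules.pushforward f).obj M') : Prop :=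
  IsIso (((Scheme.Modules.pullbackPushforwardAdjunction f).homEquiv M M').symm p)

/-- An isomorphism `f^* X ≃ X'` of skew-symmetric complexes, given by the corresponding morphisms
`E → f_* E'` and `E* → f_* E'*`. -/
structure SkewComplex.BaseChange (X' : SkewComplex S') (X : SkewComplex S) where
  /-- The component in degree `0`. -/
  p₀ : X.E ⟶ (Scheme.Modules.pushforward f).obj X'.E
  /-- The component in degree `1`. -/
  p₁ : dual X.E ⟶ (Scheme.Modules.pushforward f).obj (dual X'.E)
  isCartesian₀ : IsCartesian p₀
  isCartesian₁ : IsCartesian p₁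
  pair_eq : ∀ (U : S.Opens) (l : Γ(dual X.E, U)) (x : Γ(X.E, U)),
    pair (pushApp p₁ l) (pushApp p₀ x) = f.app U (pair l x)
  comm : ∀ (U : S.Opens) (x : Γ(X.E, U)),
    pushApp p₁ (X.α.app U x) = X'.α.app (f ⁻¹ᵁ U) (pushApp p₀ x)

/-- An isomorphism `f^* L ≃ L'` of graded line bundles, given by the corresponding morphism
`L → f_* L'`. -/
structure GradedLine.BaseChange {A : Type} (L' : GradedLine A S') (L : GradedLine A S) where
  /-- The underlying morphism. -/
  p : L.mod ⟶ (Scheme.Modules.pushforward f).obj L'.mod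
  isCartesian : IsCartesian p
  deg_eq : ∀ x : S', L'.deg x = L.deg (f x)

variable {f}

/-- `g' : X' → Y'` is the pullback of `g : X → Y`. -/
def SkewComplex.BaseChange.IsPullbackHom {X' Y' : SkewComplex S'} {X Y : SkewComplex S}
    (p : X'.BaseChange f X) (q : Y'.BaseChange f Y) (g' : X' ⟶ Y') (g : X ⟶ Y) : Prop :=
  (∀ (U : S.Opens) (x : Γ(X.E, U)), pushApp q.p₀ ((Hom.chain g).f₀.app U x) =
    (Hom.chain g').f₀.app (f ⁻¹ᵁ U) (pushApp p.p₀ x)) ∧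
  ∀ (U : S.Opens) (l : Γ(dual X.E, U)), pushApp q.p₁ ((Hom.chain g).f₁.app U l) =
    (Hom.chain g').f₁.app (f ⁻¹ᵁ U) (pushApp p.p₁ l)

/-- `g' : L' → M'` is the pullback of `g : L → M`. -/
def GradedLine.BaseChange.IsPullbackHom {A : Type} {L' M' : GradedLine A S'}
    {L M : GradedLine A S} (p : L'.BaseChange f L) (q : M'.BaseChange f M) (g' : L' ⟶ M')
    (g : L ⟶ M) : Prop :=
  ∀ (U : S.Opens) (s : Γ(L.mod, U)),
    pushApp q.p (GradedLine.Hom.app g s) = GradedLine.Hom.app g' (pushApp p.p s)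

/-- The isomorphism `r : (f' ≫ f)^* X ≃ X''` is the composite of `p : f^* X ≃ X'` and
`q : f'^* X' ≃ X''`. -/
def SkewComplex.BaseChange.IsComp {S'' : Scheme.{u}} {f' : S'' ⟶ S'} {X'' : SkewComplex S''}
    {X' : SkewComplex S'} {X : SkewComplex S} (p : X'.BaseChange f X) (q : X''.BaseChange f' X')
    (r : X''.BaseChange (f' ≫ f) X) : Prop :=
  ∀ (U : S.Opens) (x : Γ(X.E, U)), pushApp r.p₀ x = pushApp q.p₀ (pushApp p.p₀ x)

/-- The isomorphism `r : (f' ≫ f)^* L ≃ L''` is the composite of `p : f^* L ≃ L'` and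
`q : f'^* L' ≃ L''`. -/
def GradedLine.BaseChange.IsComp {A : Type} {S'' : Scheme.{u}} {f' : S'' ⟶ S'}
    {L'' : GradedLine A S''} {L' : GradedLine A S'} {L : GradedLine A S} (p : L'.BaseChange f L)
    (q : L''.BaseChange f' L') (r : L''.BaseChange (f' ≫ f) L) : Prop :=
  ∀ (U : S.Opens) (s : Γ(L.mod, U)), pushApp r.p s = pushApp q.p (pushApp p.p s)

/-- Let `p : f^* X ≃ X'` and `b : f^* L ≃ L'`. The isomorphism `θ' : Det X' ≃ L' ⊗ L'` is the
pullback of `θ : Det X ≃ L ⊗ L`: if `θ` maps `(e₁ ∧ ⋯ ∧ eₙ) ⊗ (ε₁ ∧ ⋯ ∧ εₙ)⁻¹` to `s ⊗ t`, for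
frames `e` of `E` and `ε` of `E*`, then `θ'` maps
`(p e₁ ∧ ⋯ ∧ p eₙ) ⊗ (p ε₁ ∧ ⋯ ∧ p εₙ)⁻¹` to `b s ⊗ b t`. -/
def SkewComplex.BaseChange.IsCompatible {A : Type} {X' : SkewComplex S'} {X : SkewComplex S}
    {L' : GradedLine A S'} {L : GradedLine A S} (p : X'.BaseChange f X) (b : L'.BaseChange f L)
    (θ' : X'.detLine.mod ≅ tensor L'.mod L'.mod) (θ : X.detLine.mod ≅ tensor L.mod L.mod) : Prop :=
  ∀ (U : S.Opens) (n : ℕ) (e : Fin n → Γ(X.E, U)) (ε : Fin n → Γ(dual X.E, U))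
    (he : IsFrame X.E e) (hε : IsFrame (dual X.E) ε)
    (he' : IsFrame X'.E fun i => pushApp p.p₀ (e i))
    (hε' : IsFrame (dual X'.E) fun i => pushApp p.p₁ (ε i))
    (σ : Γ(dual (det (isVectorBundle_dual X.isVectorBundle)), U))
    (σ' : Γ(dual (det (isVectorBundle_dual X'.isVectorBundle)), f ⁻¹ᵁ U))
    (_ : pair σ (wedge (isVectorBundle_dual X.isVectorBundle) hε) = 1)
    (_ : pair σ' (wedge (isVectorBundle_dual X'.isVectorBundle) hε') = 1)
    (s t : Γ(L.mod, U)),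
    θ.hom.app U (tmul (wedge X.isVectorBundle he) σ) = tmul s t →
      θ'.hom.app (f ⁻¹ᵁ U) (tmul (wedge X'.isVectorBundle he') σ') =
        tmul (pushApp b.p s) (pushApp b.p t)

end BaseChange

end

end Pfaff

open Pfaff

/-!
Let `f : X → Y` be a morphism of skew-symmetric complexes, `X = (α : E → E*)` and `Y = (β : F →
F*)`. Choose local frames, and let `A`, `B` be the matrices of `α`, `β`, `P` and `Qᵀ` those of `f₀`,
`f₁` with respect to frames and dual frames. That the shifted dual of `f` is a homotopy inverse of
`f` says that `QP = 1 + HA` and `PQ = 1 + KB` for matrices `H`, `K` of homotopies, and since `2` is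
invertible these may be taken skew-symmetric (`exists_skew_homotopy`). Then `(Pᵀ, -K)` is a section
of `(Qᵀ B)`, and for this section the matrix of the cone that defines `Det f` is the skew-symmetric
matrix `(A Pᵀ; -P -K)`, called `skewCone`. So `Det f` is a square, and its Pfaffian, normalized by
the sign of the hyperbolic matrix, is the required square root, `pfIso`.

What has to be shown is a list of matrix identities, each of which exhibits a congruence `UᵀMU` of
skew-symmetric matrices with known `det U`: the Pfaffian does not depend on the homotopy `K`
(`pfIso_eq_of_homotopy`), it is multiplicative in `f` (`pfIso_comp`), it is `1` if `f` is homotopic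
to the identity (`pfIso_one_add`), and it changes by the right determinants under changes of frames
(`pfIso_change_basis`). Hence the local Pfaffians glue to an isomorphism `det E ≃ det F`
(`exists_pfaffian_iso`), functorial in `f`. The Pfaffian of a matrix is a polynomial with integral
coefficients whose square is the generic determinant (`exists_pfaffian`); its behaviour under
congruences (`pf_congr`) and block sums (`pfSum_diag`) holds up to sign because squares agree, and
the sign is found at the standard symplectic matrix.

The isomorphism `θ` sends `(e₁ ∧ ⋯ ∧ eₙ) ⊗ (e₁* ∧ ⋯ ∧ eₙ*)⁻¹` to `(e₁ ∧ ⋯ ∧ eₙ) ⊗ (e₁ ∧ ⋯ ∧ eₙ)`,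
and the determinant of `f` is defined as the conjugate by `θ` of the square of the Pfaffian. That it
is the morphism described by the cone in arbitrary frames and for arbitrary sections is
`isDeterminant_detHom`, which rests on `pfIso_sq` and on the independence of the section
(`det_cone_section`).

For base change, all matrices pull back, so the Pfaffians do (`pfCoeff_pushApp`). The point that
needs an argument is that frames pull back to frames for an abstract pullback `M → f_* M'`,
characterized by its adjoint `f^* M → M'` being an isomorphism (`IsCartesian.isFrame`). Conversely,
a morphism that maps local generators to local generators is a pullback (`isCartesian_of_isGen`).
-/

/-! ### The Pfaffian of a skew-symmetric matrix -/

namespace Pfaff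

open Matrix

theorem exists_perm_zero_one {n : ℕ} {i j : Fin (2 + n)} (hij : i ≠ j) :
    ∃ σ : Equiv.Perm (Fin (2 + n)), σ ⟨0, by omega⟩ = i ∧ σ ⟨1, by omega⟩ = j := by
  let z : Fin (2 + n) := ⟨0, by omega⟩
  let o : Fin (2 + n) := ⟨1, by omega⟩
  have hzo : z ≠ o := by simp [z, o, Fin.ext_iff]
  have hk : Equiv.swap z i j ≠ z := by
    rw [Ne, Equiv.swap_apply_eq_iff, Equiv.swap_apply_left]
    exact hij.symm
  refine ⟨Equiv.swap z i * Equiv.swap o (Equiv.swap z i j), ?_, ?_⟩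
  · change Equiv.swap z i (Equiv.swap o _ z) = i
    rw [Equiv.swap_apply_of_ne_of_ne hzo hk.symm, Equiv.swap_apply_left]
  · change Equiv.swap z i (Equiv.swap o _ o) = j
    rw [Equiv.swap_apply_left, Equiv.swap_apply_self]

/-- The determinant of a skew-symmetric matrix is a square. Over a field the Schur complement of an
invertible `2 × 2` block is again skew-symmetric, which allows an induction on the size. -/
theorem isSquare_det_of_skew {K : Type*} [Field K] (h2 : (2 : K) ≠ 0) (n : ℕ)
    (M : Matrix (Fin n) (Fin n) K) (hM : Mᵀ = -M) : IsSquare M.det := by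
  induction n using Nat.strong_induction_on with
  | _ n ih =>
  have hdiag : ∀ i, M i i = 0 := by
    intro i
    have h : M i i = -M i i := congrFun (congrFun hM i) i
    have h' : 2 * M i i = 0 := by linear_combination h
    simpa [h2] using h'
  by_cases h0 : ∃ i j, M i j ≠ 0
  · obtain ⟨i, j, hij⟩ := h0
    have hne : i ≠ j := by rintro rfl; exact hij (hdiag i)
    obtain ⟨k, rfl⟩ : ∃ k, n = 2 + k := by
      refine ⟨n - 2, ?_⟩
      have := i.2; have := j.2; have : (i : ℕ) ≠ j := fun h => hne (Fin.ext h)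
      omega
    -- move a nonzero entry to the position `(0, 1)`
    obtain ⟨σ, hi, hj⟩ := exists_perm_zero_one hne
    let e : Fin 2 ⊕ Fin k ≃ Fin (2 + k) := finSumFinEquiv.trans σ
    have he0 : e (Sum.inl 0) = i := by rw [← hi]; rfl
    have he1 : e (Sum.inl 1) = j := by rw [← hj]; rfl
    let N := M.submatrix e e
    have hN : Nᵀ = -N := by
      change (M.submatrix e e)ᵀ = -(M.submatrix e e)
      rw [transpose_submatrix, hM]; rfl
    have hNdet : N.det = M.det := det_submatrix_equiv_self e M
    have hB : N.toBlocks₁₁ = !![0, M i j; -M i j, 0] := by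
      have hji : M j i = -M i j := congrFun (congrFun hM i) j
      ext a b
      fin_cases a <;> fin_cases b <;> simp [N, toBlocks₁₁, he0, he1, hdiag, hji]
    have hAt : N.toBlocks₁₁ᵀ = -N.toBlocks₁₁ := by
      ext a b; exact congrFun (congrFun hN (Sum.inl a)) (Sum.inl b)
    have hDt : N.toBlocks₂₂ᵀ = -N.toBlocks₂₂ := by
      ext a b; exact congrFun (congrFun hN (Sum.inr a)) (Sum.inr b)
    have hBt : N.toBlocks₁₂ᵀ = -N.toBlocks₂₁ := by
      ext a b; exact congrFun (congrFun hN (Sum.inr a)) (Sum.inl b)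
    have hCt : N.toBlocks₂₁ᵀ = -N.toBlocks₁₂ := by
      ext a b; exact congrFun (congrFun hN (Sum.inl a)) (Sum.inr b)
    have hAdet : N.toBlocks₁₁.det = M i j * M i j := by
      rw [hB, det_fin_two_of]; ring
    have hu : IsUnit N.toBlocks₁₁.det := by
      rw [hAdet]; exact (mul_ne_zero hij hij).isUnit
    let := N.toBlocks₁₁.invertibleOfIsUnitDet hu
    rw [← hNdet, ← fromBlocks_toBlocks N, det_fromBlocks₁₁, hAdet]
    refine IsSquare.mul ⟨_, rfl⟩ (ih k (by omega) _ ?_)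
    rw [transpose_sub, transpose_mul, transpose_mul, hDt, hBt, hCt, invOf_eq_nonsing_inv,
      transpose_nonsing_inv, hAt]
    have : (-N.toBlocks₁₁)⁻¹ = -N.toBlocks₁₁⁻¹ := by
      refine inv_eq_right_inv ?_
      rw [neg_mul_neg, mul_nonsing_inv _ hu]
    rw [this]
    simp [Matrix.mul_assoc, sub_eq_add_neg, add_comm]
  · push Not at h0
    have : M = 0 := by ext a b; exact h0 a b
    subst this
    rcases Nat.eq_zero_or_pos n with rfl | hn
    · simp
    · have : Nonempty (Fin n) := ⟨⟨0, hn⟩⟩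
      rw [Matrix.det_zero]; exact IsSquare.zero

/-- The generic alternating matrix. The variables `X (i, j)` with `j ≤ i` do not occur. -/
noncomputable def genericSkew (N : ℕ) :
    Matrix (Fin N) (Fin N) (MvPolynomial (Fin N × Fin N) ℤ) :=
  Matrix.of fun i j =>
    if i < j then MvPolynomial.X (i, j) else if j < i then -MvPolynomial.X (j, i) else 0

theorem genericSkew_transpose (N : ℕ) : (genericSkew N)ᵀ = -genericSkew N := by
  ext1 i j
  simp only [genericSkew, transpose_apply, of_apply, Matrix.neg_apply]
  rcases lt_trichotomy i j with h | h | h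
  · simp [h, h.not_gt]
  · simp [h]
  · simp [h, h.not_gt]

/-- The standard symplectic matrix: diagonal blocks `(0 1; -1 0)`. -/
def stdSymp (N : ℕ) : Matrix (Fin N) (Fin N) ℤ :=
  Matrix.of fun i j => if (i : ℕ) / 2 = (j : ℕ) / 2 then ((j : ℕ) : ℤ) - ((i : ℕ) : ℤ) else 0

theorem stdSymp_transpose (N : ℕ) : (stdSymp N)ᵀ = -stdSymp N := by
  ext1 i j
  simp only [stdSymp, transpose_apply, of_apply, Matrix.neg_apply]
  by_cases h : (i : ℕ) / 2 = (j : ℕ) / 2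
  · simp [h]
  · simp [h, Ne.symm h]

theorem det_stdSymp {N : ℕ} (hN : Even N) : (stdSymp N).det = 1 := by
  obtain ⟨q, rfl⟩ := hN.two_dvd
  rw [mul_comm]
  have h : (stdSymp (q * 2)).submatrix finProdFinEquiv finProdFinEquiv =
      Matrix.kroneckerMap (· * ·) (1 : Matrix (Fin q) (Fin q) ℤ) !![0, 1; -1, 0] := by
    ext ⟨a, b⟩ ⟨c, d⟩
    have hdiv : ∀ (x : Fin q) (y : Fin 2), ((y : ℕ) + 2 * (x : ℕ)) / 2 = x := by
      intro x y; have := y.2; omega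
    simp only [stdSymp, submatrix_apply, of_apply, finProdFinEquiv_apply_val, hdiv,
      kroneckerMap_apply, one_apply, Fin.val_inj]
    by_cases hac : a = c
    · subst hac
      fin_cases b <;> fin_cases d <;> simp
    · simp [hac]
  rw [← det_submatrix_equiv_self finProdFinEquiv, h, det_kronecker]
  simp [det_fin_two_of]

/-- The specialization of a polynomial in the entries of a matrix. -/
noncomputable def evalAt {N : ℕ} {R : Type*} [CommRing R] (M : Matrix (Fin N) (Fin N) R) :
    MvPolynomial (Fin N × Fin N) ℤ →+* R :=
  MvPolynomial.eval₂Hom (Int.castRingHom R) fun ij => M ij.1 ij.2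

theorem evalAt_genericSkew {N : ℕ} {R : Type*} [CommRing R] (h2 : ∀ x : R, 2 * x = 0 → x = 0)
    (M : Matrix (Fin N) (Fin N) R) (hM : Mᵀ = -M) : (genericSkew N).map (evalAt M) = M := by
  ext1 i j
  have h : M j i = -M i j := congrFun (congrFun hM i) j
  simp only [genericSkew, map_apply, of_apply, evalAt]
  rcases lt_trichotomy i j with hij | hij | hij
  · simp [hij]
  · subst hij
    have : M i i = 0 := h2 _ (by linear_combination h)
    simp [this]
  · simp [hij, hij.not_gt, h]

theorem map_evalAt {N : ℕ} {R R' : Type*} [CommRing R] [CommRing R'] (φ : R →+* R')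
    (M : Matrix (Fin N) (Fin N) R) (p : MvPolynomial (Fin N × Fin N) ℤ) :
    φ (evalAt M p) = evalAt (M.map φ) p := by
  have : φ.comp (evalAt M) = evalAt (M.map φ) := by
    ext
    · simp
    · simp [evalAt]
  exact congrArg (fun ψ : _ →+* R' => ψ p) this

/-- The determinant of the generic alternating matrix has a polynomial square root. It is first
found in the fraction field; it is a polynomial because the polynomial ring is integrally closed.
The sign is normalized on the standard symplectic matrix. -/
theorem exists_pfaffian (N : ℕ) : ∃ p : MvPolynomial (Fin N × Fin N) ℤ,
    p ^ 2 = (genericSkew N).det ∧ 0 ≤ evalAt (stdSymp N) p := by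
  let A := MvPolynomial (Fin N × Fin N) ℤ
  let K := FractionRing A
  have hinj : Function.Injective (algebraMap A K) := IsFractionRing.injective A K
  have h2 : (2 : K) ≠ 0 := by
    have : (2 : A) ≠ 0 := two_ne_zero
    intro h
    exact this (hinj (by rw [map_ofNat, map_zero]; exact h))
  obtain ⟨x, hx⟩ := isSquare_det_of_skew h2 N ((genericSkew N).map (algebraMap A K)) (by
    rw [← transpose_map, genericSkew_transpose]
    ext1 i j
    simp)
  have hdet : algebraMap A K (genericSkew N).det = x ^ 2 := by
    rw [RingHom.map_det, sq]; exact hx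
  obtain ⟨p, hp⟩ := IsIntegrallyClosed.exists_algebraMap_eq_of_isIntegral_pow (R := A) (x := x)
    two_pos (hdet ▸ isIntegral_algebraMap)
  have hp2 : p ^ 2 = (genericSkew N).det := hinj (by rw [map_pow, hp, hdet])
  rcases le_total 0 (evalAt (stdSymp N) p) with h | h
  · exact ⟨p, hp2, h⟩
  · exact ⟨-p, by rw [neg_sq, hp2], by rw [map_neg]; omega⟩

/-- The Pfaffian of a skew-symmetric matrix: the polynomial in the entries above the diagonal
whose square is the determinant, and which takes the value `1` at the standard symplectic matrix. It
is chosen as a polynomial over `ℤ`, so that it commutes with ring homomorphisms; in odd size it is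
zero. -/
noncomputable def pf {N : ℕ} {R : Type*} [CommRing R] (M : Matrix (Fin N) (Fin N) R) : R :=
  evalAt M (exists_pfaffian N).choose

theorem map_pf {N : ℕ} {R R' : Type*} [CommRing R] [CommRing R'] (φ : R →+* R')
    (M : Matrix (Fin N) (Fin N) R) : φ (pf M) = pf (M.map φ) :=
  map_evalAt φ M _

theorem pf_sq {N : ℕ} {R : Type*} [CommRing R] (h2 : ∀ x : R, 2 * x = 0 → x = 0)
    {M : Matrix (Fin N) (Fin N) R} (hM : Mᵀ = -M) : pf M ^ 2 = M.det := by
  rw [pf, ← map_pow, (exists_pfaffian N).choose_spec.1, RingHom.map_det]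
  exact congrArg Matrix.det (evalAt_genericSkew h2 M hM)

theorem pf_stdSymp {N : ℕ} (hN : Even N) : pf (stdSymp N) = 1 := by
  have h1 : pf (stdSymp N) ^ 2 = 1 := by
    rw [pf_sq (fun x hx => by omega) (stdSymp_transpose N), det_stdSymp hN]
  have h2 : 0 ≤ pf (stdSymp N) := (exists_pfaffian N).choose_spec.2
  rcases (sq_eq_sq_iff_eq_or_eq_neg.1 (h1.trans (one_pow 2).symm)) with h | h <;> omega

/-! ### Congruences and block matrices -/

theorem pf_of_odd {N : ℕ} (hN : Odd N) {R : Type*} [CommRing R] (M : Matrix (Fin N) (Fin N) R) :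
    pf M = 0 := by
  have h : (genericSkew N).det = 0 := by
    have h1 : (genericSkew N).det = -(genericSkew N).det := by
      conv_lhs => rw [← det_transpose, genericSkew_transpose, det_neg, Fintype.card_fin,
        hN.neg_one_pow, neg_one_mul]
    have h2 : (2 : MvPolynomial (Fin N × Fin N) ℤ) * (genericSkew N).det = 0 := by
      linear_combination h1
    exact (mul_eq_zero.1 h2).resolve_left two_ne_zero
  have h0 : (exists_pfaffian N).choose = 0 := by
    exact pow_eq_zero_iff two_ne_zero |>.1 ((exists_pfaffian N).choose_spec.1.trans h)
  rw [pf, h0, map_zero]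

theorem map_transpose_eq_neg {n R R' : Type*} [CommRing R] [CommRing R'] (φ : R →+* R')
    {M : Matrix n n R} (hM : Mᵀ = -M) : (M.map φ)ᵀ = -M.map φ := by
  ext1 i j
  have h : M j i = -M i j := congrFun (congrFun hM i) j
  simp [h]

theorem congr_transpose_eq_neg {n R : Type*} [Fintype n] [CommRing R] (U : Matrix n n R)
    {M : Matrix n n R} (hM : Mᵀ = -M) : (Uᵀ * M * U)ᵀ = -(Uᵀ * M * U) := by
  simp [transpose_mul, hM, Matrix.mul_assoc]

theorem two_mul_eq_zero_of_charZero {A : Type*} [CommRing A] [IsDomain A] [CharZero A] (x : A)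
    (hx : 2 * x = 0) : x = 0 :=
  (mul_eq_zero.1 hx).resolve_left two_ne_zero

/-- Both sides have the same square, so in the universal case, over a polynomial ring, they agree up
to sign. The sign is found by specializing the congruence to the identity. -/
theorem pf_congr {N : ℕ} {R : Type*} [CommRing R] (h2 : ∀ x : R, 2 * x = 0 → x = 0)
    (U : Matrix (Fin N) (Fin N) R) {M : Matrix (Fin N) (Fin N) R} (hM : Mᵀ = -M) :
    pf (Uᵀ * M * U) = U.det * pf M := by
  rcases Nat.even_or_odd N with hN | hN
  swap
  · rw [pf_of_odd hN, pf_of_odd hN, mul_zero]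
  let ι := Fin N × Fin N
  let A := MvPolynomial (ι ⊕ ι) ℤ
  let ρ : MvPolynomial ι ℤ →+* A := (MvPolynomial.rename Sum.inl).toRingHom
  let G : Matrix (Fin N) (Fin N) A := (genericSkew N).map ρ
  let V : Matrix (Fin N) (Fin N) A := Matrix.of fun i j => MvPolynomial.X (Sum.inr (i, j))
  have hG : Gᵀ = -G := map_transpose_eq_neg ρ (genericSkew_transpose N)
  -- every instance of the statement is a specialization of the universal one, `(V, G)`
  have spec : ∀ {R : Type _} [CommRing R] (_ : ∀ x : R, 2 * x = 0 → x = 0)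
      (W M : Matrix (Fin N) (Fin N) R) (_ : Mᵀ = -M), ∃ φ : A →+* R, G.map φ = M ∧ V.map φ = W := by
    intro R _ h2 W M hM
    let φ : A →+* R := MvPolynomial.eval₂Hom (Int.castRingHom R)
      (Sum.elim (fun ij => M ij.1 ij.2) fun ij => W ij.1 ij.2)
    refine ⟨φ, ?_, ?_⟩
    · have : φ.comp ρ = evalAt M := by
        ext
        · simp
        · simp [φ, ρ, evalAt]
          exact MvPolynomial.eval₂_X _ _ _
      rw [Matrix.map_map, ← RingHom.coe_comp, this, evalAt_genericSkew h2 M hM]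
    · ext1 i j
      simp [V, φ]
      exact MvPolynomial.eval₂_X _ _ _
  have hsq : pf (Vᵀ * G * V) ^ 2 = (V.det * pf G) ^ 2 := by
    rw [mul_pow, pf_sq two_mul_eq_zero_of_charZero hG,
      pf_sq two_mul_eq_zero_of_charZero (congr_transpose_eq_neg V hG), det_mul, det_mul,
      det_transpose]
    ring
  have hmap : ∀ {R : Type _} [CommRing R] (φ : A →+* R), φ (pf (Vᵀ * G * V)) =
      pf ((V.map φ)ᵀ * G.map φ * V.map φ) := by
    intro R _ φ
    rw [map_pf, Matrix.map_mul, Matrix.map_mul, transpose_map]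
  have key : pf (Vᵀ * G * V) = V.det * pf G := by
    rcases sq_eq_sq_iff_eq_or_eq_neg.1 hsq with h | h
    · exact h
    · exfalso
      -- `ULift ℤ` is `ℤ` in the universe of `R`
      obtain ⟨φ, hφ1, hφ2⟩ := spec (R := ULift ℤ)
        (fun x hx => by
          have h := congrArg ULift.down hx
          refine ULift.ext _ _ ?_
          simpa using h) 1 ((stdSymp N).map (ULift.ringEquiv.symm : ℤ ≃+* ULift ℤ).toRingHom)
        (map_transpose_eq_neg _ (stdSymp_transpose N))
      have h1 := congrArg φ h
      rw [hmap, hφ1, hφ2, map_neg, map_mul, RingHom.map_det, map_pf, hφ1,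
        RingHom.mapMatrix_apply, hφ2, transpose_one, Matrix.one_mul, Matrix.mul_one, det_one,
        one_mul, ← map_pf, pf_stdSymp hN, map_one] at h1
      exact absurd (congrArg ULift.down h1) (by norm_num)
  obtain ⟨φ, hφ1, hφ2⟩ := spec h2 U M hM
  have h1 := congrArg φ key
  rwa [hmap, hφ1, hφ2, map_mul, RingHom.map_det, map_pf, hφ1, RingHom.mapMatrix_apply, hφ2] at h1

/-- The Pfaffian of a matrix indexed by a finite type with an enumeration `e`. -/
noncomputable def pfOf {N : ℕ} {ι R : Type*} [CommRing R] (e : ι ≃ Fin N) (M : Matrix ι ι R) : R :=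
  pf (M.submatrix e.symm e.symm)

section pfOf

variable {N : ℕ} {ι R R' : Type*} [CommRing R] [CommRing R']

theorem submatrix_transpose_eq_neg {κ : Type*} (e : κ → ι) {M : Matrix ι ι R} (hM : Mᵀ = -M) :
    (M.submatrix e e)ᵀ = -M.submatrix e e := by
  rw [transpose_submatrix, hM]; rfl

theorem map_pfOf (φ : R →+* R') (e : ι ≃ Fin N) (M : Matrix ι ι R) :
    φ (pfOf e M) = pfOf e (M.map φ) := by
  rw [pfOf, map_pf]; rfl

variable [Fintype ι] [DecidableEq ι] (h2 : ∀ x : R, 2 * x = 0 → x = 0)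

include h2

theorem pfOf_sq (e : ι ≃ Fin N) {M : Matrix ι ι R} (hM : Mᵀ = -M) : pfOf e M ^ 2 = M.det := by
  rw [pfOf, pf_sq h2 (submatrix_transpose_eq_neg _ hM), det_submatrix_equiv_self]

theorem pfOf_congr (e : ι ≃ Fin N) (U : Matrix ι ι R) {M : Matrix ι ι R} (hM : Mᵀ = -M) :
    pfOf e (Uᵀ * M * U) = U.det * pfOf e M := by
  rw [pfOf, pfOf, ← det_submatrix_equiv_self e.symm U,
    ← pf_congr h2 _ (submatrix_transpose_eq_neg _ hM), transpose_submatrix,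
    submatrix_mul_equiv, submatrix_mul_equiv]

/-- Two enumerations that differ by an even permutation give the same Pfaffian. -/
theorem pfOf_eq_of_sign_eq_one {N' : ℕ} (e : ι ≃ Fin N) (e' : ι ≃ Fin N') (σ : Equiv.Perm ι)
    (hσ : Equiv.Perm.sign σ = 1) (h : ∀ i, (e' i : ℕ) = e (σ i)) {M : Matrix ι ι R}
    (hM : Mᵀ = -M) : pfOf e' M = pfOf e M := by
  obtain rfl : N' = N := by
    rw [← Fintype.card_fin N', ← Fintype.card_congr e', Fintype.card_congr e, Fintype.card_fin]
  have he : e' = σ.trans e := Equiv.ext fun i => Fin.ext (h i)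
  have h1 : pfOf e' M = pfOf e (M.submatrix σ.symm σ.symm) := by rw [he]; rfl
  have h3 : M.submatrix σ.symm σ.symm =
      ((1 : Matrix ι ι R).submatrix id σ.symm)ᵀ * M * (1 : Matrix ι ι R).submatrix id σ.symm := by
    rw [transpose_submatrix, transpose_one]
    ext1 i j
    simp [Matrix.mul_apply, Matrix.one_apply]
  rw [h1, h3, pfOf_congr h2 e _ hM, det_permute']
  simp [hσ]

end pfOf

/-- The Pfaffian of a matrix with blocks of sizes `n` and `m`. -/
noncomputable def pfSum {n m : ℕ} {R : Type*} [CommRing R]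
    (M : Matrix (Fin n ⊕ Fin m) (Fin n ⊕ Fin m) R) : R :=
  pfOf finSumFinEquiv M

/-- The concatenation of two enumerations. -/
def sumEnum {N N' : ℕ} {ι κ : Type*} (e : ι ≃ Fin N) (e' : κ ≃ Fin N') : ι ⊕ κ ≃ Fin (N + N') :=
  (Equiv.sumCongr e e').trans finSumFinEquiv

theorem stdSymp_add {N N' : ℕ} (hN : Even N) : (stdSymp (N + N')).submatrix finSumFinEquiv
    finSumFinEquiv = fromBlocks (stdSymp N) 0 0 (stdSymp N') := by
  obtain ⟨q, rfl⟩ := hN.two_dvd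
  ext1 i j
  rcases i with i | i <;> rcases j with j | j
  · simp [stdSymp]
  · simp only [stdSymp, submatrix_apply, of_apply, finSumFinEquiv_apply_left,
      finSumFinEquiv_apply_right, Fin.val_castAdd, Fin.val_natAdd, fromBlocks_apply₁₂,
      Matrix.zero_apply, ite_eq_right_iff]
    intro h
    omega
  · simp only [stdSymp, submatrix_apply, of_apply, finSumFinEquiv_apply_left,
      finSumFinEquiv_apply_right, Fin.val_castAdd, Fin.val_natAdd, fromBlocks_apply₂₁,
      Matrix.zero_apply, ite_eq_right_iff]
    intro h
    omega
  · simp only [stdSymp, submatrix_apply, of_apply,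
      finSumFinEquiv_apply_right, Fin.val_natAdd, fromBlocks_apply₂₂]
    have h1 : (2 * q + (i : ℕ)) / 2 = q + (i : ℕ) / 2 := by omega
    have h2 : (2 * q + (j : ℕ)) / 2 = q + (j : ℕ) / 2 := by omega
    simp only [h1, h2, add_right_inj]
    push_cast
    simp

theorem fromBlocks_diag_transpose_eq_neg {n m R : Type*} [CommRing R] {M : Matrix n n R}
    {M' : Matrix m m R} (hM : Mᵀ = -M) (hM' : M'ᵀ = -M') :
    (fromBlocks M 0 0 M')ᵀ = -fromBlocks M 0 0 M' := by
  simp [fromBlocks_transpose, hM, hM', fromBlocks_neg]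

/-- The Pfaffian of a block diagonal matrix. As for `pf_congr`, the identity holds up to sign in the
universal case, and the sign is found by specializing to standard symplectic matrices. -/
theorem pfSum_diag {N N' : ℕ} {R : Type*} [CommRing R] (h2 : ∀ x : R, 2 * x = 0 → x = 0)
    {M : Matrix (Fin N) (Fin N) R} (hM : Mᵀ = -M) {M' : Matrix (Fin N') (Fin N') R}
    (hM' : M'ᵀ = -M') : pfSum (fromBlocks M 0 0 M') = pf M * pf M' := by
  let ι := Fin N × Fin N
  let ι' := Fin N' × Fin N'
  let A := MvPolynomial (ι ⊕ ι') ℤ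
  let ρ : MvPolynomial ι ℤ →+* A := (MvPolynomial.rename Sum.inl).toRingHom
  let ρ' : MvPolynomial ι' ℤ →+* A := (MvPolynomial.rename Sum.inr).toRingHom
  let G : Matrix (Fin N) (Fin N) A := (genericSkew N).map ρ
  let G' : Matrix (Fin N') (Fin N') A := (genericSkew N').map ρ'
  have hG : Gᵀ = -G := map_transpose_eq_neg ρ (genericSkew_transpose N)
  have hG' : G'ᵀ = -G' := map_transpose_eq_neg ρ' (genericSkew_transpose N')
  have spec : ∀ {R : Type _} [CommRing R] (_ : ∀ x : R, 2 * x = 0 → x = 0)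
      (M : Matrix (Fin N) (Fin N) R) (M' : Matrix (Fin N') (Fin N') R) (_ : Mᵀ = -M)
      (_ : M'ᵀ = -M'), ∃ φ : A →+* R, G.map φ = M ∧ G'.map φ = M' := by
    intro R _ h2 M M' hM hM'
    let φ : A →+* R := MvPolynomial.eval₂Hom (Int.castRingHom R)
      (Sum.elim (fun ij => M ij.1 ij.2) fun ij => M' ij.1 ij.2)
    refine ⟨φ, ?_, ?_⟩
    · have : φ.comp ρ = evalAt M := by
        ext
        · simp
        · simp [φ, ρ, evalAt]
          exact MvPolynomial.eval₂_X _ _ _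
      rw [Matrix.map_map, ← RingHom.coe_comp, this, evalAt_genericSkew h2 M hM]
    · have : φ.comp ρ' = evalAt M' := by
        ext
        · simp
        · simp [φ, ρ', evalAt]
          exact MvPolynomial.eval₂_X _ _ _
      rw [Matrix.map_map, ← RingHom.coe_comp, this, evalAt_genericSkew h2 M' hM']
  have hmap : ∀ {R : Type _} [CommRing R] (φ : A →+* R), φ (pfSum (fromBlocks G 0 0 G')) =
      pfSum (fromBlocks (G.map φ) 0 0 (G'.map φ)) := by
    intro R _ φ
    rw [pfSum, map_pfOf, fromBlocks_map]
    simp [pfSum]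
  have hsq : pfSum (fromBlocks G 0 0 G') ^ 2 = (pf G * pf G') ^ 2 := by
    rw [mul_pow, pf_sq two_mul_eq_zero_of_charZero hG, pf_sq two_mul_eq_zero_of_charZero hG',
      pfSum, pfOf_sq two_mul_eq_zero_of_charZero _ (fromBlocks_diag_transpose_eq_neg hG hG'),
      det_fromBlocks_zero₁₂]
  have key : pfSum (fromBlocks G 0 0 G') = pf G * pf G' := by
    rcases sq_eq_sq_iff_eq_or_eq_neg.1 hsq with h | h
    · exact h
    · rcases Nat.even_or_odd N with hN | hN
      swap
      · rw [h, pf_of_odd hN, zero_mul, neg_zero]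
      rcases Nat.even_or_odd N' with hN' | hN'
      swap
      · rw [h, pf_of_odd hN', mul_zero, neg_zero]
      exfalso
      let c := (ULift.ringEquiv.symm : ℤ ≃+* ULift ℤ).toRingHom
      obtain ⟨φ, hφ1, hφ2⟩ := spec (R := ULift ℤ)
        (fun x hx => by
          have h := congrArg ULift.down hx
          refine ULift.ext _ _ ?_
          simpa using h) ((stdSymp N).map c) ((stdSymp N').map c)
        (map_transpose_eq_neg _ (stdSymp_transpose N))
        (map_transpose_eq_neg _ (stdSymp_transpose N'))
      have h1 := congrArg φ h
      have h3 : fromBlocks ((stdSymp N).map c) 0 0 ((stdSymp N').map c) =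
          (fromBlocks (stdSymp N) 0 0 (stdSymp N')).map c := by
        rw [fromBlocks_map]; simp
      have h4 : pfSum (fromBlocks (stdSymp N) 0 0 (stdSymp N')) = 1 := by
        rw [← stdSymp_add hN, pfSum, pfOf, submatrix_submatrix]
        simp [pf_stdSymp (hN.add hN')]
      rw [hmap, hφ1, hφ2, map_neg, map_mul, map_pf, map_pf, hφ1, hφ2, h3, pfSum, ← map_pfOf,
        ← pfSum, h4, ← map_pf, ← map_pf, pf_stdSymp hN, pf_stdSymp hN', map_one, mul_one] at h1
      exact absurd (congrArg ULift.down h1) (by norm_num)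
  obtain ⟨φ, hφ1, hφ2⟩ := spec h2 M M' hM hM'
  have h1 := congrArg φ key
  rwa [hmap, hφ1, hφ2, map_mul, map_pf, map_pf, hφ1, hφ2] at h1

theorem pfOf_sumEnum {N N' : ℕ} {ι κ R : Type*} [Fintype ι] [DecidableEq ι] [Fintype κ]
    [DecidableEq κ] [CommRing R] (h2 : ∀ x : R, 2 * x = 0 → x = 0) (e : ι ≃ Fin N)
    (e' : κ ≃ Fin N') {M : Matrix ι ι R} (hM : Mᵀ = -M) {M' : Matrix κ κ R} (hM' : M'ᵀ = -M') :
    pfOf (sumEnum e e') (fromBlocks M 0 0 M') = pfOf e M * pfOf e' M' := by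
  rw [pfOf, pfOf, pfOf, ← pfSum_diag h2 (submatrix_transpose_eq_neg _ hM)
    (submatrix_transpose_eq_neg _ hM'), pfSum, pfOf]
  congr 1
  rw [show (sumEnum e e').symm = finSumFinEquiv.symm.trans (Equiv.sumCongr e.symm e'.symm) from rfl]
  ext1 i j
  simp only [submatrix_apply, Equiv.trans_apply]
  rcases finSumFinEquiv.symm i with i | i <;> rcases finSumFinEquiv.symm j with j | j <;> simp

/-- Rotating `a + b` objects by `b` places is an even permutation if `a` is even. -/
theorem exists_rotation {a b : ℕ} (ha : Even a) : ∃ σ : Equiv.Perm (Fin (a + b)),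
    Equiv.Perm.sign σ = 1 ∧ ∀ i, (σ i : ℕ) = ((i : ℕ) + b) % (a + b) := by
  refine ⟨finRotate (a + b) ^ b, ?_, fun i => ?_⟩
  · rw [map_pow, sign_finRotate, ← pow_mul]
    refine Even.neg_one_pow ?_
    rcases Nat.even_or_odd b with hb | hb
    · exact hb.mul_left _
    · exact (Nat.Odd.sub_odd (ha.add_odd hb) odd_one).mul_right _
  · have hpos : 0 < a + b := i.pos
    have : ∀ c : ℕ, (((finRotate (a + b)) ^ c) i : ℕ) = ((i : ℕ) + c) % (a + b) := by
      intro c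
      induction c with
      | zero => simp [Nat.mod_eq_of_lt i.2]
      | succ c ih =>
        obtain ⟨k, hk⟩ : ∃ k, a + b = k + 1 := ⟨a + b - 1, by omega⟩
        rw [pow_succ', Equiv.Perm.mul_apply]
        generalize hj : ((finRotate (a + b)) ^ c) i = j at ih
        clear hj
        revert j
        clear hpos
        generalize a + b = s at i hk
        subst hk
        intro j hj
        rw [finRotate_apply, Fin.val_add, hj]
        simp [Nat.add_assoc]
    exact this b

/-! ### The Pfaffian of an isometry, in matrices -/

/-- The matrices of an isometry `f : (E, A) → (F, B)` of skew-symmetric complexes of free modules: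
`P` and `Q` are the components in degree `0` of `f` and of its shifted dual, and `H`, `K` are
homotopies, which may be taken skew-symmetric when `2` is invertible. The components in degree `1`
are `Qᵀ` and `Pᵀ`. -/
structure IsIsometryMatrix {n m : ℕ} {R : Type*} [CommRing R] (A : Matrix (Fin n) (Fin n) R)
    (B : Matrix (Fin m) (Fin m) R) (P : Matrix (Fin m) (Fin n) R) (Q : Matrix (Fin n) (Fin m) R)
    (H : Matrix (Fin n) (Fin n) R) (K : Matrix (Fin m) (Fin m) R) : Prop where
  skew_left : Aᵀ = -A
  skew_right : Bᵀ = -B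
  skew_H : Hᵀ = -H
  skew_K : Kᵀ = -K
  comm : Qᵀ * A = B * P
  mul_left : Q * P = 1 + H * A
  mul_right : P * Q = 1 + K * B

/-- The skew-symmetric matrix `(A Pᵀ; -P -K)` of the cone of an isometry, for the section
`(Pᵀ, -K)` of `(Qᵀ B)`. -/
def skewCone {n m : ℕ} {R : Type*} [CommRing R] (A : Matrix (Fin n) (Fin n) R)
    (P : Matrix (Fin m) (Fin n) R) (K : Matrix (Fin m) (Fin m) R) :
    Matrix (Fin n ⊕ Fin m) (Fin n ⊕ Fin m) R :=
  fromBlocks A Pᵀ (-P) (-K)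

/-- The hyperbolic matrix `(0 1; -1 0)`. -/
def hyp (m : ℕ) (R : Type*) [CommRing R] : Matrix (Fin m ⊕ Fin m) (Fin m ⊕ Fin m) R :=
  fromBlocks 0 1 (-1) 0

/-- The Pfaffian of an isometry with respect to bases of `E` and `F`. The first factor is a sign,
which makes the Pfaffian of the identity equal to `1`. -/
noncomputable def pfIso {n m : ℕ} {R : Type*} [CommRing R] (A : Matrix (Fin n) (Fin n) R)
    (P : Matrix (Fin m) (Fin n) R) (K : Matrix (Fin m) (Fin m) R) : R :=
  pfSum (hyp m R) * pfSum (skewCone A P K)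

section

variable {n m l : ℕ} {R R' : Type*} [CommRing R] [CommRing R']

theorem eq_zero_of_two_mul (h2 : IsUnit (2 : R)) (x : R) (hx : 2 * x = 0) : x = 0 :=
  (h2.mul_right_eq_zero).1 hx

theorem hyp_transpose : (hyp m R)ᵀ = -hyp m R := by
  simp [hyp, fromBlocks_transpose, fromBlocks_neg]

theorem hyp_map (φ : R →+* R') : (hyp m R).map φ = hyp m R' := by
  ext1 i j
  rcases i with i | i <;> rcases j with j | j <;> simp [hyp, Matrix.one_apply, apply_ite φ]

theorem skewCone_transpose {A : Matrix (Fin n) (Fin n) R} (hA : Aᵀ = -A)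
    (P : Matrix (Fin m) (Fin n) R) {K : Matrix (Fin m) (Fin m) R} (hK : Kᵀ = -K) :
    (skewCone A P K)ᵀ = -skewCone A P K := by
  simp [skewCone, fromBlocks_transpose, fromBlocks_neg, hA, hK]

theorem skewCone_map (φ : R →+* R') (A : Matrix (Fin n) (Fin n) R)
    (P : Matrix (Fin m) (Fin n) R) (K : Matrix (Fin m) (Fin m) R) :
    (skewCone A P K).map φ = skewCone (A.map φ) (P.map φ) (K.map φ) := by
  ext1 i j
  rcases i with i | i <;> rcases j with j | j <;> simp [skewCone]

theorem map_pfIso (φ : R →+* R') (A : Matrix (Fin n) (Fin n) R)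
    (P : Matrix (Fin m) (Fin n) R) (K : Matrix (Fin m) (Fin m) R) :
    φ (pfIso A P K) = pfIso (A.map φ) (P.map φ) (K.map φ) := by
  rw [pfIso, map_mul, pfSum, pfSum, map_pfOf, map_pfOf, hyp_map, skewCone_map]
  rfl

theorem pfSum_hyp_mul_self : pfSum (hyp m R) * pfSum (hyp m R) = 1 := by
  have hz : pfSum (hyp m ℤ) ^ 2 = 1 := by
    have h1 : pfSum (hyp m ℤ) ^ 2 = (hyp m ℤ).det :=
      pfOf_sq two_mul_eq_zero_of_charZero _ hyp_transpose
    have h2 : (hyp m ℤ).det * (hyp m ℤ).det = 1 := by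
      have h3 : hyp m ℤ * (hyp m ℤ)ᵀ = 1 := by
        simp [hyp, fromBlocks_transpose, fromBlocks_multiply]
      have h4 := congrArg Matrix.det h3
      rwa [det_mul, det_transpose, det_one] at h4
    nlinarith [sq_nonneg (pfSum (hyp m ℤ))]
  have h := congrArg (Int.castRingHom R) hz
  rwa [map_pow, pfSum, map_pfOf, hyp_map, map_one, sq] at h

theorem pfIso_sq (h2 : IsUnit (2 : R)) {A : Matrix (Fin n) (Fin n) R} (hA : Aᵀ = -A)
    (P : Matrix (Fin m) (Fin n) R) {K : Matrix (Fin m) (Fin m) R} (hK : Kᵀ = -K) :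
    pfIso A P K * pfIso A P K = (skewCone A P K).det := by
  rw [← pfOf_sq (eq_zero_of_two_mul h2) finSumFinEquiv (skewCone_transpose hA P hK)]
  change pfIso A P K * pfIso A P K = pfSum (skewCone A P K) ^ 2
  simp only [pfIso]
  linear_combination (exp := 1) pfSum (skewCone A P K) ^ 2 * pfSum_hyp_mul_self (m := m) (R := R)

theorem pfIso_of_odd (h : Odd (n + m)) (A : Matrix (Fin n) (Fin n) R)
    (P : Matrix (Fin m) (Fin n) R) (K : Matrix (Fin m) (Fin m) R) : pfIso A P K = 0 := by
  have : pfSum (skewCone A P K) = 0 := pf_of_odd h _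
  rw [pfIso, this, mul_zero]

namespace IsIsometryMatrix

variable {A : Matrix (Fin n) (Fin n) R} {B : Matrix (Fin m) (Fin m) R}
  {P : Matrix (Fin m) (Fin n) R} {Q : Matrix (Fin n) (Fin m) R} {H : Matrix (Fin n) (Fin n) R}
  {K : Matrix (Fin m) (Fin m) R} (D : IsIsometryMatrix A B P Q H K)

include D

theorem comm' : A * Q = Pᵀ * B := by
  have h := congrArg transpose D.comm
  simp only [transpose_mul, transpose_transpose, D.skew_left, D.skew_right] at h
  simpa using h

theorem transpose_mul_left : Pᵀ * Qᵀ = 1 + A * H := by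
  have h := congrArg transpose D.mul_left
  simpa [transpose_mul, D.skew_left, D.skew_H] using h

theorem transpose_mul_right : Qᵀ * Pᵀ = 1 + B * K := by
  have h := congrArg transpose D.mul_right
  simpa [transpose_mul, D.skew_right, D.skew_K] using h

/-- The cone of an isometry is acyclic. In the lower left corner of the inverse, `d` is the
obstruction to the compatibility of the two homotopies; it is killed by `B`. -/
theorem skewCone_mul_inv : skewCone A P K *
    fromBlocks (-H + Q * (P * H - K * Qᵀ)) (-Q) Qᵀ B = 1 := by
  have hBd : B * (P * H - K * Qᵀ) = 0 := by
    have h1 : B * (P * H) = Qᵀ * (A * H) := by rw [← Matrix.mul_assoc, ← D.comm, Matrix.mul_assoc]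
    have h2 : A * H = Pᵀ * Qᵀ - 1 := by rw [D.transpose_mul_left]; abel
    have h3 : B * (K * Qᵀ) = (Qᵀ * Pᵀ - 1) * Qᵀ := by
      rw [← Matrix.mul_assoc, D.transpose_mul_right]; congr 1; abel
    rw [Matrix.mul_sub, h1, h2, h3, Matrix.mul_sub, Matrix.sub_mul, Matrix.mul_assoc]
    simp
  have h11 : A * (-H + Q * (P * H - K * Qᵀ)) + Pᵀ * Qᵀ = 1 := by
    rw [Matrix.mul_add, ← Matrix.mul_assoc, D.comm', Matrix.mul_assoc, hBd, D.transpose_mul_left]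
    simp
  have h21 : -P * (-H + Q * (P * H - K * Qᵀ)) + -K * Qᵀ = 0 := by
    have h : P * (Q * (P * H - K * Qᵀ)) = P * H - K * Qᵀ := by
      rw [← Matrix.mul_assoc, D.mul_right, Matrix.add_mul, Matrix.mul_assoc, hBd]
      simp
    rw [Matrix.neg_mul, Matrix.mul_add, h]
    simp
  rw [skewCone, fromBlocks_multiply, h11, h21, Matrix.mul_neg, D.comm', Matrix.neg_mul,
    Matrix.neg_mul, Matrix.mul_neg, neg_neg, D.mul_right, ← fromBlocks_one]
  congr 1
  · simp
  · abel

theorem isUnit_det_skewCone : IsUnit (skewCone A P K).det := by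
  have h := congrArg Matrix.det D.skewCone_mul_inv
  rw [det_mul, det_one] at h
  exact IsUnit.of_mul_eq_one _ h

theorem isUnit_pfIso (h2 : IsUnit (2 : R)) : IsUnit (pfIso A P K) := by
  have h := D.isUnit_det_skewCone
  rw [← pfIso_sq h2 D.skew_left P D.skew_K] at h
  exact isUnit_of_mul_isUnit_left h

/-- The determinant of the cone depends on the section `(u, v)` of `(Qᵀ B)` only through the basis
of `F*` that is being lifted. -/
theorem det_cone_section {u : Matrix (Fin n) (Fin m) R} {v D' : Matrix (Fin m) (Fin m) R}
    (h : Qᵀ * u + B * v = D') :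
    (fromBlocks A u (-P) v).det = (skewCone A P K).det * D'.det := by
  let w := (-H + Q * (P * H - K * Qᵀ)) * u + -Q * v
  have h1 : skewCone A P K * (fromBlocks (-H + Q * (P * H - K * Qᵀ)) (-Q) Qᵀ B *
      fromBlocks (0 : Matrix (Fin n) (Fin n) R) u (0 : Matrix (Fin m) (Fin n) R) v) =
      fromBlocks 0 u 0 v := by
    rw [← Matrix.mul_assoc, D.skewCone_mul_inv, Matrix.one_mul]
  rw [fromBlocks_multiply, h] at h1
  have h2 : skewCone A P K * fromBlocks 1 w 0 D' = fromBlocks A u (-P) v := by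
    simp only [skewCone, fromBlocks_multiply, fromBlocks_inj, Matrix.mul_zero, add_zero] at h1 ⊢
    exact ⟨by simp, h1.2.1, by simp, h1.2.2.2⟩
  rw [← h2, det_mul, det_fromBlocks_zero₂₁, det_one, one_mul]

/-- The Pfaffian of an isometry does not depend on the homotopy. -/
theorem pfIso_eq_of_homotopy (h2 : IsUnit (2 : R)) {K' : Matrix (Fin m) (Fin m) R}
    (hK' : K'ᵀ = -K') (h : P * Q = 1 + K' * B) : pfIso A P K' = pfIso A P K := by
  obtain ⟨c, hc⟩ := h2.exists_right_inv
  obtain ⟨s, rfl⟩ : ∃ s, K' = K + s := ⟨K' - K, by abel⟩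
  have hs : sᵀ = -s := by
    rw [transpose_add, D.skew_K, neg_add] at hK'
    exact add_left_cancel hK'
  have hsB : s * B = 0 := by
    have := h.symm.trans D.mul_right
    rw [Matrix.add_mul, ← add_assoc] at this
    simpa using this
  have hBs : B * s = 0 := by
    have := congrArg transpose hsB
    simpa [transpose_mul, hs, D.skew_right] using this
  -- the two cones are congruent by a unipotent matrix; `c = 1 / 2`
  let U : Matrix (Fin n ⊕ Fin m) (Fin n ⊕ Fin m) R := fromBlocks 1 (c • (Q * s)) 0 1
  have hAQs : A * (Q * s) = 0 := by
    rw [← Matrix.mul_assoc, D.comm', Matrix.mul_assoc, hBs, Matrix.mul_zero]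
  have hPQs : P * (Q * s) = s := by
    rw [← Matrix.mul_assoc, D.mul_right, Matrix.add_mul, Matrix.mul_assoc, hBs]; simp
  have hPQs' : s * (Qᵀ * Pᵀ) = s := by
    have := congrArg transpose hPQs
    simpa [transpose_mul, hs, Matrix.mul_assoc] using this
  have hsQA : s * (Qᵀ * A) = 0 := by
    rw [D.comm, ← Matrix.mul_assoc, hsB, Matrix.zero_mul]
  have hU : Uᵀ * skewCone A P K * U = skewCone A P (K + s) := by
    simp only [U, skewCone, fromBlocks_transpose, fromBlocks_multiply, transpose_one,
      transpose_zero, transpose_smul, transpose_mul, hs]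
    simp only [Matrix.one_mul, Matrix.mul_one, Matrix.zero_mul, Matrix.mul_zero, add_zero, zero_add,
      Matrix.smul_mul, Matrix.mul_smul, Matrix.neg_mul, Matrix.mul_neg,
      Matrix.mul_assoc, hAQs, hPQs, hPQs', hsQA, smul_zero, neg_zero, smul_neg]
    congr 1
    have hs2 : c • s + c • s = s := by rw [← add_smul, ← two_mul, hc, one_smul]
    linear_combination (norm := module) -hs2
  rw [pfIso, pfIso, ← hU, pfSum, pfSum, pfSum, pfOf_congr (eq_zero_of_two_mul h2) _ _
    (skewCone_transpose D.skew_left P D.skew_K)]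
  simp [U]

end IsIsometryMatrix

/-- The effect of a change of bases of `E` and `F`. -/
theorem pfIso_change_basis (h2 : IsUnit (2 : R)) {A : Matrix (Fin n) (Fin n) R} (hA : Aᵀ = -A)
    (P : Matrix (Fin m) (Fin n) R) {K : Matrix (Fin m) (Fin m) R} (hK : Kᵀ = -K)
    (a : Matrix (Fin n) (Fin n) R) (b : Matrix (Fin m) (Fin m) R) :
    pfIso (aᵀ * A * a) (b * P * a) (b * K * bᵀ) = a.det * b.det * pfIso A P K := by
  let U : Matrix (Fin n ⊕ Fin m) (Fin n ⊕ Fin m) R := fromBlocks a 0 0 bᵀ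
  have hU : Uᵀ * skewCone A P K * U = skewCone (aᵀ * A * a) (b * P * a) (b * K * bᵀ) := by
    simp [U, skewCone, fromBlocks_transpose, fromBlocks_multiply, transpose_mul, Matrix.mul_assoc]
  rw [pfIso, pfIso, ← hU, pfSum, pfSum, pfSum, pfOf_congr (eq_zero_of_two_mul h2) _ _
    (skewCone_transpose hA P hK)]
  simp only [U, det_fromBlocks_zero₂₁, det_transpose]
  ring

/-- An isometry homotopic to the identity has Pfaffian `1`: its cone is congruent to the cone of the
identity, and the latter to the hyperbolic matrix, by unipotent matrices. -/
theorem pfIso_one_add (h2 : IsUnit (2 : R)) {A : Matrix (Fin n) (Fin n) R} (hA : Aᵀ = -A)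
    (h : Matrix (Fin n) (Fin n) R) : pfIso A (1 + h * A) (h - hᵀ - h * A * hᵀ) = 1 := by
  obtain ⟨c, hc⟩ := h2.exists_right_inv
  let U : Matrix (Fin n ⊕ Fin n) (Fin n ⊕ Fin n) R := fromBlocks 1 (-hᵀ) 0 1
  let V : Matrix (Fin n ⊕ Fin n) (Fin n ⊕ Fin n) R := fromBlocks 1 0 (c • A) 1
  have hV : Vᵀ * hyp n R * V = skewCone A 1 0 := by
    simp only [V, hyp, skewCone, fromBlocks_transpose, fromBlocks_multiply, transpose_one,
      transpose_zero, transpose_smul, hA]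
    simp only [Matrix.one_mul, Matrix.mul_one, Matrix.zero_mul, Matrix.mul_zero, add_zero, zero_add,
      Matrix.mul_neg, smul_neg, neg_neg, neg_zero]
    congr 1
    rw [← add_smul, ← two_mul, hc, one_smul]
  have hU : Uᵀ * skewCone A 1 0 * U = skewCone A (1 + h * A) (h - hᵀ - h * A * hᵀ) := by
    simp only [U, skewCone, fromBlocks_transpose, fromBlocks_multiply, transpose_one,
      transpose_zero, transpose_neg, transpose_transpose, transpose_add, transpose_mul, hA]
    simp only [Matrix.one_mul, Matrix.mul_one, Matrix.mul_zero, add_zero,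
      Matrix.mul_neg, neg_zero, Matrix.neg_mul, Matrix.add_mul]
    congr 1 <;> abel
  rw [pfIso, ← hU, pfSum, pfSum, pfOf_congr (eq_zero_of_two_mul h2) _ _
    (skewCone_transpose hA 1 (by simp)), ← hV, pfOf_congr (eq_zero_of_two_mul h2) _ _
    hyp_transpose]
  have := pfSum_hyp_mul_self (m := n) (R := R)
  simp only [U, V, det_fromBlocks_zero₂₁, det_fromBlocks_zero₁₂, det_one, one_mul]
  exact this

/-- The shuffle `(E, G*), (F*, F) → (E, F*), (F, G*)` of the blocks of the cones. -/
def shuffle (α β γ δ : Type*) : (α ⊕ δ) ⊕ (β ⊕ γ) ≃ (α ⊕ β) ⊕ (γ ⊕ δ) where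
  toFun := Sum.elim (Sum.elim (fun x => .inl (.inl x)) fun z => .inr (.inr z))
    (Sum.elim (fun x => .inl (.inr x)) fun z => .inr (.inl z))
  invFun := Sum.elim (Sum.elim (fun x => .inl (.inl x)) fun z => .inr (.inl z))
    (Sum.elim (fun x => .inr (.inr x)) fun z => .inl (.inr z))
  left_inv := by rintro ((x | x) | (x | x)) <;> rfl
  right_inv := by rintro ((x | x) | (x | x)) <;> rfl

/-- The shuffle moves `G*` across `F* ⊕ F`, a block of even size, so it is an even permutation. -/
theorem pfOf_shuffle (h2 : ∀ x : R, 2 * x = 0 → x = 0)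
    {N : Matrix ((Fin n ⊕ Fin m) ⊕ (Fin m ⊕ Fin l)) ((Fin n ⊕ Fin m) ⊕ (Fin m ⊕ Fin l)) R}
    (hN : Nᵀ = -N) :
    pfOf (sumEnum finSumFinEquiv finSumFinEquiv)
      (N.submatrix (shuffle (Fin n) (Fin m) (Fin m) (Fin l)) (shuffle _ _ _ _)) =
      pfOf (sumEnum finSumFinEquiv finSumFinEquiv) N := by
  let τ := shuffle (Fin n) (Fin m) (Fin m) (Fin l)
  let q : (Fin n ⊕ Fin m) ⊕ (Fin m ⊕ Fin l) ≃ Fin n ⊕ Fin (m + m + l) :=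
    (Equiv.sumAssoc _ _ _).trans (Equiv.sumCongr (Equiv.refl _)
      ((Equiv.sumAssoc _ _ _).symm.trans (sumEnum finSumFinEquiv (Equiv.refl _))))
  obtain ⟨ρ, hρ, hρ'⟩ := exists_rotation (a := m + m) (b := l) ⟨m, rfl⟩
  have hq : ∀ j, ((sumEnum finSumFinEquiv finSumFinEquiv) j : ℕ) =
      Sum.elim (fun x : Fin n => (x : ℕ)) (fun y : Fin (m + m + l) => n + (y : ℕ))
        (q j : Fin n ⊕ _) := by
    rintro ((x | x) | (x | x)) <;> simp [q, sumEnum] <;> ring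
  change pfOf (τ.symm.trans (sumEnum finSumFinEquiv finSumFinEquiv)) N = _
  refine pfOf_eq_of_sign_eq_one h2 _ _ (q.symm.permCongr (Equiv.sumCongr (Equiv.refl _) ρ)) ?_ ?_ hN
  · rw [Equiv.Perm.sign_permCongr]
    exact (Equiv.Perm.sign_sumCongr 1 ρ).trans (by rw [hρ, Equiv.Perm.sign_one, one_mul])
  · intro i
    rw [hq, Equiv.permCongr_apply, Equiv.apply_symm_apply, Equiv.symm_symm]
    rcases i with (x | x) | (x | x)
    · simp [q, τ, shuffle, sumEnum]
    · have : (x : ℕ) + l < m + m + l := by omega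
      simp [q, τ, shuffle, sumEnum, hρ', Nat.mod_eq_of_lt this]
      ring
    · have : (x : ℕ) + m + l < m + m + l := by omega
      simp [q, τ, shuffle, sumEnum, hρ', Nat.mod_eq_of_lt this]
      ring
    · have h1 : m + m + (x : ℕ) + l = (x : ℕ) + (m + m + l) := by ring
      have h3 : (x : ℕ) < m + m + l := by omega
      simp [q, τ, shuffle, sumEnum, hρ', h1, Nat.mod_eq_of_lt h3]

/-- Multiplicativity of the Pfaffian. The sum of the cones of `f` and `g` is congruent to a matrix
in which `E` and `G*` are linked only through the hyperbolic plane `F* ⊕ F`; eliminating that plane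
gives the cone of the composite. -/
theorem IsIsometryMatrix.pfIso_comp (h2 : IsUnit (2 : R)) {A : Matrix (Fin n) (Fin n) R}
    {B : Matrix (Fin m) (Fin m) R} {C : Matrix (Fin l) (Fin l) R}
    {P : Matrix (Fin m) (Fin n) R} {Q : Matrix (Fin n) (Fin m) R} {H : Matrix (Fin n) (Fin n) R}
    {K : Matrix (Fin m) (Fin m) R} (D : IsIsometryMatrix A B P Q H K)
    {P' : Matrix (Fin l) (Fin m) R} {Q' : Matrix (Fin m) (Fin l) R} {H' : Matrix (Fin m) (Fin m) R}
    {K' : Matrix (Fin l) (Fin l) R} (D' : IsIsometryMatrix B C P' Q' H' K') :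
    pfIso A (P' * P) (K' + P' * K * P'ᵀ) = pfIso A P K * pfIso B P' K' := by
  obtain ⟨c, hc⟩ := h2.exists_right_inv
  have hcK : c • K + c • K = K := by rw [← add_smul, ← two_mul, hc, one_smul]
  have h2' := eq_zero_of_two_mul h2
  -- `U` takes the sum of the cones of `f` and `g` to `N`, where `B` has disappeared
  let W : Matrix (Fin n ⊕ Fin m) (Fin m ⊕ Fin l) R := fromBlocks (-Q) 0 B 0
  let X : Matrix (Fin n ⊕ Fin m) (Fin m ⊕ Fin l) R := fromBlocks 0 0 1 0
  let N := fromBlocks (skewCone A P K) X (-Xᵀ) (fromBlocks 0 P'ᵀ (-P') (-K'))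
  let U : Matrix ((Fin n ⊕ Fin m) ⊕ (Fin m ⊕ Fin l)) ((Fin n ⊕ Fin m) ⊕ (Fin m ⊕ Fin l)) R :=
    fromBlocks 1 W 0 1
  have hM := skewCone_transpose D.skew_left P D.skew_K
  have hM' := skewCone_transpose D'.skew_left P' D'.skew_K
  have hMW : skewCone A P K * W = X := by
    simp only [skewCone, W, X, fromBlocks_multiply, Matrix.mul_zero, add_zero, Matrix.mul_neg,
      Matrix.neg_mul, neg_neg, D.comm', D.mul_right]
    congr 1
    · simp
    · abel
  have hWM : Wᵀ * skewCone A P K = -Xᵀ := by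
    rw [← hMW, transpose_mul, hM, Matrix.mul_neg, neg_neg]
  have hU : Uᵀ * fromBlocks (skewCone A P K) 0 0 (skewCone B P' K') * U = N := by
    simp only [U, N, fromBlocks_transpose, fromBlocks_multiply, transpose_one, transpose_zero,
      Matrix.one_mul, Matrix.mul_one, Matrix.zero_mul, Matrix.mul_zero, add_zero, zero_add, hMW,
      hWM]
    congr 1
    simp [W, X, skewCone, fromBlocks_transpose, fromBlocks_multiply, fromBlocks_add, fromBlocks_neg]
  have hN : Nᵀ = -N := by
    rw [← hU]
    exact congr_transpose_eq_neg U (fromBlocks_diag_transpose_eq_neg hM hM')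
  have hpf1 : pfOf (sumEnum finSumFinEquiv finSumFinEquiv) N =
      pfSum (skewCone A P K) * pfSum (skewCone B P' K') := by
    rw [← hU, pfOf_congr h2' _ _ (fromBlocks_diag_transpose_eq_neg hM hM'),
      pfOf_sumEnum h2' _ _ hM hM']
    simp [U, pfSum]
  -- `V` takes the sum of the cone of the composite and a hyperbolic plane to a reordering of `N`
  let Y : Matrix (Fin m ⊕ Fin m) (Fin n ⊕ Fin l) R := fromBlocks 0 (-P'ᵀ) (-P) (-(c • (K * P'ᵀ)))
  let Z : Matrix (Fin m ⊕ Fin m) (Fin m ⊕ Fin m) R := fromBlocks 1 0 (-(c • K)) 1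
  let V : Matrix ((Fin n ⊕ Fin l) ⊕ (Fin m ⊕ Fin m)) ((Fin n ⊕ Fin l) ⊕ (Fin m ⊕ Fin m)) R :=
    fromBlocks 1 0 Y Z
  have hK'' : (K' + P' * K * P'ᵀ)ᵀ = -(K' + P' * K * P'ᵀ) := by
    simp only [transpose_add, transpose_mul, transpose_transpose, D.skew_K, D'.skew_K,
      Matrix.neg_mul, Matrix.mul_neg, neg_add, Matrix.mul_assoc]
  have hM'' := skewCone_transpose D.skew_left (P' * P) hK''
  have hNs : N.submatrix (shuffle (Fin n) (Fin m) (Fin m) (Fin l)) (shuffle _ _ _ _) =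
      fromBlocks (fromBlocks A 0 0 (-K')) (fromBlocks Pᵀ 0 0 (-P')) (fromBlocks (-P) 0 0 P'ᵀ)
        (fromBlocks (-K) 1 (-1) 0) := by
    ext1 i j
    rcases i with (i | i) | (i | i) <;> rcases j with (j | j) | (j | j) <;>
      simp [N, X, shuffle, skewCone, Matrix.one_apply, eq_comm]
  have hV : Vᵀ * fromBlocks (skewCone A (P' * P) (K' + P' * K * P'ᵀ)) 0 0 (hyp m R) * V =
      N.submatrix (shuffle (Fin n) (Fin m) (Fin m) (Fin l)) (shuffle _ _ _ _) := by
    rw [hNs]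
    have hJZ : hyp m R * Z = fromBlocks (-(c • K)) 1 (-1) 0 := by
      simp [hyp, Z, fromBlocks_multiply]
    have hJY : hyp m R * Y = fromBlocks (-P) (-(c • (K * P'ᵀ))) 0 P'ᵀ := by
      simp [hyp, Y, fromBlocks_multiply]
    have hZt : Zᵀ = fromBlocks 1 (c • K) 0 1 := by
      simp [Z, fromBlocks_transpose, D.skew_K]
    have hYt : Yᵀ = fromBlocks 0 (-Pᵀ) (-P') (c • (P' * K)) := by
      simp [Y, fromBlocks_transpose, D.skew_K]
    simp only [V, fromBlocks_transpose, fromBlocks_multiply, transpose_one, transpose_zero,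
      Matrix.one_mul, Matrix.mul_one, Matrix.zero_mul, Matrix.mul_zero, add_zero, zero_add]
    rw [Matrix.mul_assoc, Matrix.mul_assoc, Matrix.mul_assoc, Matrix.mul_assoc, hJZ, hJY, hZt, hYt]
    simp only [skewCone, fromBlocks_multiply, fromBlocks_add]
    simp only [Matrix.one_mul, Matrix.mul_one, Matrix.zero_mul, Matrix.mul_zero, add_zero,
      Matrix.mul_neg, Matrix.neg_mul, neg_neg, Matrix.smul_mul, Matrix.mul_smul, neg_zero,
      transpose_mul, Matrix.mul_assoc]
    have h1 := congrArg (fun M => P' * (M * P'ᵀ)) hcK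
    simp only [Matrix.mul_add, Matrix.add_mul, Matrix.mul_smul, Matrix.smul_mul] at h1
    congr 2
    · simp
    · simp
    · linear_combination (norm := module) h1
    · simp
    · simp
    · simp
    · simp
    · rw [hJZ, fromBlocks_multiply]
      congr 1
      · simp only [Matrix.one_mul, Matrix.mul_neg, Matrix.mul_one]
        linear_combination (norm := module) -hcK
      all_goals simp
  have hpf2 : pfOf (sumEnum finSumFinEquiv finSumFinEquiv) N =
      pfSum (skewCone A (P' * P) (K' + P' * K * P'ᵀ)) * pfSum (hyp m R) := by
    rw [← pfOf_shuffle h2' hN, ← hV, pfOf_congr h2' _ _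
      (fromBlocks_diag_transpose_eq_neg hM'' hyp_transpose),
      pfOf_sumEnum h2' _ _ hM'' hyp_transpose]
    simp [V, Z, det_fromBlocks_zero₁₂, pfSum]
  have h3 := hpf1.symm.trans hpf2
  have h4 := pfSum_hyp_mul_self (m := m) (R := R)
  simp only [pfIso]
  linear_combination (-pfSum (hyp l R) * pfSum (hyp m R)) * h3 -
    pfSum (hyp l R) * pfSum (skewCone A (P' * P) (K' + P' * K * P'ᵀ)) * h4

end

end Pfaff

/-! ### Morphisms and frames of sheaves of modules -/

namespace Pfaff

noncomputable section

variable {S : Scheme.{u}}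

theorem mres_glue (M : S.Modules) {V : S.Opens} {ι : Type*} (W : ι → S.Opens) (hW : ∀ i, W i ≤ V)
    (hc : ∀ x ∈ V, ∃ i, x ∈ W i) (s : ∀ i, Γ(M, W i))
    (hs : ∀ i j, mres M (inf_le_left : W i ⊓ W j ≤ W i) (s i) = mres M inf_le_right (s j)) :
    ∃ t : Γ(M, V), ∀ i, mres M (hW i) t = s i := by
  obtain ⟨t, ht, -⟩ := TopCat.Sheaf.existsUnique_gluing' ⟨M.presheaf, M.isSheaf⟩ W V
    (fun i => homOfLE (hW i)) (fun x hx => Opens.mem_iSup.2 (hc x hx)) s (fun i j => hs i j)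
  exact ⟨t, ht⟩

/-- A morphism of `𝒪_S`-modules from its action on sections. -/
def homMk {M N : S.Modules} (φ : ∀ V : S.Opens, Γ(M, V) →+ Γ(N, V))
    (hsmul : ∀ (V : S.Opens) (a : Γ(S, V)) (x : Γ(M, V)), φ V (a • x) = a • φ V x)
    (hres : ∀ (U V : S.Opens) (h : V ≤ U) (x : Γ(M, U)), φ V (mres M h x) = mres N h (φ U x)) :
    M ⟶ N :=
  SheafOfModules.Hom.mk <| PresheafOfModules.homMk
    { app := fun U => AddCommGrpCat.ofHom (φ U.unop)
      naturality := fun U V f => by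
        ext x
        exact hres U.unop V.unop (leOfHom f.unop) x }
    fun U a x => hsmul U.unop a x

theorem hom_ext_sections {M N : S.Modules} {f g : M ⟶ N}
    (h : ∀ (V : S.Opens) (x : Γ(M, V)), f.app V x = g.app V x) : f = g := by
  refine Scheme.Modules.hom_ext _ _ fun U => ?_
  ext x
  exact h U x

theorem app_sum {M N : S.Modules} (f : M ⟶ N) {V : S.Opens} {ι : Type*} (t : Finset ι)
    (x : ι → Γ(M, V)) : f.app V (∑ i ∈ t, x i) = ∑ i ∈ t, f.app V (x i) :=
  map_sum (f.app V).hom x t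

/-- A morphism is determined by its values on local generators. -/
theorem hom_ext_of_isGen {L N : S.Modules} {f g : L ⟶ N}
    (h : ∀ x : S, ∃ (U : S.Opens) (_ : x ∈ U) (s : Γ(L, U)), IsGen L s ∧ f.app U s = g.app U s) :
    f = g := by
  refine hom_ext_sections fun V y => mres_ext N fun x hx => ?_
  obtain ⟨U, hU, s, hs, hfg⟩ := h x
  refine ⟨U ⊓ V, inf_le_right, ⟨hU, hx⟩, ?_⟩
  obtain ⟨c, hc⟩ := (hs (U ⊓ V) inf_le_left).2 (mres L inf_le_right y)
  rw [← app_mres, ← app_mres, ← hc]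
  change f.app _ (c • _) = g.app _ (c • _)
  rw [f.app_smul, g.app_smul, app_mres, app_mres, hfg]

/-- Local generators `s i` of `L` may be sent to any sections `n i` that satisfy the same
relations. -/
theorem exists_hom_of_isGen {L N : S.Modules} {ι : Type*} (U : ι → S.Opens)
    (hU : ∀ x : S, ∃ i, x ∈ U i) (s : ∀ i, Γ(L, U i)) (hs : ∀ i, IsGen L (s i))
    (n : ∀ i, Γ(N, U i))
    (h : ∀ i j (V : S.Opens) (hi : V ≤ U i) (hj : V ≤ U j) (r : Γ(S, V)),
      mres L hi (s i) = r • mres L hj (s j) → mres N hi (n i) = r • mres N hj (n j)) :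
    ∃ φ : L ⟶ N, ∀ i, φ.app (U i) (s i) = n i := by
  -- `P V x y` says that `y` has the value at `x` prescribed by the coefficients of `x`
  let P : ∀ (V : S.Opens) (_ : Γ(L, V)) (_ : Γ(N, V)), Prop := fun V x y =>
    ∀ i (W : S.Opens) (hW : W ≤ V) (hi : W ≤ U i) (c : Γ(S, W)),
      mres L hW x = c • mres L hi (s i) → mres N hW y = c • mres N hi (n i)
  have hP : ∀ (V : S.Opens) (x : Γ(L, V)), ∃ y, P V x y := by
    intro V x
    choose c hc using fun i => (hs i (V ⊓ U i) inf_le_right).2 (mres L inf_le_left x)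
    have hc' : ∀ i, c i • mres L inf_le_right (s i) = mres L (inf_le_left : V ⊓ U i ≤ V) x := hc
    have key : ∀ i j (W : S.Opens) (hW : W ≤ V) (hi : W ≤ U i) (hj : W ≤ U j) (d : Γ(S, W)),
        mres L hW x = d • mres L hi (s i) →
        mres N (le_inf hW hj) (c j • mres N inf_le_right (n j)) = d • mres N hi (n i) := by
      intro i j W hW hi hj d hd
      have h1 := congrArg (mres L (le_inf hW hj)) (hc' j)
      rw [mres_smul, mres_mres, mres_mres, hd] at h1
      -- the generators `s i` and `s j` differ by a factor `r`
      obtain ⟨r, hr⟩ := (hs i W hi).2 (mres L hj (s j))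
      have hr' : mres L hj (s j) = r • mres L hi (s i) := hr.symm
      have h2 := h j i W hj hi r hr'
      rw [hr', ← mul_smul] at h1
      have h3 := (hs i W hi).1 h1
      rw [mres_smul, mres_mres, h2, ← mul_smul, h3]
    obtain ⟨y, hy⟩ := mres_glue N (fun i => V ⊓ U i) (fun i => inf_le_left)
      (fun x hx => (hU x).imp fun i hi => ⟨hx, hi⟩) (fun i => c i • mres N inf_le_right (n i)) (by
        intro i j
        have hd : mres L (inf_le_left.trans inf_le_left : (V ⊓ U i) ⊓ (V ⊓ U j) ≤ V) x =
            res (inf_le_left : (V ⊓ U i) ⊓ (V ⊓ U j) ≤ V ⊓ U i) (c i) •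
              mres L (inf_le_left.trans inf_le_right : (V ⊓ U i) ⊓ (V ⊓ U j) ≤ U i) (s i) := by
          have := congrArg (mres L (inf_le_left : (V ⊓ U i) ⊓ (V ⊓ U j) ≤ _)) (hc' i)
          rw [mres_smul, mres_mres, mres_mres] at this
          exact this.symm
        have := key i j _ _ _ (inf_le_right.trans inf_le_right) _ hd
        rw [mres_smul, mres_mres]
        exact this.symm)
    refine ⟨y, fun i W hW hi d hd => mres_ext N fun p hp => ?_⟩
    obtain ⟨j, hj⟩ := hU p
    refine ⟨W ⊓ U j, inf_le_left, ⟨hp, hj⟩, ?_⟩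
    have hd' := congrArg (mres L (inf_le_left : W ⊓ U j ≤ W)) hd
    rw [mres_smul, mres_mres, mres_mres] at hd'
    have := key i j _ _ _ inf_le_right _ hd'
    rw [← hy, mres_mres] at this
    rw [mres_mres, mres_smul, mres_mres]
    exact this
  have huniq : ∀ (V : S.Opens) (x : Γ(L, V)) (y y' : Γ(N, V)), P V x y → P V x y' → y = y' := by
    intro V x y y' hy hy'
    refine mres_ext N fun p hp => ?_
    obtain ⟨i, hi⟩ := hU p
    obtain ⟨c, hc⟩ := (hs i (V ⊓ U i) inf_le_right).2 (mres L inf_le_left x)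
    exact ⟨V ⊓ U i, inf_le_left, ⟨hp, hi⟩,
      (hy i _ _ _ c hc.symm).trans (hy' i _ _ _ c hc.symm).symm⟩
  choose φ hφ using hP
  have hcoef : ∀ i (W : S.Opens) (hi : W ≤ U i) (x : Γ(L, W)), ∃ c, x = c • mres L hi (s i) :=
    fun i W hi x => ((hs i W hi).2 x).imp fun c hc => hc.symm
  have hext : ∀ (V : S.Opens) (y y' : Γ(N, V)),
      (∀ i (W : S.Opens) (hW : W ≤ V) (_ : W ≤ U i), mres N hW y = mres N hW y') → y = y' := by
    intro V y y' hy
    refine mres_ext N fun p hp => ?_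
    obtain ⟨i, hi⟩ := hU p
    exact ⟨V ⊓ U i, inf_le_left, ⟨hp, hi⟩, hy i _ _ inf_le_right⟩
  refine ⟨homMk (fun V => AddMonoidHom.mk' (φ V) fun x y => hext V _ _ fun i W hW hi => ?_)
    (fun V a x => hext V _ _ fun i W hW hi => ?_) (fun V V' hV x => ?_), fun i => ?_⟩
  · obtain ⟨c, hc⟩ := hcoef i W hi (mres L hW x)
    obtain ⟨d, hd⟩ := hcoef i W hi (mres L hW y)
    rw [map_add, hφ V x i W hW hi c hc, hφ V y i W hW hi d hd, ← add_smul]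
    exact hφ V (x + y) i W hW hi (c + d) (by rw [map_add, hc, hd, add_smul])
  · obtain ⟨c, hc⟩ := hcoef i W hi (mres L hW x)
    change mres N hW (φ V (a • x)) = mres N hW (a • φ V x)
    rw [mres_smul, hφ V x i W hW hi c hc, ← mul_smul]
    exact hφ V (a • x) i W hW hi (res hW a * c) (by rw [mres_smul, hc, mul_smul])
  · refine huniq V' _ _ _ (hφ V' _) fun i W hW hi c hc => ?_
    rw [mres_mres] at hc ⊢
    exact hφ V x i W _ hi c hc
  · change φ (U i) (s i) = n i
    have := hφ (U i) (s i) i (U i) le_rfl le_rfl 1 (by rw [one_smul])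
    rwa [mres_self, mres_self, one_smul] at this

/-! ### Change of frame -/

/-- The matrix of a family of sections with respect to a frame. -/
def coord {M : S.Modules} {U : S.Opens} {n : ℕ} {e : Fin n → Γ(M, U)} (he : IsFrame M e) {ι : Type*}
    (x : ι → Γ(M, U)) : Matrix (Fin n) ι Γ(S, U) :=
  Matrix.of fun i j => he.basis.repr (x j) i

theorem sum_coord {M : S.Modules} {U : S.Opens} {n : ℕ} {e : Fin n → Γ(M, U)} (he : IsFrame M e)
    {ι : Type*} (x : ι → Γ(M, U)) (j : ι) : ∑ i, coord he x i j • e i = x j := by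
  conv_rhs => rw [← he.basis.sum_repr (x j)]
  simp only [IsFrame.basis_apply]
  rfl

theorem coord_unique {M : S.Modules} {U : S.Opens} {n : ℕ} {e : Fin n → Γ(M, U)} (he : IsFrame M e)
    {ι : Type*} {x : ι → Γ(M, U)} {a : Matrix (Fin n) ι Γ(S, U)} (h : ∀ j, x j = ∑ i, a i j • e i) :
    coord he x = a := by
  ext1 i j
  have h1 : ∑ i, coord he x i j • e i = ∑ i, a i j • e i := (sum_coord he x j).trans (h j)
  have h2 := (he U le_rfl).1 (a₁ := fun i => coord he x i j) (a₂ := fun i => a i j)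
    (by simpa only [mres_self] using h1)
  exact congrFun h2 i

theorem coord_self {M : S.Modules} {U : S.Opens} {n : ℕ} {e : Fin n → Γ(M, U)} (he : IsFrame M e) :
    coord he e = 1 :=
  coord_unique he fun j => by simp [Matrix.one_apply]

theorem coord_mul {M : S.Modules} {U : S.Opens} {n m : ℕ} {e : Fin n → Γ(M, U)} (he : IsFrame M e)
    {e' : Fin m → Γ(M, U)} (he' : IsFrame M e') {ι : Type*} (x : ι → Γ(M, U)) :
    coord he e' * coord he' x = coord he x := by
  symm
  refine coord_unique he fun j => ?_
  conv_lhs => rw [← sum_coord he' x j]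
  simp only [Matrix.mul_apply, Finset.sum_smul]
  rw [Finset.sum_comm]
  refine Finset.sum_congr rfl fun i _ => ?_
  conv_lhs => rw [← sum_coord he e' i]
  rw [Finset.smul_sum]
  refine Finset.sum_congr rfl fun k _ => ?_
  rw [← mul_smul, mul_comm]

theorem coord_mul_coord {M : S.Modules} {U : S.Opens} {n m : ℕ} {e : Fin n → Γ(M, U)}
    (he : IsFrame M e) {e' : Fin m → Γ(M, U)} (he' : IsFrame M e') :
    coord he e' * coord he' e = 1 := by
  rw [coord_mul, coord_self]

theorem coord_mres {M : S.Modules} {U V : S.Opens} {n : ℕ} {e : Fin n → Γ(M, U)} (he : IsFrame M e)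
    (h : V ≤ U) {ι : Type*} (x : ι → Γ(M, U)) :
    coord (he.restrict h) (fun i => mres M h (x i)) = (coord he x).map (res h) := by
  refine coord_unique _ fun j => ?_
  conv_lhs => rw [← sum_coord he x j]
  simp [mres_smul]

theorem mres_wedge {E : S.Modules} (hE : IsVectorBundle E) {U V : S.Opens} (h : V ≤ U) {n : ℕ}
    {e : Fin n → Γ(E, U)} (he : IsFrame E e) :
    mres (det hE) h (wedge hE he) = wedge hE (he.restrict h) := by
  have h1 : pres (detPresheaf hE) h (preWedge hE he) = preWedge hE (he.restrict h) :=
    Subtype.ext (extMap_ιMulti _ _ _ _)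
  exact (toShf_pres (detPresheaf hE) h (preWedge hE he)).symm.trans (congrArg _ h1)

/-- An alternating map on a free module of rank `n` is determined by its value at a basis. -/
theorem alternatingMap_apply_eq_det_smul {R M N : Type*} [CommRing R] [AddCommGroup M]
    [AddCommGroup N] [Module R M] [Module R N] {n : ℕ} (f : M [⋀^Fin n]→ₗ[R] N)
    (b : Module.Basis (Fin n) R M) (v : Fin n → M) : f v = b.det v • f b := by
  have h : f = (LinearMap.toSpanSingleton R N (f b)).compAlternatingMap b.det := by
    refine b.ext_alternating fun σ hσ => ?_
    let τ : Equiv.Perm (Fin n) := Equiv.ofBijective σ (Finite.injective_iff_bijective.1 hσ)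
    have h1 := f.map_perm b τ
    have h2 := b.det.map_perm b τ
    change f (fun i => b (τ i)) = b.det (fun i => b (τ i)) • f b
    rw [show (fun i => b (τ i)) = b ∘ τ from rfl, h1, h2, b.det_self]
    simp only [Units.smul_def, ← Int.cast_smul_eq_zsmul R, smul_eq_mul, mul_one]
  exact congrArg (fun g : M [⋀^Fin n]→ₗ[R] N => g v) h

/-- The wedge of a frame changes by the determinant. -/
theorem wedge_eq_det_smul {E : S.Modules} (hE : IsVectorBundle E) {U : S.Opens} {n : ℕ}
    {e e' : Fin n → Γ(E, U)} (he : IsFrame E e) (he' : IsFrame E e') :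
    wedge hE he' = (coord he e').det • wedge hE he := by
  have h1 : ExteriorAlgebra.ιMulti Γ(S, U) n e' =
      (coord he e').det • ExteriorAlgebra.ιMulti Γ(S, U) n e := by
    have h3 := alternatingMap_apply_eq_det_smul (ExteriorAlgebra.ιMulti Γ(S, U) n) he.basis e'
    rwa [show ⇑he.basis = e from funext fun i => IsFrame.basis_apply _ i] at h3
  have h2 : preWedge hE he' = (coord he e').det • preWedge hE he := Subtype.ext h1
  exact (congrArg _ h2).trans (toShf_smul _ _ _)

theorem wedge_congr {E : S.Modules} (hE : IsVectorBundle E) {U : S.Opens} {n : ℕ}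
    {e e' : Fin n → Γ(E, U)} (he : IsFrame E e) (he' : IsFrame E e') (h : e = e') :
    wedge hE he = wedge hE he' := by
  subst h; rfl

/-! ### The Pfaffian of a morphism with respect to frames -/

/-- The frame of `E*` dual to a frame of `E`. -/
def IsFrame.dualFrame {E : S.Modules} {U : S.Opens} {n : ℕ} {e : Fin n → Γ(E, U)}
    (he : IsFrame E e) : Fin n → Γ(dual E, U) :=
  he.exists_dual.choose

theorem IsFrame.isFrame_dualFrame {E : S.Modules} {U : S.Opens} {n : ℕ} {e : Fin n → Γ(E, U)}
    (he : IsFrame E e) : IsFrame (dual E) he.dualFrame :=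
  he.exists_dual.choose_spec.1

theorem IsFrame.pair_dualFrame {E : S.Modules} {U : S.Opens} {n : ℕ} {e : Fin n → Γ(E, U)}
    (he : IsFrame E e) (i j : Fin n) : pair (he.dualFrame i) (e j) = if i = j then 1 else 0 :=
  he.exists_dual.choose_spec.2 i j

theorem IsFrame.pair_dualFrame_eq_coord {E : S.Modules} {U : S.Opens} {n : ℕ}
    {e : Fin n → Γ(E, U)} (he : IsFrame E e) {ι : Type*} (x : ι → Γ(E, U)) (i : Fin n) (j : ι) :
    pair (he.dualFrame i) (x j) = coord he x i j := by
  conv_lhs => rw [← sum_coord he x j]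
  rw [pair_sum_right]
  simp [pair_smul_right, he.pair_dualFrame]

theorem IsFrame.coord_dualFrame {E : S.Modules} {U : S.Opens} {n : ℕ} {e : Fin n → Γ(E, U)}
    (he : IsFrame E e) {ι : Type*} (x : ι → Γ(dual E, U)) (i : Fin n) (j : ι) :
    coord he.isFrame_dualFrame x i j = pair (x j) (e i) := by
  conv_rhs => rw [← sum_coord he.isFrame_dualFrame x j]
  rw [pair_sum_left]
  simp [pair_smul_left, he.pair_dualFrame]

theorem IsFrame.dualFrame_eq {E : S.Modules} {U : S.Opens} {n : ℕ} {e : Fin n → Γ(E, U)}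
    (he : IsFrame E e) {l : Fin n → Γ(dual E, U)}
    (hl : ∀ i j, pair (l i) (e j) = if i = j then 1 else 0) : he.dualFrame = l := by
  have h1 : coord he.isFrame_dualFrame l = 1 := by
    ext1 i j
    rw [he.coord_dualFrame, hl, Matrix.one_apply]
    simp [eq_comm]
  funext j
  have h2 := sum_coord he.isFrame_dualFrame l j
  rw [h1] at h2
  rw [← h2]
  simp [Matrix.one_apply]

theorem coord_app {M N : S.Modules} (g : M ⟶ N) {U : S.Opens} {n m : ℕ} {e : Fin n → Γ(M, U)}
    (he : IsFrame M e) {φ : Fin m → Γ(N, U)} (hφ : IsFrame N φ) {ι : Type*} (x : ι → Γ(M, U)) :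
    coord hφ (fun j => g.app U (x j)) = coord hφ (fun j => g.app U (e j)) * coord he x := by
  refine coord_unique _ fun j => ?_
  conv_lhs => rw [← sum_coord he x j]
  rw [app_sum]
  simp only [Matrix.mul_apply, Finset.sum_smul]
  rw [Finset.sum_comm]
  refine Finset.sum_congr rfl fun i _ => ?_
  have h : g.app U (coord he x i j • e i) = coord he x i j • g.app U (e i) := g.app_smul _ _
  rw [h]
  conv_lhs => rw [← sum_coord hφ (fun j => g.app U (e j)) i]
  rw [Finset.smul_sum]
  refine Finset.sum_congr rfl fun k _ => ?_
  rw [← mul_smul, mul_comm]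

theorem coord_dualMap {E F : S.Modules} (g : E ⟶ F) {U : S.Opens} {n m : ℕ} {e : Fin n → Γ(E, U)}
    (he : IsFrame E e) {φ : Fin m → Γ(F, U)} (hφ : IsFrame F φ) :
    coord he.isFrame_dualFrame (fun j => (dualMap g).app U (hφ.dualFrame j)) =
      (coord hφ fun j => g.app U (e j)).transpose := by
  ext1 i j
  rw [he.coord_dualFrame, pair_dualMap, Matrix.transpose_apply]
  exact hφ.pair_dualFrame_eq_coord (fun j => g.app U (e j)) j i

theorem coord_add {M : S.Modules} {U : S.Opens} {n : ℕ} {e : Fin n → Γ(M, U)} (he : IsFrame M e)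
    {ι : Type*} (x y : ι → Γ(M, U)) : coord he (fun j => x j + y j) = coord he x + coord he y := by
  ext1 i j
  simp [coord]

namespace SkewComplex

variable {X Y Z : SkewComplex S} {U : S.Opens} {n m l : ℕ}

/-- The matrix of `α_E` with respect to a frame of `E` and the dual frame of `E*`. -/
def gram (X : SkewComplex S) {U : S.Opens} {n : ℕ} (e : Fin n → Γ(X.E, U)) :
    Matrix (Fin n) (Fin n) Γ(S, U) :=
  Matrix.of fun i j => pair (X.α.app U (e j)) (e i)

theorem gram_transpose (e : Fin n → Γ(X.E, U)) : (X.gram e).transpose = -X.gram e := by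
  ext1 i j
  exact X.skew U (e i) (e j)

theorem coord_dualFrame_α {e : Fin n → Γ(X.E, U)} (he : IsFrame X.E e) :
    coord he.isFrame_dualFrame (fun j => X.α.app U (e j)) = X.gram e := by
  ext1 i j
  rw [he.coord_dualFrame]
  rfl

/-- The matrix of the component of degree `0`. -/
def mat₀ (f : ChainMap X Y) (e : Fin n → Γ(X.E, U)) {φ : Fin m → Γ(Y.E, U)}
    (hφ : IsFrame Y.E φ) : Matrix (Fin m) (Fin n) Γ(S, U) :=
  coord hφ fun j => f.f₀.app U (e j)

/-- The matrix of the component of degree `1`, with respect to the dual frames. -/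
def mat₁ (f : ChainMap X Y) {e : Fin n → Γ(X.E, U)} (he : IsFrame X.E e)
    {φ : Fin m → Γ(Y.E, U)} (hφ : IsFrame Y.E φ) : Matrix (Fin m) (Fin n) Γ(S, U) :=
  coord hφ.isFrame_dualFrame fun j => f.f₁.app U (he.dualFrame j)

theorem mat₁_mul_gram (f : ChainMap X Y) {e : Fin n → Γ(X.E, U)} (he : IsFrame X.E e)
    {φ : Fin m → Γ(Y.E, U)} (hφ : IsFrame Y.E φ) :
    mat₁ f he hφ * X.gram e = Y.gram φ * mat₀ f e hφ := by
  rw [← coord_dualFrame_α he, ← coord_dualFrame_α hφ, mat₁, mat₀, ← coord_app, ← coord_app]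
  congr 1
  funext j
  exact congrArg (fun k : X.E ⟶ dual Y.E => k.app U (e j)) f.comm

theorem mat₀_comp (f : ChainMap X Y) (g : ChainMap Y Z) (e : Fin n → Γ(X.E, U))
    {φ : Fin m → Γ(Y.E, U)} (hφ : IsFrame Y.E φ) {ψ : Fin l → Γ(Z.E, U)} (hψ : IsFrame Z.E ψ) :
    mat₀ (f.comp g) e hψ = mat₀ g φ hψ * mat₀ f e hφ := by
  rw [mat₀, mat₀, mat₀, ← coord_app]
  rfl

theorem mat₁_comp (f : ChainMap X Y) (g : ChainMap Y Z) {e : Fin n → Γ(X.E, U)}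
    (he : IsFrame X.E e) {φ : Fin m → Γ(Y.E, U)} (hφ : IsFrame Y.E φ) {ψ : Fin l → Γ(Z.E, U)}
    (hψ : IsFrame Z.E ψ) : mat₁ (f.comp g) he hψ = mat₁ g hφ hψ * mat₁ f he hφ := by
  rw [mat₁, mat₁, mat₁, ← coord_app]
  rfl

theorem mat₀_change (f : ChainMap X Y) {e e' : Fin n → Γ(X.E, U)} (he : IsFrame X.E e)
    {φ φ' : Fin m → Γ(Y.E, U)} (hφ : IsFrame Y.E φ) (hφ' : IsFrame Y.E φ') :
    mat₀ f e' hφ' = coord hφ' φ * mat₀ f e hφ * coord he e' := by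
  rw [mat₀, coord_app _ he, mat₀, coord_mul]

theorem coord_dualFrame_dualFrame {E : S.Modules} {e : Fin n → Γ(E, U)} (he : IsFrame E e)
    {e' : Fin n → Γ(E, U)} (he' : IsFrame E e') :
    coord he.isFrame_dualFrame he'.dualFrame = (coord he' e).transpose := by
  ext1 i j
  rw [he.coord_dualFrame, he'.pair_dualFrame_eq_coord, Matrix.transpose_apply]

theorem gram_change {e e' : Fin n → Γ(X.E, U)} (he : IsFrame X.E e) (he' : IsFrame X.E e') :
    X.gram e' = (coord he e').transpose * X.gram e * coord he e' := by
  rw [← coord_dualFrame_α he', coord_app _ he, ← coord_dualFrame_α he, ← coord_dualFrame_dualFrame,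
    coord_mul]

theorem mat₁_change (f : ChainMap X Y) {e e' : Fin n → Γ(X.E, U)} (he : IsFrame X.E e)
    (he' : IsFrame X.E e') {φ φ' : Fin m → Γ(Y.E, U)} (hφ : IsFrame Y.E φ)
    (hφ' : IsFrame Y.E φ') :
    mat₁ f he' hφ' = (coord hφ φ').transpose * mat₁ f he hφ * (coord he' e).transpose := by
  rw [mat₁, coord_app _ he.isFrame_dualFrame, mat₁, ← coord_dualFrame_dualFrame,
    ← coord_dualFrame_dualFrame, coord_mul]

/-- If `f` is homotopic to the identity by a homotopy with matrix `h`, then its matrix in degree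
`0` is `1 + h A` and its matrix in degree `1` is `1 + A h`. -/
theorem exists_mat_of_homotopic {f : ChainMap X X} (hf : f.Homotopic (ChainMap.id X))
    {e : Fin n → Γ(X.E, U)} (he : IsFrame X.E e) : ∃ h : Matrix (Fin n) (Fin n) Γ(S, U),
      mat₀ f e he = 1 + h * X.gram e ∧ mat₁ f he he = 1 + X.gram e * h := by
  obtain ⟨k, h0, h1⟩ := hf
  refine ⟨coord he fun j => k.app U (he.dualFrame j), ?_, ?_⟩
  · rw [← coord_dualFrame_α he, ← coord_app, ← coord_self he, mat₀, ← coord_add]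
    congr 1
    funext j
    have h2 := congrArg (fun k : X.E ⟶ X.E => k.app U (e j)) h0
    change f.f₀.app U (e j) - e j = k.app U (X.α.app U (e j)) at h2
    rw [← h2]; abel
  · rw [← coord_dualFrame_α he, ← coord_app, ← coord_self he.isFrame_dualFrame, mat₁, ← coord_add]
    congr 1
    funext j
    have h2 := congrArg (fun k : dual X.E ⟶ dual X.E => k.app U (he.dualFrame j)) h1
    change f.f₁.app U (he.dualFrame j) - he.dualFrame j = X.α.app U (k.app U (he.dualFrame j)) at h2
    rw [← h2]; abel

/-- A homotopy can be replaced by a skew-symmetric one. -/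
theorem exists_skew_homotopy {R : Type*} [CommRing R] (h2 : IsUnit (2 : R))
    {A P h : Matrix (Fin n) (Fin n) R} (hA : A.transpose = -A) (h0 : P = 1 + h * A)
    (h1 : P.transpose = 1 + A * h) :
    ∃ H : Matrix (Fin n) (Fin n) R, H.transpose = -H ∧ P = 1 + H * A := by
  obtain ⟨c, hc⟩ := h2.exists_right_inv
  have h3 : h.transpose * A = -(h * A) := by
    have := congrArg Matrix.transpose h1
    rw [Matrix.transpose_transpose, h0] at this
    simp only [Matrix.transpose_add, Matrix.transpose_one, Matrix.transpose_mul, hA,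
      Matrix.mul_neg, add_right_inj] at this
    rw [this, neg_neg]
  refine ⟨c • (h - h.transpose), ?_, ?_⟩
  · simp only [Matrix.transpose_smul, Matrix.transpose_sub, Matrix.transpose_transpose]
    module
  · rw [h0, Matrix.smul_mul, Matrix.sub_mul, h3]
    have : c • (h * A) + c • (h * A) = h * A := by rw [← add_smul, ← two_mul, hc, one_smul]
    linear_combination (norm := module) -this

theorem isIsometry_chain (f : X ⟶ Y) : (Hom.chain f).IsIsometry :=
  Hom.isIsometry f

/-- With respect to frames, a morphism of skew-symmetric complexes is given by the matrices of an
isometry. -/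
theorem exists_isIsometryMatrix (h2 : IsUnit (2 : Γ(S, U))) {f : ChainMap X Y}
    (hf : f.IsIsometry) {e : Fin n → Γ(X.E, U)} (he : IsFrame X.E e) {φ : Fin m → Γ(Y.E, U)}
    (hφ : IsFrame Y.E φ) : ∃ H K, IsIsometryMatrix (X.gram e) (Y.gram φ) (mat₀ f e hφ)
      (mat₁ f he hφ).transpose H K := by
  obtain ⟨g, ⟨hg1, hg2⟩, hfg, hgf⟩ := hf
  have hQ : (mat₁ f he hφ).transpose = mat₀ g φ he := by
    rw [mat₁, hg2, coord_dualMap, Matrix.transpose_transpose, mat₀]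
  have hP : mat₁ g hφ he = (mat₀ f e hφ).transpose := by
    rw [mat₁, hg1, coord_dualMap, mat₀]
  obtain ⟨h, hh0, hh1⟩ := exists_mat_of_homotopic hfg he
  obtain ⟨k, hk0, hk1⟩ := exists_mat_of_homotopic hgf hφ
  rw [mat₀_comp _ _ _ hφ] at hh0
  rw [mat₀_comp _ _ _ he] at hk0
  rw [mat₁_comp _ _ _ hφ] at hh1
  rw [mat₁_comp _ _ _ he] at hk1
  obtain ⟨H, hH, hH'⟩ := exists_skew_homotopy h2 (gram_transpose e) hh0 (by
    rw [← hh1, Matrix.transpose_mul, hP, ← hQ, Matrix.transpose_transpose])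
  obtain ⟨K, hK, hK'⟩ := exists_skew_homotopy h2 (gram_transpose φ) hk0 (by
    rw [← hk1, Matrix.transpose_mul, hP, ← hQ, Matrix.transpose_transpose])
  exact ⟨H, K, gram_transpose e, gram_transpose φ, hH, hK,
    by rw [Matrix.transpose_transpose, mat₁_mul_gram], by rw [hQ, hH'], by rw [hQ, hK']⟩

open Classical in
/-- The Pfaffian of a morphism with respect to frames `e` of `E` and `φ` of `F`. It does not depend
on the chosen homotopies. -/
def pfCoeff (f : X ⟶ Y) {e : Fin n → Γ(X.E, U)} (he : IsFrame X.E e) {φ : Fin m → Γ(Y.E, U)}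
    (hφ : IsFrame Y.E φ) : Γ(S, U) :=
  if h : ∃ K H, IsIsometryMatrix (X.gram e) (Y.gram φ) (mat₀ (Hom.chain f) e hφ)
      (mat₁ (Hom.chain f) he hφ).transpose H K then
    pfIso (X.gram e) (mat₀ (Hom.chain f) e hφ) h.choose
  else 0

theorem pfCoeff_eq (h2 : IsUnit (2 : Γ(S, U))) (f : X ⟶ Y) {e : Fin n → Γ(X.E, U)}
    (he : IsFrame X.E e) {φ : Fin m → Γ(Y.E, U)} (hφ : IsFrame Y.E φ)
    {K : Matrix (Fin m) (Fin m) Γ(S, U)} (hK : K.transpose = -K)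
    (h : mat₀ (Hom.chain f) e hφ * (mat₁ (Hom.chain f) he hφ).transpose = 1 + K * Y.gram φ) :
    pfCoeff f he hφ = pfIso (X.gram e) (mat₀ (Hom.chain f) e hφ) K := by
  obtain ⟨H', K', h'⟩ := exists_isIsometryMatrix h2 (isIsometry_chain f) he hφ
  have hex : ∃ K H, IsIsometryMatrix (X.gram e) (Y.gram φ) (mat₀ (Hom.chain f) e hφ)
      (mat₁ (Hom.chain f) he hφ).transpose H K := ⟨K', H', h'⟩
  rw [pfCoeff, dif_pos hex]
  exact (hex.choose_spec.choose_spec.pfIso_eq_of_homotopy h2 hK h).symm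

/-- The Pfaffian of a morphism depends only on the matrices, in a way that is compatible with ring
homomorphisms. -/
theorem map_pfCoeff {S' : Scheme.{u}} {X' Y' : SkewComplex S'} {U' : S'.Opens}
    (h2 : IsUnit (2 : Γ(S, U))) (ρ : Γ(S, U) →+* Γ(S', U')) (f : X ⟶ Y) (f' : X' ⟶ Y')
    {e : Fin n → Γ(X.E, U)} (he : IsFrame X.E e)
    {φ : Fin m → Γ(Y.E, U)} (hφ : IsFrame Y.E φ) {e' : Fin n → Γ(X'.E, U')} (he' : IsFrame X'.E e')
    {φ' : Fin m → Γ(Y'.E, U')} (hφ' : IsFrame Y'.E φ') (hA : X'.gram e' = (X.gram e).map ρ)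
    (hB : Y'.gram φ' = (Y.gram φ).map ρ)
    (h0 : mat₀ (Hom.chain f') e' hφ' = (mat₀ (Hom.chain f) e hφ).map ρ)
    (h1 : mat₁ (Hom.chain f') he' hφ' = (mat₁ (Hom.chain f) he hφ).map ρ) :
    pfCoeff f' he' hφ' = ρ (pfCoeff f he hφ) := by
  obtain ⟨H, K, h⟩ := exists_isIsometryMatrix h2 (isIsometry_chain f) he hφ
  have h2' : IsUnit (2 : Γ(S', U')) := by
    have := h2.map ρ
    rwa [map_ofNat] at this
  rw [pfCoeff_eq h2 f he hφ h.skew_K h.mul_right, pfCoeff_eq h2' f' he' hφ'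
    (map_transpose_eq_neg ρ h.skew_K) ?_, map_pfIso, hA, h0]
  have := congrArg (fun M => M.map ρ) h.mul_right
  rw [h0, h1, hB, ← Matrix.transpose_map, ← Matrix.map_mul, this]
  ext1 i j
  simp [Matrix.one_apply, Matrix.mul_apply, apply_ite ρ]

theorem gram_mres {V : S.Opens} (h : V ≤ U) (e : Fin n → Γ(X.E, U)) :
    X.gram (fun i => mres X.E h (e i)) = (X.gram e).map (res h) := by
  ext1 i j
  change pair (X.α.app V (mres X.E h (e j))) (mres X.E h (e i)) = res h _
  rw [app_mres, pair_mres]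
  rfl

theorem mat₀_mres {V : S.Opens} (h : V ≤ U) (f : ChainMap X Y) (e : Fin n → Γ(X.E, U))
    {φ : Fin m → Γ(Y.E, U)} (hφ : IsFrame Y.E φ) :
    mat₀ f (fun i => mres X.E h (e i)) (hφ.restrict h) = (mat₀ f e hφ).map (res h) := by
  rw [mat₀, mat₀, ← coord_mres]
  congr 1
  funext j
  exact app_mres _ _ _

theorem dualFrame_restrict {E : S.Modules} {V : S.Opens} (h : V ≤ U) {e : Fin n → Γ(E, U)}
    (he : IsFrame E e) : (he.restrict h).dualFrame = fun i => mres (dual E) h (he.dualFrame i) :=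
  (he.restrict h).dualFrame_eq fun i j => by
    rw [pair_mres, he.pair_dualFrame]
    simp [apply_ite (res h)]

theorem mat₁_mres {V : S.Opens} (h : V ≤ U) (f : ChainMap X Y) {e : Fin n → Γ(X.E, U)}
    (he : IsFrame X.E e) {φ : Fin m → Γ(Y.E, U)} (hφ : IsFrame Y.E φ) :
    mat₁ f (he.restrict h) (hφ.restrict h) = (mat₁ f he hφ).map (res h) := by
  ext1 i j
  rw [mat₁, IsFrame.coord_dualFrame, dualFrame_restrict, app_mres, pair_mres, Matrix.map_apply,
    mat₁, IsFrame.coord_dualFrame]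

theorem pfCoeff_restrict (h2 : IsUnit (2 : Γ(S, U))) {V : S.Opens} (h : V ≤ U) (f : X ⟶ Y)
    {e : Fin n → Γ(X.E, U)} (he : IsFrame X.E e) {φ : Fin m → Γ(Y.E, U)} (hφ : IsFrame Y.E φ) :
    pfCoeff f (he.restrict h) (hφ.restrict h) = res h (pfCoeff f he hφ) :=
  map_pfCoeff h2 (res h) f f he hφ _ _ (gram_mres h e) (gram_mres h φ) (mat₀_mres h _ e hφ)
    (mat₁_mres h _ he hφ)

theorem pfCoeff_change (h2 : IsUnit (2 : Γ(S, U))) (f : X ⟶ Y) {e e' : Fin n → Γ(X.E, U)}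
    (he : IsFrame X.E e) (he' : IsFrame X.E e') {φ φ' : Fin m → Γ(Y.E, U)} (hφ : IsFrame Y.E φ)
    (hφ' : IsFrame Y.E φ') : pfCoeff f he' hφ' =
      (coord he e').det * (coord hφ' φ).det * pfCoeff f he hφ := by
  obtain ⟨H, K, h⟩ := exists_isIsometryMatrix h2 (isIsometry_chain f) he hφ
  have hK : (coord hφ' φ * K * (coord hφ' φ).transpose).transpose =
      -(coord hφ' φ * K * (coord hφ' φ).transpose) := by
    simp [Matrix.transpose_mul, h.skew_K, Matrix.mul_assoc]
  have hb : (coord hφ' φ).transpose * (coord hφ φ').transpose = 1 := by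
    rw [← Matrix.transpose_mul, coord_mul_coord, Matrix.transpose_one]
  rw [pfCoeff_eq h2 f he hφ h.skew_K h.mul_right, pfCoeff_eq h2 f he' hφ' hK ?_,
    mat₀_change _ he hφ hφ', gram_change he he',
    pfIso_change_basis h2 (gram_transpose e) _ h.skew_K]
  have hm := h.mul_right
  rw [mat₀_change _ he hφ hφ', mat₁_change _ he he' hφ hφ', gram_change hφ hφ']
  simp only [Matrix.transpose_mul, Matrix.transpose_transpose, Matrix.mul_assoc]
  rw [← Matrix.mul_assoc (coord he e'), coord_mul_coord, Matrix.one_mul,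
    ← Matrix.mul_assoc (coord hφ' φ).transpose, hb, Matrix.one_mul,
    ← Matrix.mul_assoc (mat₀ _ _ _), hm, Matrix.add_mul, Matrix.mul_add, Matrix.one_mul,
    coord_mul_coord, Matrix.mul_assoc]

theorem isUnit_pfCoeff (h2 : IsUnit (2 : Γ(S, U))) (f : X ⟶ Y) {e : Fin n → Γ(X.E, U)}
    (he : IsFrame X.E e) {φ : Fin m → Γ(Y.E, U)} (hφ : IsFrame Y.E φ) :
    IsUnit (pfCoeff f he hφ) := by
  obtain ⟨H, K, h⟩ := exists_isIsometryMatrix h2 (isIsometry_chain f) he hφ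
  rw [pfCoeff_eq h2 f he hφ h.skew_K h.mul_right]
  exact h.isUnit_pfIso h2

theorem pfCoeff_comp (h2 : IsUnit (2 : Γ(S, U))) (f : X ⟶ Y) (g : Y ⟶ Z) {e : Fin n → Γ(X.E, U)}
    (he : IsFrame X.E e) {φ : Fin m → Γ(Y.E, U)} (hφ : IsFrame Y.E φ) {ψ : Fin l → Γ(Z.E, U)}
    (hψ : IsFrame Z.E ψ) : pfCoeff (f ≫ g) he hψ = pfCoeff f he hφ * pfCoeff g hφ hψ := by
  obtain ⟨H, K, h⟩ := exists_isIsometryMatrix h2 (isIsometry_chain f) he hφ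
  obtain ⟨H', K', h'⟩ := exists_isIsometryMatrix h2 (isIsometry_chain g) hφ hψ
  have e0 : mat₀ (Hom.chain (f ≫ g)) e hψ = mat₀ (Hom.chain g) φ hψ * mat₀ (Hom.chain f) e hφ :=
    mat₀_comp _ _ _ _ _
  have e1 : mat₁ (Hom.chain (f ≫ g)) he hψ = mat₁ (Hom.chain g) hφ hψ * mat₁ (Hom.chain f) he hφ :=
    mat₁_comp _ _ _ _ _
  rw [pfCoeff_eq h2 f he hφ h.skew_K h.mul_right, pfCoeff_eq h2 g hφ hψ h'.skew_K h'.mul_right,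
    ← h.pfIso_comp h2 h', ← e0]
  refine pfCoeff_eq h2 (f ≫ g) he hψ ?_ ?_
  · simp [Matrix.transpose_mul, h.skew_K, h'.skew_K, Matrix.mul_assoc]
    abel
  · have h3 := h'.comm'
    generalize hP : mat₀ (Hom.chain f) e hφ = P at *
    generalize hP' : mat₀ (Hom.chain g) φ hψ = P' at *
    generalize hQ : mat₁ (Hom.chain f) he hφ = Q at *
    generalize hQ' : mat₁ (Hom.chain g) hφ hψ = Q' at *
    rw [e0, e1, Matrix.transpose_mul, Matrix.mul_assoc, ← Matrix.mul_assoc P, h.mul_right,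
      Matrix.add_mul, Matrix.mul_assoc K, h3, Matrix.mul_add, Matrix.one_mul, h'.mul_right]
    simp only [Matrix.add_mul, Matrix.mul_assoc, add_assoc]

theorem pfCoeff_of_homotopicToId (h2 : IsUnit (2 : Γ(S, U))) {f : X ⟶ X} (hf : HomotopicToId f)
    {e : Fin n → Γ(X.E, U)} (he : IsFrame X.E e) : pfCoeff f he he = 1 := by
  obtain ⟨h, h0, h1⟩ := exists_mat_of_homotopic hf he
  have hA := gram_transpose (X := X) e
  rw [← pfIso_one_add h2 hA h, ← h0]
  refine pfCoeff_eq h2 f he he ?_ ?_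
  · simp only [Matrix.transpose_sub, Matrix.transpose_transpose, Matrix.transpose_mul, hA,
      Matrix.mul_assoc, Matrix.neg_mul, Matrix.mul_neg]
    abel
  · rw [h0, h1]
    simp only [Matrix.transpose_add, Matrix.transpose_one, Matrix.transpose_mul, hA,
      Matrix.mul_assoc, Matrix.mul_neg, Matrix.mul_add, Matrix.add_mul, Matrix.sub_mul,
      Matrix.mul_one, Matrix.one_mul]
    abel

theorem even_add_of_frames [Nontrivial Γ(S, U)] (h2 : IsUnit (2 : Γ(S, U))) (f : X ⟶ Y)
    {e : Fin n → Γ(X.E, U)} (he : IsFrame X.E e) {φ : Fin m → Γ(Y.E, U)} (hφ : IsFrame Y.E φ) :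
    Even (n + m) := by
  by_contra h
  rw [Nat.not_even_iff_odd] at h
  obtain ⟨H, K, hK⟩ := exists_isIsometryMatrix h2 (isIsometry_chain f) he hφ
  have := hK.isUnit_pfIso h2
  rw [pfIso_of_odd h] at this
  exact not_isUnit_zero this

end SkewComplex

/-! ### The Pfaffian functor -/

theorem mres_eq_of_isEmpty (M : S.Modules) {V : S.Opens} (hV : ¬ ∃ x, x ∈ V) (s t : Γ(M, V)) :
    s = t :=
  mres_ext M fun x hx => (hV ⟨x, hx⟩).elim

theorem IsGen.eq_of_smul_eq {L : S.Modules} {U : S.Opens} {s : Γ(L, U)} (hs : IsGen L s)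
    {a b : Γ(S, U)} (h : a • s = b • s) : a = b :=
  (hs U le_rfl).1 (by simpa only [mres_self] using h)

theorem IsGen.exists_smul_eq {L : S.Modules} {U : S.Opens} {s : Γ(L, U)} (hs : IsGen L s)
    (t : Γ(L, U)) : ∃ a : Γ(S, U), t = a • s := by
  obtain ⟨a, ha⟩ := (hs U le_rfl).2 t
  exact ⟨a, by rw [← ha]; simp only [mres_self]⟩

theorem IsGen.unit_smul {L : S.Modules} {U : S.Opens} {s : Γ(L, U)} (hs : IsGen L s)
    {a : Γ(S, U)} (ha : IsUnit a) : IsGen L (a • s) := by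
  intro V hV
  have h1 : (fun c : Γ(S, V) => c • mres L hV (a • s)) =
      (fun c : Γ(S, V) => c • mres L hV s) ∘ fun c => c * res hV a := by
    funext c
    simp [mres_smul, mul_smul]
  rw [h1]
  exact (hs V hV).comp (IsUnit.isUnit_iff_mulRight_bijective.1 (ha.map (res hV)))

/-- Two families of local generators with the same transition functions define an isomorphism. -/
theorem exists_iso_of_isGen {L N : S.Modules} {ι : Type*} (U : ι → S.Opens)
    (hU : ∀ x : S, ∃ i, x ∈ U i) (s : ∀ i, Γ(L, U i)) (hs : ∀ i, IsGen L (s i))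
    (n : ∀ i, Γ(N, U i)) (hn : ∀ i, IsGen N (n i))
    (h : ∀ i j (V : S.Opens) (hi : V ≤ U i) (hj : V ≤ U j) (r : Γ(S, V)),
      mres L hi (s i) = r • mres L hj (s j) → mres N hi (n i) = r • mres N hj (n j)) :
    ∃ φ : L ≅ N, ∀ i, φ.hom.app (U i) (s i) = n i := by
  obtain ⟨φ, hφ⟩ := exists_hom_of_isGen U hU s hs n h
  obtain ⟨ψ, hψ⟩ := exists_hom_of_isGen U hU n hn s (by
    intro i j V hi hj r hr
    obtain ⟨r', hr'⟩ := ((hs j).restrict hj).exists_smul_eq (mres L hi (s i))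
    have h1 := h i j V hi hj r' hr'
    rw [hr] at h1
    rw [hr', ((hn j).restrict hj).eq_of_smul_eq h1])
  refine ⟨⟨φ, ψ, hom_ext_of_isGen fun x => ?_, hom_ext_of_isGen fun x => ?_⟩, hφ⟩
  · obtain ⟨i, hi⟩ := hU x
    exact ⟨U i, hi, s i, hs i, (congrArg (ψ.app (U i)) (hφ i)).trans (hψ i)⟩
  · obtain ⟨i, hi⟩ := hU x
    exact ⟨U i, hi, n i, hn i, (congrArg (φ.app (U i)) (hψ i)).trans (hφ i)⟩

/-- A frame of `M` and a frame of `N` over a common open set. -/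
structure LocalFrames (M N : S.Modules) where
  /-- The open set. -/
  U : S.Opens
  /-- The rank of `M`. -/
  n : ℕ
  /-- The rank of `N`. -/
  m : ℕ
  /-- The frame of `M`. -/
  e : Fin n → Γ(M, U)
  /-- The frame of `N`. -/
  φ : Fin m → Γ(N, U)
  isFrame_left : IsFrame M e
  isFrame_right : IsFrame N φ

theorem IsVectorBundle.exists_frames {M N : S.Modules} (hM : IsVectorBundle M)
    (hN : IsVectorBundle N) (x : S) : ∃ (U : S.Opens) (_ : x ∈ U) (n m : ℕ) (e : Fin n → Γ(M, U))
      (φ : Fin m → Γ(N, U)), IsFrame M e ∧ IsFrame N φ := by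
  obtain ⟨U, hU, n, e, he⟩ := hM x
  obtain ⟨V, hV, m, φ, hφ⟩ := hN x
  exact ⟨U ⊓ V, ⟨hU, hV⟩, n, m, _, _, he.restrict inf_le_left, hφ.restrict inf_le_right⟩

/-- A morphism from a determinant is determined by its values at the wedges of frames. -/
theorem det_hom_ext {E N : S.Modules} (hE : IsVectorBundle E) {f g : det hE ⟶ N}
    (h : ∀ x : S, ∃ (U : S.Opens) (_ : x ∈ U) (n : ℕ) (e : Fin n → Γ(E, U)) (he : IsFrame E e),
      f.app U (wedge hE he) = g.app U (wedge hE he)) : f = g :=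
  hom_ext_of_isGen fun x => by
    obtain ⟨U, hU, n, e, he, h⟩ := h x
    exact ⟨U, hU, _, isGen_wedge hE he, h⟩

namespace SkewComplex

variable {X Y Z : SkewComplex S}

theorem pfCoeff_smul_wedge {U : S.Opens} (h2 : IsUnit (2 : Γ(S, U))) (f : X ⟶ Y) {n m : ℕ}
    {e e' : Fin n → Γ(X.E, U)} {φ φ' : Fin m → Γ(Y.E, U)} (he : IsFrame X.E e)
    (he' : IsFrame X.E e') (hφ : IsFrame Y.E φ) (hφ' : IsFrame Y.E φ') {r : Γ(S, U)}
    (hr : wedge X.isVectorBundle he = r • wedge X.isVectorBundle he') :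
    pfCoeff f he hφ • wedge Y.isVectorBundle hφ =
      r • pfCoeff f he' hφ' • wedge Y.isVectorBundle hφ' := by
  rw [wedge_eq_det_smul _ he' he] at hr
  have hr' := (isGen_wedge _ _).eq_of_smul_eq hr
  rw [← hr', pfCoeff_change h2 f he' he hφ' hφ, wedge_eq_det_smul _ hφ' hφ, ← mul_smul, ← mul_smul]
  congr 1
  have h3 := congrArg Matrix.det (coord_mul_coord hφ' hφ)
  rw [Matrix.det_mul, Matrix.det_one] at h3
  linear_combination (coord he' e).det * pfCoeff f he' hφ' * h3

/-- The local isomorphisms given by `pfCoeff` glue. -/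
theorem exists_pfaffian_iso (h2 : ∀ U : S.Opens, IsUnit (2 : Γ(S, U))) (f : X ⟶ Y) :
    ∃ d : det X.isVectorBundle ≅ det Y.isVectorBundle,
      ∀ (U : S.Opens) (n m : ℕ) (e : Fin n → Γ(X.E, U)) (φ : Fin m → Γ(Y.E, U))
        (he : IsFrame X.E e) (hφ : IsFrame Y.E φ),
        d.hom.app U (wedge X.isVectorBundle he) = pfCoeff f he hφ • wedge Y.isVectorBundle hφ := by
  obtain ⟨d, hd⟩ := exists_iso_of_isGen (L := det X.isVectorBundle) (N := det Y.isVectorBundle)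
    (ι := LocalFrames X.E Y.E) (fun i => i.U)
    (fun x => by
      obtain ⟨U, hx, n, m, e, φ, he, hφ⟩ := X.isVectorBundle.exists_frames Y.isVectorBundle x
      exact ⟨⟨U, n, m, e, φ, he, hφ⟩, hx⟩)
    (fun i => wedge X.isVectorBundle i.isFrame_left) (fun i => isGen_wedge _ _)
    (fun i => pfCoeff f i.isFrame_left i.isFrame_right • wedge Y.isVectorBundle i.isFrame_right)
    (fun i => (isGen_wedge _ _).unit_smul (isUnit_pfCoeff (h2 _) _ _ _)) (by
      rintro ⟨U, n, m, e, φ, he, hφ⟩ ⟨U', n', m', e', φ', he', hφ'⟩ V hi hj r hr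
      -- the ranks agree only if `V` is nonempty
      by_cases hV : ∃ x, x ∈ V
      swap
      · exact mres_eq_of_isEmpty _ hV _ _
      obtain ⟨x, hx⟩ := hV
      obtain rfl : n = n' := he.card_eq he' (hi hx) (hj hx)
      obtain rfl : m = m' := hφ.card_eq hφ' (hi hx) (hj hx)
      have hr' := pfCoeff_smul_wedge (h2 V) f (he.restrict hi) (he'.restrict hj) (hφ.restrict hi)
        (hφ'.restrict hj) (r := r)
        ((mres_wedge _ hi he).symm.trans (hr.trans (congrArg _ (mres_wedge _ hj he'))))
      rw [pfCoeff_restrict (h2 _), pfCoeff_restrict (h2 _), ← mres_wedge, ← mres_wedge,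
        ← mres_smul, ← mres_smul] at hr'
      exact hr')
  exact ⟨d, fun U n m e φ he hφ => hd ⟨U, n, m, e, φ, he, hφ⟩⟩

/-- The Pfaffian of a morphism: locally, multiplication by `pfCoeff`. -/
def pfaffianIso (h2 : ∀ U : S.Opens, IsUnit (2 : Γ(S, U))) (f : X ⟶ Y) :
    det X.isVectorBundle ≅ det Y.isVectorBundle :=
  (exists_pfaffian_iso h2 f).choose

theorem pfaffianIso_wedge (h2 : ∀ U : S.Opens, IsUnit (2 : Γ(S, U))) (f : X ⟶ Y) {U : S.Opens}
    {n m : ℕ} {e : Fin n → Γ(X.E, U)} {φ : Fin m → Γ(Y.E, U)} (he : IsFrame X.E e)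
    (hφ : IsFrame Y.E φ) : (pfaffianIso h2 f).hom.app U (wedge X.isVectorBundle he) =
      pfCoeff f he hφ • wedge Y.isVectorBundle hφ :=
  (exists_pfaffian_iso h2 f).choose_spec U n m e φ he hφ

theorem pfaffianIso_of_homotopicToId (h2 : ∀ U : S.Opens, IsUnit (2 : Γ(S, U))) {f : X ⟶ X}
    (hf : HomotopicToId f) : pfaffianIso h2 f = Iso.refl _ := by
  refine Iso.ext (det_hom_ext _ fun x => ?_)
  obtain ⟨U, hU, n, e, he⟩ := X.isVectorBundle x
  refine ⟨U, hU, n, e, he, ?_⟩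
  rw [pfaffianIso_wedge h2 f he he, pfCoeff_of_homotopicToId (h2 U) hf, one_smul]
  rfl

theorem pfaffianIso_comp (h2 : ∀ U : S.Opens, IsUnit (2 : Γ(S, U))) (f : X ⟶ Y) (g : Y ⟶ Z) :
    pfaffianIso h2 (f ≫ g) = pfaffianIso h2 f ≪≫ pfaffianIso h2 g := by
  refine Iso.ext (det_hom_ext _ fun x => ?_)
  obtain ⟨U, hU, n, m, e, φ, he, hφ⟩ := X.isVectorBundle.exists_frames Y.isVectorBundle x
  obtain ⟨V, hV, l, ψ, hψ⟩ := Z.isVectorBundle x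
  refine ⟨U ⊓ V, ⟨hU, hV⟩, n, _, he.restrict inf_le_left, ?_⟩
  have hφ' := hφ.restrict (inf_le_left : U ⊓ V ≤ U)
  have hψ' := hψ.restrict (inf_le_right : U ⊓ V ≤ V)
  rw [pfaffianIso_wedge h2 _ _ hψ', pfCoeff_comp (h2 _) f g _ hφ' hψ', mul_smul,
    ← pfaffianIso_wedge h2 g hφ' hψ']
  change _ = (pfaffianIso h2 g).hom.app _ ((pfaffianIso h2 f).hom.app _ _)
  rw [pfaffianIso_wedge h2 f _ hφ']
  exact ((pfaffianIso h2 g).hom.app_smul _ _).symm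

/-- A morphism preserves the parity of the rank. -/
theorem rank_mod_two (h2 : ∀ U : S.Opens, IsUnit (2 : Γ(S, U))) (f : X ⟶ Y) :
    (rank X.isVectorBundle).map (fun n : ℕ => (n : ZMod 2)) =
      (rank Y.isVectorBundle).map fun n : ℕ => (n : ZMod 2) := by
  ext x
  obtain ⟨U, hU, n, m, e, φ, he, hφ⟩ := X.isVectorBundle.exists_frames Y.isVectorBundle x
  have : Nontrivial Γ(S, U) := nontrivial_of_mem hU
  have h := even_add_of_frames (h2 U) f he hφ
  simp only [LocallyConstant.map_apply, Function.comp_apply]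
  rw [rank_apply _ he hU, rank_apply _ hφ hU, ZMod.natCast_eq_natCast_iff, Nat.ModEq]
  rw [Nat.even_iff] at h
  omega

/-- The Pfaffian functor, `X ↦ (Λ^max E, rank E mod 2)` on objects. -/
def pfaffianFunctor (h2 : ∀ U : S.Opens, IsUnit (2 : Γ(S, U))) :
    SkewComplex S ⥤ GradedLine (ZMod 2) S where
  obj X := gradedDet (ZMod 2) X.isVectorBundle
  map f := { iso := pfaffianIso h2 f, deg_eq := rank_mod_two h2 f }
  map_id X := GradedLine.Hom.ext
    (pfaffianIso_of_homotopicToId h2 (f := 𝟙 X) (ChainMap.Homotopic.refl _))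
  map_comp f g := GradedLine.Hom.ext (pfaffianIso_comp h2 f g)

end SkewComplex

/-! ### The determinant functor and the square of the Pfaffian -/

theorem IsGen.exists_dual {L : S.Modules} {U : S.Opens} {s : Γ(L, U)} (hs : IsGen L s) :
    ∃ σ : Γ(dual L, U), IsGen (dual L) σ ∧ pair σ s = 1 := by
  have h := (isGen_iff_isFrame s).1 hs
  refine ⟨h.dualFrame 0, (isGen_iff_isFrame _).2 ?_, by simpa using h.pair_dualFrame 0 0⟩
  convert h.isFrame_dualFrame using 2 with i
  rw [Subsingleton.elim i 0]

theorem IsGen.dual_unique {L : S.Modules} {U : S.Opens} {s : Γ(L, U)} (hs : IsGen L s)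
    {σ τ : Γ(dual L, U)} (h : pair σ s = pair τ s) : σ = τ := by
  refine dual_ext fun V hV x => ?_
  obtain ⟨c, rfl⟩ := (hs.restrict hV).exists_smul_eq x
  rw [pair_smul_right, pair_smul_right, pair_mres, pair_mres, h]

theorem tmul_smul_left {L M : S.Modules} {U : S.Opens} (a : Γ(S, U)) (s : Γ(L, U)) (t : Γ(M, U)) :
    tmul (a • s) t = a • tmul s t := by
  have h : (preTmul (a • s) t : (preTensor L M).presheaf.obj (op U)) = a • preTmul s t :=
    TensorProduct.smul_tmul' (R := Γ(S, U)) a s t |>.symm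
  exact (congrArg _ h).trans (toShf_smul _ _ _)

theorem tmul_smul_right {L M : S.Modules} {U : S.Opens} (a : Γ(S, U)) (s : Γ(L, U))
    (t : Γ(M, U)) : tmul s (a • t) = a • tmul s t := by
  have h : (preTmul s (a • t) : (preTensor L M).presheaf.obj (op U)) = a • preTmul s t :=
    TensorProduct.tmul_smul (R := Γ(S, U)) a s t
  exact (congrArg _ h).trans (toShf_smul _ _ _)

/-- The generator of `(det E*)⁻¹` dual to the wedge of the dual frame. -/
def dualWedge {E : S.Modules} (hE : IsVectorBundle E) {U : S.Opens} {n : ℕ} {e : Fin n → Γ(E, U)}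
    (he : IsFrame E e) : Γ(dual (det (isVectorBundle_dual hE)), U) :=
  (isGen_wedge (isVectorBundle_dual hE) he.isFrame_dualFrame).exists_dual.choose

theorem isGen_dualWedge {E : S.Modules} (hE : IsVectorBundle E) {U : S.Opens} {n : ℕ}
    {e : Fin n → Γ(E, U)} (he : IsFrame E e) : IsGen _ (dualWedge hE he) :=
  (isGen_wedge (isVectorBundle_dual hE) he.isFrame_dualFrame).exists_dual.choose_spec.1

theorem pair_dualWedge {E : S.Modules} (hE : IsVectorBundle E) {U : S.Opens} {n : ℕ}
    {e : Fin n → Γ(E, U)} (he : IsFrame E e) :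
    pair (dualWedge hE he) (wedge (isVectorBundle_dual hE) he.isFrame_dualFrame) = 1 :=
  (isGen_wedge (isVectorBundle_dual hE) he.isFrame_dualFrame).exists_dual.choose_spec.2

/-- The generator dual to the wedge of an arbitrary frame of `E*`. -/
theorem eq_det_smul_dualWedge {E : S.Modules} (hE : IsVectorBundle E) {U : S.Opens} {n : ℕ}
    {e : Fin n → Γ(E, U)} (he : IsFrame E e) {ε : Fin n → Γ(dual E, U)}
    (hε : IsFrame (dual E) ε) {σ : Γ(dual (det (isVectorBundle_dual hE)), U)}
    (hσ : pair σ (wedge (isVectorBundle_dual hE) hε) = 1) :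
    σ = (coord hε he.dualFrame).det • dualWedge hE he := by
  refine (isGen_wedge (isVectorBundle_dual hE) he.isFrame_dualFrame).dual_unique ?_
  rw [pair_smul_left, pair_dualWedge, wedge_eq_det_smul _ hε he.isFrame_dualFrame,
    pair_smul_right, hσ]

theorem mres_dualWedge {E : S.Modules} (hE : IsVectorBundle E) {U V : S.Opens} (h : V ≤ U) {n : ℕ}
    {e : Fin n → Γ(E, U)} (he : IsFrame E e) :
    mres (dual (det (isVectorBundle_dual hE))) h (dualWedge hE he) =
      dualWedge hE (he.restrict h) := by
  refine (isGen_wedge (isVectorBundle_dual hE)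
    (he.restrict h).isFrame_dualFrame).dual_unique ?_
  rw [pair_dualWedge, wedge_congr _ (he.restrict h).isFrame_dualFrame
    (he.isFrame_dualFrame.restrict h) (SkewComplex.dualFrame_restrict h he),
    ← mres_wedge (isVectorBundle_dual hE) h he.isFrame_dualFrame,
    pair_mres, pair_dualWedge, map_one]

theorem dualWedge_eq_det_smul {E : S.Modules} (hE : IsVectorBundle E) {U : S.Opens} {n : ℕ}
    {e e' : Fin n → Γ(E, U)} (he : IsFrame E e) (he' : IsFrame E e') :
    dualWedge hE he' = (coord he e').det • dualWedge hE he := by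
  have h := eq_det_smul_dualWedge hE he he'.isFrame_dualFrame (pair_dualWedge hE he')
  rwa [SkewComplex.coord_dualFrame_dualFrame, Matrix.det_transpose] at h

/-- The generators `(e₁ ∧ ⋯ ∧ eₙ) ⊗ (e₁* ∧ ⋯ ∧ eₙ*)⁻¹` and `(e₁ ∧ ⋯ ∧ eₙ) ⊗ (e₁ ∧ ⋯ ∧ eₙ)` both
change by the square of the determinant of the change of frame. -/
theorem tmul_wedge_wedge_of_eq {E : S.Modules} (hE : IsVectorBundle E) {U : S.Opens} {n : ℕ}
    {e e' : Fin n → Γ(E, U)} (he : IsFrame E e) (he' : IsFrame E e') {r : Γ(S, U)}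
    (hr : tmul (wedge hE he) (dualWedge hE he) = r • tmul (wedge hE he') (dualWedge hE he')) :
    tmul (wedge hE he) (wedge hE he) = r • tmul (wedge hE he') (wedge hE he') := by
  rw [wedge_eq_det_smul hE he' he, dualWedge_eq_det_smul hE he' he, tmul_smul_left,
    tmul_smul_right, ← mul_smul] at hr
  rw [wedge_eq_det_smul hE he' he, tmul_smul_left, tmul_smul_right, ← mul_smul,
    ((isGen_wedge _ he').tmul (isGen_dualWedge _ he')).eq_of_smul_eq hr]

theorem exists_detSquareIso {E : S.Modules} (hE : IsVectorBundle E) :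
    ∃ θ : tensor (det hE) (dual (det (isVectorBundle_dual hE))) ≅ tensor (det hE) (det hE),
      ∀ (U : S.Opens) (n : ℕ) (e : Fin n → Γ(E, U)) (he : IsFrame E e),
        θ.hom.app U (tmul (wedge hE he) (dualWedge hE he)) =
          tmul (wedge hE he) (wedge hE he) := by
  obtain ⟨d, hd⟩ := exists_iso_of_isGen
    (L := tensor (det hE) (dual (det (isVectorBundle_dual hE)))) (N := tensor (det hE) (det hE))
    (ι := LocalFrames E E) (fun i => i.U)
    (fun x => by
      obtain ⟨U, hx, n, e, he⟩ := hE x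
      exact ⟨⟨U, n, n, e, e, he, he⟩, hx⟩)
    (fun i => tmul (wedge hE i.isFrame_left) (dualWedge hE i.isFrame_left))
    (fun i => (isGen_wedge _ _).tmul (isGen_dualWedge _ _))
    (fun i => tmul (wedge hE i.isFrame_left) (wedge hE i.isFrame_left))
    (fun i => (isGen_wedge _ _).tmul (isGen_wedge _ _)) (by
      rintro ⟨U, n, m, e, φ, he, hφ⟩ ⟨U', n', m', e', φ', he', hφ'⟩ V hi hj r hr
      -- the ranks agree only if `V` is nonempty
      by_cases hV : ∃ x, x ∈ V
      swap
      · exact mres_eq_of_isEmpty _ hV _ _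
      obtain ⟨x, hx⟩ := hV
      obtain rfl : n = n' := he.card_eq he' (hi hx) (hj hx)
      have key := tmul_wedge_wedge_of_eq hE (he.restrict hi) (he'.restrict hj) (r := r)
      rw [← mres_wedge hE hi he, ← mres_wedge hE hj he', ← mres_dualWedge hE hi he,
        ← mres_dualWedge hE hj he', ← mres_tmul, ← mres_tmul, ← mres_tmul, ← mres_tmul] at key
      exact key hr)
  exact ⟨d, fun U n e he => hd ⟨U, n, n, e, e, he, he⟩⟩

namespace SkewComplex

variable {X Y : SkewComplex S}

/-- The isomorphism `det E ⊗ (det E*)⁻¹ ≃ det E ⊗ det E`. -/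
def detSquareIso (X : SkewComplex S) :
    X.detLine.mod ≅ tensor (det X.isVectorBundle) (det X.isVectorBundle) :=
  (exists_detSquareIso X.isVectorBundle).choose

theorem detSquareIso_tmul (X : SkewComplex S) {U : S.Opens} {n : ℕ} {e : Fin n → Γ(X.E, U)}
    (he : IsFrame X.E e) {ε : Fin n → Γ(dual X.E, U)} (hε : IsFrame (dual X.E) ε)
    {σ : Γ(dual (det (isVectorBundle_dual X.isVectorBundle)), U)}
    (hσ : pair σ (wedge (isVectorBundle_dual X.isVectorBundle) hε) = 1) :
    X.detSquareIso.hom.app U (tmul (wedge X.isVectorBundle he) σ) =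
      (coord hε he.dualFrame).det •
        tmul (wedge X.isVectorBundle he) (wedge X.isVectorBundle he) := by
  rw [eq_det_smul_dualWedge X.isVectorBundle he hε hσ]
  refine (congrArg _ (tmul_smul_right _ _ _)).trans ?_
  refine (X.detSquareIso.hom.app_smul _ _).trans ?_
  exact congrArg _ ((exists_detSquareIso X.isVectorBundle).choose_spec U n e he)

theorem deg_detLine (X : SkewComplex S) : X.detLine.deg = 0 := by
  ext x
  obtain ⟨U, hU, n, e, he⟩ := X.isVectorBundle x
  change ((rank X.isVectorBundle x : ℕ) : ℤ) +
    -((rank (isVectorBundle_dual X.isVectorBundle) x : ℕ) : ℤ) = 0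
  rw [rank_apply _ he hU, rank_apply _ he.isFrame_dualFrame hU, add_neg_cancel]

/-- The determinant of a morphism, obtained from the square of its Pfaffian. -/
def detHom (h2 : ∀ U : S.Opens, IsUnit (2 : Γ(S, U))) (f : X ⟶ Y) : X.detLine ⟶ Y.detLine where
  iso := X.detSquareIso ≪≫ tensorIso (pfaffianIso h2 f) (pfaffianIso h2 f) ≪≫ Y.detSquareIso.symm
  deg_eq := by rw [deg_detLine, deg_detLine]

/-- The determinant of the cone of `f` with respect to arbitrary frames and sections, in terms of
the Pfaffian. -/
theorem det_coneMatrix (h2 : ∀ U : S.Opens, IsUnit (2 : Γ(S, U))) (f : X ⟶ Y) {U : S.Opens}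
    {n m : ℕ} {e : Fin n → Γ(X.E, U)} {ε : Fin n → Γ(dual X.E, U)} {φ : Fin m → Γ(Y.E, U)}
    {ψ : Fin m → Γ(dual Y.E, U)} (he : IsFrame X.E e) (hε : IsFrame (dual X.E) ε)
    (hφ : IsFrame Y.E φ) {u : Fin m → Γ(dual X.E, U)} {v : Fin m → Γ(Y.E, U)}
    (huv : ∀ j, (Hom.chain f).f₁.app U (u j) + Y.α.app U (v j) = ψ j) :
    (coneMatrix f e hε hφ u v).det = (coord hε he.dualFrame).det *
      (pfCoeff f he hφ * pfCoeff f he hφ) * (coord hφ.isFrame_dualFrame ψ).det := by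
  obtain ⟨H, K, h⟩ := exists_isIsometryMatrix (h2 U) (isIsometry_chain f) he hφ
  have hD : (mat₁ (Hom.chain f) he hφ).transpose.transpose * coord he.isFrame_dualFrame u +
      Y.gram φ * coord hφ v = coord hφ.isFrame_dualFrame ψ := by
    rw [Matrix.transpose_transpose, mat₁, ← coord_app, ← coord_dualFrame_α hφ, ← coord_app,
      ← coord_add]
    congr 1
    funext j
    exact huv j
  have hc : coneMatrix f e hε hφ u v =
      Matrix.fromBlocks (coord hε he.dualFrame) 0 0 1 *
        Matrix.fromBlocks (X.gram e) (coord he.isFrame_dualFrame u) (-mat₀ (Hom.chain f) e hφ)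
          (coord hφ v) := by
    rw [Matrix.fromBlocks_multiply, ← coord_dualFrame_α he]
    simp only [Matrix.zero_mul, add_zero, zero_add, Matrix.one_mul, coord_mul]
    rfl
  rw [hc, Matrix.det_mul, h.det_cone_section hD, Matrix.det_fromBlocks_zero₂₁, Matrix.det_one,
    ← pfIso_sq (h2 U) h.skew_left _ h.skew_K, ← pfCoeff_eq (h2 U) f he hφ h.skew_K h.mul_right]
  ring

theorem isDeterminant_detHom (h2 : ∀ U : S.Opens, IsUnit (2 : Γ(S, U))) (f : X ⟶ Y) :
    IsDeterminant f (detHom h2 f) := by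
  intro U n m e ε φ ψ he hε hφ hψ u v huv σ τ hσ hτ
  have hinj : Function.Injective fun s => Y.detSquareIso.hom.app U s := by
    refine Function.LeftInverse.injective (g := fun s => Y.detSquareIso.inv.app U s) fun s => ?_
    exact congrArg (fun k : Y.detLine.mod ⟶ Y.detLine.mod => k.app U s) Y.detSquareIso.hom_inv_id
  refine hinj ?_
  have h1 : Y.detSquareIso.hom.app U (GradedLine.Hom.app (detHom h2 f)
      (tmul (wedge X.isVectorBundle he) σ)) = (tensorMap (pfaffianIso h2 f).hom
        (pfaffianIso h2 f).hom).app U (X.detSquareIso.hom.app U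
          (tmul (wedge X.isVectorBundle he) σ)) :=
    congrArg (fun k : tensor (det Y.isVectorBundle) (det Y.isVectorBundle) ⟶ _ => k.app U
      ((tensorMap (pfaffianIso h2 f).hom (pfaffianIso h2 f).hom).app U (X.detSquareIso.hom.app U
          (tmul (wedge X.isVectorBundle he) σ)))) Y.detSquareIso.inv_hom_id
  refine h1.trans ?_
  rw [detSquareIso_tmul X he hε hσ]
  refine ((tensorMap _ _).app_smul _ _).trans ?_
  rw [tensorMap_tmul, pfaffianIso_wedge h2 f he hφ, tmul_smul_left, tmul_smul_right, ← mul_smul,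
    ← mul_smul]
  refine Eq.trans ?_ (Y.detSquareIso.hom.app_smul _ _).symm
  refine Eq.trans ?_ (congrArg _ (detSquareIso_tmul Y hφ hψ hτ)).symm
  rw [← mul_smul, det_coneMatrix h2 f he hε hφ huv]
  congr 1
  have h3 := congrArg Matrix.det (coord_mul_coord hφ.isFrame_dualFrame hψ)
  rw [Matrix.det_mul, Matrix.det_one] at h3
  linear_combination (-(coord hε he.dualFrame).det * (pfCoeff f he hφ * pfCoeff f he hφ)) * h3

end SkewComplex

/-- The determinant functor, conjugate to the square of the Pfaffian functor. -/
def determinantFunctor (h2 : ∀ U : S.Opens, IsUnit (2 : Γ(S, U))) : DeterminantFunctor S where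
  map f := SkewComplex.detHom h2 f
  isDeterminant f := SkewComplex.isDeterminant_detHom h2 f
  map_id X := by
    refine GradedLine.Hom.ext ?_
    change X.detSquareIso ≪≫ tensorIso (SkewComplex.pfaffianIso h2 (𝟙 X))
      (SkewComplex.pfaffianIso h2 (𝟙 X)) ≪≫ X.detSquareIso.symm = Iso.refl _
    rw [SkewComplex.pfaffianIso_of_homotopicToId h2 (f := 𝟙 X)
      (SkewComplex.ChainMap.Homotopic.refl _)]
    have : tensorIso (Iso.refl (det X.isVectorBundle)) (Iso.refl (det X.isVectorBundle)) =
      Iso.refl _ := Iso.ext (tensorMap_id _ _)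
    rw [this]
    simp
  map_comp {X Y Z} f g := by
    refine GradedLine.Hom.ext ?_
    change X.detSquareIso ≪≫ tensorIso (SkewComplex.pfaffianIso h2 (f ≫ g))
      (SkewComplex.pfaffianIso h2 (f ≫ g)) ≪≫ Z.detSquareIso.symm =
      (X.detSquareIso ≪≫ tensorIso (SkewComplex.pfaffianIso h2 f)
      (SkewComplex.pfaffianIso h2 f) ≪≫ Y.detSquareIso.symm) ≪≫
      (Y.detSquareIso ≪≫ tensorIso (SkewComplex.pfaffianIso h2 g)
      (SkewComplex.pfaffianIso h2 g) ≪≫ Z.detSquareIso.symm)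
    rw [SkewComplex.pfaffianIso_comp]
    refine Iso.ext ?_
    have : (tensorIso (SkewComplex.pfaffianIso h2 f ≪≫ SkewComplex.pfaffianIso h2 g)
        (SkewComplex.pfaffianIso h2 f ≪≫ SkewComplex.pfaffianIso h2 g)).hom =
      (tensorIso (SkewComplex.pfaffianIso h2 f) (SkewComplex.pfaffianIso h2 f)).hom ≫
      (tensorIso (SkewComplex.pfaffianIso h2 g) (SkewComplex.pfaffianIso h2 g)).hom :=
      tensorMap_comp _ _ _ _
    simp [this]

/-- The isomorphism between the determinant and the square of the Pfaffian. -/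
def thetaIso (h2 : ∀ U : S.Opens, IsUnit (2 : Γ(S, U))) :
    (determinantFunctor h2).toFunctor ⋙ modTwo S ≅
      SkewComplex.pfaffianFunctor h2 ⋙ squareFunctor (ZMod 2) S :=
  have hdeg (X : SkewComplex S) : X.detLine.deg.map (fun a : ℤ => (a : ZMod 2)) =
      (gradedDet (ZMod 2) X.isVectorBundle).deg + (gradedDet (ZMod 2) X.isVectorBundle).deg := by
    rw [X.deg_detLine]
    ext x
    exact (Int.cast_zero.trans (CharTwo.add_self_eq_zero _).symm)
  NatIso.ofComponents
    (fun X =>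
      { hom := { iso := X.detSquareIso, deg_eq := hdeg X }
        inv := { iso := X.detSquareIso.symm, deg_eq := (hdeg X).symm }
        hom_inv_id := GradedLine.Hom.ext X.detSquareIso.self_symm_id
        inv_hom_id := GradedLine.Hom.ext X.detSquareIso.symm_self_id })
    fun {X Y} f => by
      refine GradedLine.Hom.ext ?_
      change (X.detSquareIso ≪≫ tensorIso (SkewComplex.pfaffianIso h2 f)
        (SkewComplex.pfaffianIso h2 f) ≪≫ Y.detSquareIso.symm) ≪≫ Y.detSquareIso =
        X.detSquareIso ≪≫ tensorIso (SkewComplex.pfaffianIso h2 f) (SkewComplex.pfaffianIso h2 f)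
      simp

end

end Pfaff

/-! ### Frames and pullbacks -/

namespace Pfaff

noncomputable section

variable {S S' : Scheme.{u}} {f : S' ⟶ S}

theorem pushApp_smul {M : S.Modules} {M' : S'.Modules}
    (p : M ⟶ (Scheme.Modules.pushforward f).obj M') {U : S.Opens} (a : Γ(S, U)) (s : Γ(M, U)) :
    pushApp p (a • s) = f.app U a • pushApp p s :=
  p.app_smul a s

theorem pushApp_sum {M : S.Modules} {M' : S'.Modules}
    (p : M ⟶ (Scheme.Modules.pushforward f).obj M') {U : S.Opens} {ι : Type*} (t : Finset ι)
    (s : ι → Γ(M, U)) : pushApp p (∑ i ∈ t, s i) = ∑ i ∈ t, pushApp p (s i) :=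
  map_sum (p.app U).hom s t

theorem pushApp_mres {M : S.Modules} {M' : S'.Modules}
    (p : M ⟶ (Scheme.Modules.pushforward f).obj M') {U V : S.Opens} (h : V ≤ U) (s : Γ(M, U)) :
    pushApp p (mres M h s) = mres M' (f.preimage_mono h) (pushApp p s) :=
  app_mres p h s

/-- The sheaf `V ↦ M(V ∩ W)`. -/
def restrictTo (M : S.Modules) (W : S.Opens) : S.Modules :=
  (Scheme.Modules.pushforward W.ι).obj (M.restrict W.ι)

/-- The open set `V ∩ W`, in the form in which it occurs in the sections of `restrictTo`. -/
abbrev meet (V W : S.Opens) : S.Opens :=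
  W.ι ''ᵁ (W.ι ⁻¹ᵁ V)

theorem meet_le_left (V W : S.Opens) : meet V W ≤ V :=
  W.ι.image_preimage_le V

theorem meet_le_right (V W : S.Opens) : meet V W ≤ W := by
  rintro x ⟨y, -, rfl⟩
  exact y.2

theorem le_meet {V W : S.Opens} (h : V ≤ W) : V ≤ meet V W :=
  fun x hx => ⟨⟨x, h hx⟩, hx, rfl⟩

theorem meet_mono {U V : S.Opens} (h : V ≤ U) (W : S.Opens) : meet V W ≤ meet U W :=
  W.ι.image_mono (W.ι.preimage_mono h)

theorem meet_smul (M : S.Modules) {V W : S.Opens} (a : Γ(S, V)) (y : Γ(M, meet V W)) :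
    (a • (show Γ(restrictTo M W, V) from y) : Γ(restrictTo M W, V)) =
      (res (meet_le_left V W) a • y : Γ(M, meet V W)) := by
  have h : (W.ι.appIso (W.ι ⁻¹ᵁ V)).inv (W.ι.app V a) = res (meet_le_left V W) a :=
    congr($(W.ι.app_appIso_inv V) a)
  rw [← h]
  rfl

/-- The restriction morphism `M → restrictTo M W`. -/
def toRestrictTo (M : S.Modules) (W : S.Opens) : M ⟶ restrictTo M W :=
  (Scheme.Modules.restrictAdjunction W.ι).unit.app M

/-- Morphisms out of the pullback `M'` of `M` are determined by their restrictions to `M`. -/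
theorem IsCartesian.hom_ext {M : S.Modules} {M' : S'.Modules}
    {p : M ⟶ (Scheme.Modules.pushforward f).obj M'} (hp : IsCartesian p) {N : S'.Modules}
    {g h : M' ⟶ N} (hgh : ∀ (V : S.Opens) (x : Γ(M, V)),
      g.app (f ⁻¹ᵁ V) (pushApp p x) = h.app (f ⁻¹ᵁ V) (pushApp p x)) : g = h := by
  have : IsIso (((Scheme.Modules.pullbackPushforwardAdjunction f).homEquiv M M').symm p) := hp
  rw [← cancel_epi (((Scheme.Modules.pullbackPushforwardAdjunction f).homEquiv M M').symm p),
    ← Adjunction.homEquiv_naturality_right_symm, ← Adjunction.homEquiv_naturality_right_symm]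
  congr 1
  exact hom_ext_sections hgh

/-- The endomorphism `x ↦ ∑ l i x • s i` of `M|_W`, as a morphism `M → restrictTo M W`. -/
def endOfDual {M : S.Modules} {W : S.Opens} {n : ℕ} (s : Fin n → Γ(M, W))
    (l : Fin n → Γ(dual M, W)) : M ⟶ restrictTo M W :=
  let φ (V : S.Opens) (x : Γ(M, V)) : Γ(M, meet V W) :=
    ∑ i, pair (mres (dual M) (meet_le_right V W) (l i)) (mres M (meet_le_left V W) x) •
      mres M (meet_le_right V W) (s i)
  have hadd (V : S.Opens) (x y : Γ(M, V)) : φ V (x + y) = φ V x + φ V y := by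
    simp only [φ, map_add, pair_add_right, add_smul, Finset.sum_add_distrib]
  have hsmul (V : S.Opens) (a : Γ(S, V)) (x : Γ(M, V)) :
      φ V (a • x) = res (meet_le_left V W) a • φ V x := by
    simp only [φ, mres_smul, pair_smul_right, mul_smul, Finset.smul_sum]
  have hres (U V : S.Opens) (h : V ≤ U) (x : Γ(M, U)) :
      φ V (mres M h x) = mres M (meet_mono h W) (φ U x) := by
    simp only [φ, map_sum, mres_smul, ← pair_mres, mres_mres]
  homMk (fun V => AddMonoidHom.mk' (M := Γ(M, V)) (G := Γ(restrictTo M W, V)) (φ V) (hadd V))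
    (fun V a x => (hsmul V a x).trans (meet_smul M a (φ V x)).symm) hres

/-- A family in `M'` that comes from a frame of `M` and has a dual family `l` is a frame: the
morphism `x ↦ ∑ l i x • s i` and the identity of `M'|_W` agree on the sections that come from
`M`. -/
theorem IsCartesian.isFrame {M : S.Modules} {M' : S'.Modules}
    {p : M ⟶ (Scheme.Modules.pushforward f).obj M'} (hp : IsCartesian p) {U : S.Opens} {n : ℕ}
    {e : Fin n → Γ(M, U)} (he : IsFrame M e) (l : Fin n → Γ(dual M', f ⁻¹ᵁ U))
    (hl : ∀ i j, pair (l i) (pushApp p (e j)) = if i = j then 1 else 0) :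
    IsFrame M' fun i => pushApp p (e i) := by
  have key : ∀ (V : S.Opens) (hV : V ≤ U) (y : Γ(M, V)), pushApp p y =
      ∑ i, pair (mres (dual M') (f.preimage_mono hV) (l i)) (pushApp p y) •
        mres M' (f.preimage_mono hV) (pushApp p (e i)) := by
    intro V hV y
    obtain ⟨c, rfl⟩ := (he V hV).2 y
    simp only [pushApp_sum, pushApp_smul, pushApp_mres]
    refine Finset.sum_congr rfl fun i _ => ?_
    congr 1
    rw [pair_sum_right]
    simp [pair_smul_right, pair_mres, hl, apply_ite (res _)]
  have hκ : endOfDual (fun i => pushApp p (e i)) l = toRestrictTo M' (f ⁻¹ᵁ U) := by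
    refine hp.hom_ext fun V x => ?_
    have hle : meet (f ⁻¹ᵁ V) (f ⁻¹ᵁ U) ≤ f ⁻¹ᵁ (V ⊓ U) :=
      le_inf (meet_le_left _ _) (meet_le_right _ _)
    have h1 := congrArg (mres M' hle) (key (V ⊓ U) inf_le_right (mres M inf_le_left x))
    simp only [map_sum, mres_smul, ← pair_mres, mres_mres, pushApp_mres] at h1
    exact h1.symm
  intro V hV
  refine ⟨fun c d hcd => ?_, fun x => ?_⟩
  · have hpair : ∀ (c : Fin n → Γ(S', V)) (j : Fin n), pair (mres (dual M') hV (l j))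
        (∑ i, c i • mres M' hV (pushApp p (e i))) = c j := by
      intro c j
      rw [pair_sum_right]
      simp [pair_smul_right, pair_mres, hl, apply_ite (res _)]
    funext j
    rw [← hpair c j, ← hpair d j]
    exact congrArg _ hcd
  · refine ⟨fun i => pair (mres (dual M') hV (l i)) x, ?_⟩
    have h1 : (∑ i, pair (mres (dual M') (meet_le_right V _) (l i))
      (mres M' (meet_le_left V _) x) • mres M' (meet_le_right V _) (pushApp p (e i)) :
        Γ(M', meet V (f ⁻¹ᵁ U))) = mres M' (meet_le_left V _) x :=
      congrArg (fun k : M' ⟶ restrictTo M' (f ⁻¹ᵁ U) => k.app V x) hκ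
    have h2 := congrArg (mres M' (le_meet hV)) h1
    simp only [map_sum, mres_smul, ← pair_mres, mres_mres, mres_self] at h2
    exact h2

/-- A morphism that maps local generators to local generators exhibits a pullback. -/
theorem isCartesian_of_isGen {L : S.Modules} {L' : S'.Modules}
    (p : L ⟶ (Scheme.Modules.pushforward f).obj L')
    (h : ∀ x : S, ∃ (U : S.Opens) (_ : x ∈ U) (s : Γ(L, U)), IsGen L s ∧ IsGen L' (pushApp p s)) :
    IsCartesian p := by
  choose U hU s hs hs' using h
  let adj := Scheme.Modules.pullbackPushforwardAdjunction f
  refine isIso_of_coyoneda_map_bijective _ fun N => ⟨fun g g' hg => ?_, fun k => ?_⟩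
  · have h1 : p ≫ (Scheme.Modules.pushforward f).map g =
        p ≫ (Scheme.Modules.pushforward f).map g' := by
      refine (adj.homEquiv L N).symm.injective ?_
      rw [Adjunction.homEquiv_naturality_right_symm, Adjunction.homEquiv_naturality_right_symm]
      exact hg
    refine hom_ext_of_isGen fun x => ⟨f ⁻¹ᵁ U (f x), hU _, _, hs' _, ?_⟩
    exact congrArg (fun k : L ⟶ (Scheme.Modules.pushforward f).obj N => k.app _ (s (f x))) h1
  · let q := adj.homEquiv L N k
    obtain ⟨g, hg⟩ := exists_hom_of_isGen (L := L') (N := N) (fun x => f ⁻¹ᵁ U x)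
      (fun x => ⟨f x, hU _⟩) (fun x => pushApp p (s x)) hs' (fun x => pushApp q (s x)) (by
        intro x y V hx hy r hr
        have hle : V ≤ f ⁻¹ᵁ (U x ⊓ U y) := le_inf hx hy
        obtain ⟨a, ha⟩ := ((hs y).restrict (inf_le_right : U x ⊓ U y ≤ U y)).exists_smul_eq
          (mres L inf_le_left (s x))
        have h1 : ∀ {N : S'.Modules} (q : L ⟶ (Scheme.Modules.pushforward f).obj N),
            mres N hx (pushApp q (s x)) = res hle (f.app _ a) • mres N hy (pushApp q (s y)) := by
          intro N q
          have h2 := congrArg (fun t => mres N hle (pushApp q t)) ha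
          simpa only [pushApp_mres, pushApp_smul, mres_smul, mres_mres] using h2
        rw [h1 p] at hr
        rw [h1 q, ((hs' y).restrict hy).eq_of_smul_eq hr])
    refine ⟨g, (adj.homEquiv L N).injective ?_⟩
    have h1 : p ≫ (Scheme.Modules.pushforward f).map g = q := by
      refine hom_ext_of_isGen fun x => ⟨U x, hU x, s x, hs x, hg x⟩
    refine Eq.trans ?_ h1
    refine (adj.homEquiv L N).symm.injective ?_
    rw [Adjunction.homEquiv_naturality_right_symm, Equiv.symm_apply_apply]

/-! ### Base change -/

theorem coord_pushApp {M : S.Modules} {M' : S'.Modules}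
    (p : M ⟶ (Scheme.Modules.pushforward f).obj M') {U : S.Opens} {n : ℕ} {e : Fin n → Γ(M, U)}
    (he : IsFrame M e) (he' : IsFrame M' fun i => pushApp p (e i)) {ι : Type*} (x : ι → Γ(M, U)) :
    coord he' (fun j => pushApp p (x j)) = (coord he x).map (f.app U).hom := by
  refine coord_unique _ fun j => ?_
  conv_lhs => rw [← sum_coord he x j]
  simp only [pushApp_sum, pushApp_smul]
  rfl

namespace SkewComplex.BaseChange

variable {X' Y' : SkewComplex S'} {X Y : SkewComplex S}

theorem pair_pushApp_dualFrame (p : X'.BaseChange f X) {U : S.Opens} {n : ℕ}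
    {e : Fin n → Γ(X.E, U)} (he : IsFrame X.E e) (i j : Fin n) :
    pair (pushApp p.p₁ (he.dualFrame i)) (pushApp p.p₀ (e j)) = if i = j then 1 else 0 := by
  rw [p.pair_eq, he.pair_dualFrame]
  simp [apply_ite (f.app U)]

/-- Frames pull back to frames. -/
theorem isFrame (p : X'.BaseChange f X) {U : S.Opens} {n : ℕ} {e : Fin n → Γ(X.E, U)}
    (he : IsFrame X.E e) : IsFrame X'.E fun i => pushApp p.p₀ (e i) :=
  p.isCartesian₀.isFrame he _ (p.pair_pushApp_dualFrame he)

theorem dualFrame_isFrame (p : X'.BaseChange f X) {U : S.Opens} {n : ℕ} {e : Fin n → Γ(X.E, U)}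
    (he : IsFrame X.E e) :
    (p.isFrame he).dualFrame = fun i => pushApp p.p₁ (he.dualFrame i) :=
  (p.isFrame he).dualFrame_eq (p.pair_pushApp_dualFrame he)

theorem gram_pushApp (p : X'.BaseChange f X) {U : S.Opens} {n : ℕ} (e : Fin n → Γ(X.E, U)) :
    X'.gram (fun i => pushApp p.p₀ (e i)) = (X.gram e).map (f.app U).hom := by
  ext1 i j
  change pair (X'.α.app _ (pushApp p.p₀ (e j))) (pushApp p.p₀ (e i)) = f.app U _
  rw [← p.comm, p.pair_eq]
  rfl

/-- The Pfaffian of a morphism commutes with base change. -/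
theorem pfCoeff_pushApp (p : X'.BaseChange f X) (q : Y'.BaseChange f Y) {g' : X' ⟶ Y'}
    {g : X ⟶ Y} (hg : p.IsPullbackHom q g' g) {U : S.Opens} (h2 : IsUnit (2 : Γ(S, U))) {n m : ℕ}
    {e : Fin n → Γ(X.E, U)} (he : IsFrame X.E e) {φ : Fin m → Γ(Y.E, U)} (hφ : IsFrame Y.E φ) :
    pfCoeff g' (p.isFrame he) (q.isFrame hφ) = f.app U (pfCoeff g he hφ) := by
  refine map_pfCoeff h2 (f.app U).hom g g' he hφ _ _ (p.gram_pushApp e) (q.gram_pushApp φ) ?_ ?_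
  · rw [mat₀, mat₀, ← coord_pushApp q.p₀ hφ (q.isFrame hφ)]
    congr 1
    funext j
    exact (hg.1 U (e j)).symm
  · ext1 i j
    rw [mat₁, IsFrame.coord_dualFrame, p.dualFrame_isFrame, ← hg.2, q.pair_eq, Matrix.map_apply,
      mat₁, IsFrame.coord_dualFrame]

/-- The wedges of the pulled back frames satisfy the relations of the wedges of the frames. -/
theorem wedge_isFrame_of_eq (p : X'.BaseChange f X) {U : S.Opens} {n : ℕ}
    {e e' : Fin n → Γ(X.E, U)} (he : IsFrame X.E e) (he' : IsFrame X.E e') {r : Γ(S, U)}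
    (hr : wedge X.isVectorBundle he = r • wedge X.isVectorBundle he') :
    wedge X'.isVectorBundle (p.isFrame he) =
      f.app U r • wedge X'.isVectorBundle (p.isFrame he') := by
  rw [wedge_eq_det_smul _ he' he] at hr
  rw [← (isGen_wedge _ _).eq_of_smul_eq hr, wedge_eq_det_smul _ (p.isFrame he') (p.isFrame he),
    coord_pushApp p.p₀ he']
  congr 1
  exact (RingHom.map_det _ _).symm

theorem mres_wedge_isFrame (p : X'.BaseChange f X) {U V : S.Opens} (h : V ≤ U) {n : ℕ}
    {e : Fin n → Γ(X.E, U)} (he : IsFrame X.E e) :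
    mres (det X'.isVectorBundle) (f.preimage_mono h) (wedge X'.isVectorBundle (p.isFrame he)) =
      wedge X'.isVectorBundle (p.isFrame (he.restrict h)) := by
  rw [mres_wedge]
  exact wedge_congr _ _ _ (funext fun i => (pushApp_mres p.p₀ h (e i)).symm)

theorem exists_detMap (p : X'.BaseChange f X) :
    ∃ d : det X.isVectorBundle ⟶ (Scheme.Modules.pushforward f).obj (det X'.isVectorBundle),
      ∀ (U : S.Opens) (n : ℕ) (e : Fin n → Γ(X.E, U)) (he : IsFrame X.E e),
        pushApp d (wedge X.isVectorBundle he) = wedge X'.isVectorBundle (p.isFrame he) := by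
  obtain ⟨d, hd⟩ := exists_hom_of_isGen (L := det X.isVectorBundle)
    (N := (Scheme.Modules.pushforward f).obj (det X'.isVectorBundle))
    (ι := LocalFrames X.E X.E) (fun i => i.U)
    (fun x => by
      obtain ⟨U, hx, n, e, he⟩ := X.isVectorBundle x
      exact ⟨⟨U, n, n, e, e, he, he⟩, hx⟩)
    (fun i => wedge X.isVectorBundle i.isFrame_left) (fun i => isGen_wedge _ _)
    (fun i => wedge X'.isVectorBundle (p.isFrame i.isFrame_left)) (by
      rintro ⟨U, n, m, e, φ, he, hφ⟩ ⟨U', n', m', e', φ', he', hφ'⟩ V hi hj r hr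
      -- the ranks agree only if `V` is nonempty
      by_cases hV : ∃ x, x ∈ V
      swap
      · exact mres_eq_of_isEmpty _ hV _ _
      obtain ⟨x, hx⟩ := hV
      obtain rfl : n = n' := he.card_eq he' (hi hx) (hj hx)
      have key := p.wedge_isFrame_of_eq (he.restrict hi) (he'.restrict hj) (r := r)
        ((mres_wedge _ hi he).symm.trans (hr.trans (congrArg _ (mres_wedge _ hj he'))))
      rw [← p.mres_wedge_isFrame hi he, ← p.mres_wedge_isFrame hj he'] at key
      exact key)
  exact ⟨d, fun U n e he => hd ⟨U, n, n, e, e, he, he⟩⟩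

/-- The morphism `det E → f_* det E'`, `e₁ ∧ ⋯ ∧ eₙ ↦ p e₁ ∧ ⋯ ∧ p eₙ`. -/
def detMap (p : X'.BaseChange f X) :
    det X.isVectorBundle ⟶ (Scheme.Modules.pushforward f).obj (det X'.isVectorBundle) :=
  p.exists_detMap.choose

theorem detMap_wedge (p : X'.BaseChange f X) {U : S.Opens} {n : ℕ} {e : Fin n → Γ(X.E, U)}
    (he : IsFrame X.E e) :
    pushApp p.detMap (wedge X.isVectorBundle he) = wedge X'.isVectorBundle (p.isFrame he) :=
  p.exists_detMap.choose_spec U n e he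

/-- The base change isomorphism of the graded determinant. -/
def gradedDet (A : Type) [NatCast A] (p : X'.BaseChange f X) :
    (Pfaff.gradedDet A X'.isVectorBundle).BaseChange f (Pfaff.gradedDet A X.isVectorBundle) where
  p := p.detMap
  isCartesian := isCartesian_of_isGen _ fun x => by
    obtain ⟨U, hx, n, e, he⟩ := X.isVectorBundle x
    exact ⟨U, hx, _, isGen_wedge _ he, p.detMap_wedge he ▸ isGen_wedge _ _⟩
  deg_eq x := by
    obtain ⟨U, hx, n, e, he⟩ := X.isVectorBundle (f x)
    change ((rank X'.isVectorBundle x : ℕ) : A) = (rank X.isVectorBundle (f x) : ℕ)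
    rw [rank_apply _ he hx, rank_apply _ (p.isFrame he) (show x ∈ f ⁻¹ᵁ U from hx)]

theorem isPullbackHom_pfaffian (h2 : ∀ U : S.Opens, IsUnit (2 : Γ(S, U)))
    (h2' : ∀ U : S'.Opens, IsUnit (2 : Γ(S', U))) (p : X'.BaseChange f X) (q : Y'.BaseChange f Y)
    {g' : X' ⟶ Y'} {g : X ⟶ Y} (hg : p.IsPullbackHom q g' g) :
    (p.gradedDet (ZMod 2)).IsPullbackHom (q.gradedDet (ZMod 2)) ((pfaffianFunctor h2').map g')
      ((pfaffianFunctor h2).map g) := by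
  have h : (pfaffianIso h2 g).hom ≫ q.detMap =
      p.detMap ≫ (Scheme.Modules.pushforward f).map (pfaffianIso h2' g').hom := by
    refine det_hom_ext _ fun x => ?_
    obtain ⟨U, hU, n, m, e, φ, he, hφ⟩ := X.isVectorBundle.exists_frames Y.isVectorBundle x
    refine ⟨U, hU, n, e, he, ?_⟩
    change pushApp q.detMap ((pfaffianIso h2 g).hom.app U _) =
      (pfaffianIso h2' g').hom.app (f ⁻¹ᵁ U) (pushApp p.detMap _)
    rw [p.detMap_wedge he, pfaffianIso_wedge h2 g he hφ, pushApp_smul, q.detMap_wedge hφ,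
      pfaffianIso_wedge h2' g' (p.isFrame he) (q.isFrame hφ), p.pfCoeff_pushApp q hg (h2 U) he hφ]
  exact fun U s => congrArg (fun k : det X.isVectorBundle ⟶ _ => k.app U s) h

theorem isComp_gradedDet (A : Type) [NatCast A] {S'' : Scheme.{u}} {f' : S'' ⟶ S'}
    {X'' : SkewComplex S''} (p : X'.BaseChange f X) (q : X''.BaseChange f' X')
    (r : X''.BaseChange (f' ≫ f) X) (h : p.IsComp q r) :
    (p.gradedDet A).IsComp (q.gradedDet A) (r.gradedDet A) := by
  have h1 : r.detMap = p.detMap ≫ (Scheme.Modules.pushforward f).map q.detMap ≫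
      (Scheme.Modules.pushforwardComp f' f).hom.app _ := by
    refine det_hom_ext _ fun x => ?_
    obtain ⟨U, hU, n, e, he⟩ := X.isVectorBundle x
    refine ⟨U, hU, n, e, he, ?_⟩
    change pushApp r.detMap _ = pushApp q.detMap (pushApp p.detMap _)
    rw [p.detMap_wedge he, r.detMap_wedge he, q.detMap_wedge (p.isFrame he)]
    exact wedge_congr _ _ _ (funext fun i => h U (e i))
  exact fun U s => congrArg (fun k : det X.isVectorBundle ⟶ _ => k.app U s) h1

/-- Both isomorphisms are given by the determinant of the matrix of the dual frame in the frame
`ε`, and this determinant pulls back. -/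
theorem isCompatible_detSquareIso (p : X'.BaseChange f X) :
    p.IsCompatible (p.gradedDet (ZMod 2)) X'.detSquareIso X.detSquareIso := by
  intro U n e ε he hε he' hε' σ σ' hσ hσ' s t h
  obtain ⟨a, rfl⟩ := (isGen_wedge X.isVectorBundle he).exists_smul_eq s
  obtain ⟨b, rfl⟩ := (isGen_wedge X.isVectorBundle he).exists_smul_eq t
  have h1 : (coord hε he.dualFrame).det • tmul (wedge X.isVectorBundle he)
      (wedge X.isVectorBundle he) = (a * b) • tmul (wedge X.isVectorBundle he)
      (wedge X.isVectorBundle he) := by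
    refine (X.detSquareIso_tmul he hε hσ).symm.trans (h.trans ?_)
    refine (tmul_smul_left a _ _).trans ?_
    exact (congrArg _ (tmul_smul_right b _ _)).trans (mul_smul _ _ _).symm
  have h2 := ((isGen_wedge X.isVectorBundle he).tmul (isGen_wedge _ he)).eq_of_smul_eq h1
  have h3 : (coord hε' he'.dualFrame).det = f.app U (a * b) := by
    rw [← h2, p.dualFrame_isFrame he, coord_pushApp p.p₁ hε]
    exact (RingHom.map_det _ _).symm
  have h4 : ∀ c : Γ(S, U), pushApp p.detMap (c • wedge X.isVectorBundle he) =
      f.app U c • wedge X'.isVectorBundle he' := fun c => by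
    rw [pushApp_smul, p.detMap_wedge he]
  refine (X'.detSquareIso_tmul he' hε' hσ').trans ?_
  refine Eq.trans ?_ (congrArg₂ tmul (h4 a) (h4 b)).symm
  rw [tmul_smul_left, tmul_smul_right, ← mul_smul, h3, map_mul]

end SkewComplex.BaseChange

theorem isUnit_two_of_over {k : Type u} [Field k] (hk : (2 : k) ≠ 0)
    (S : Over (Spec (CommRingCat.of k))) (U : S.left.Opens) : IsUnit (2 : Γ(S.left, U)) := by
  let ρ : k →+* Γ(S.left, U) := (res le_top).comp
    ((S.hom.appTop.hom).comp (Scheme.ΓSpecIso (CommRingCat.of k)).inv.hom)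
  exact map_ofNat ρ 2 ▸ (isUnit_iff_ne_zero.2 hk).map ρ

end

end Pfaff

theorem mainTheorem12 {k : Type u} [Field k] [IsAlgClosed k] (hk : (2 : k) ≠ 0) :
    ∃ (Pf : ∀ S : Over (Spec (CommRingCat.of k)), SkewComplex S.left ⥤ GradedLine (ZMod 2) S.left)
      (Det : ∀ S : Over (Spec (CommRingCat.of k)), DeterminantFunctor S.left)
      (θ : ∀ S : Over (Spec (CommRingCat.of k)),
        (Det S).toFunctor ⋙ modTwo S.left ≅ Pf S ⋙ squareFunctor (ZMod 2) S.left)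
      (bc : ∀ {S' S : Over (Spec (CommRingCat.of k))} (f : S' ⟶ S) {X' : SkewComplex S'.left}
        {X : SkewComplex S.left}, X'.BaseChange f.left X →
          ((Pf S').obj X').BaseChange f.left ((Pf S).obj X)),
      -- the value on objects
      (∀ (S : Over (Spec (CommRingCat.of k))) (X : SkewComplex S.left),
        (Pf S).obj X = gradedDet (ZMod 2) X.isVectorBundle) ∧
      -- the base change isomorphisms are natural
      (∀ {S' S : Over (Spec (CommRingCat.of k))} (f : S' ⟶ S) {X' Y' : SkewComplex S'.left}
        {X Y : SkewComplex S.left} (p : X'.BaseChange f.left X) (q : Y'.BaseChange f.left Y)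
        (g' : X' ⟶ Y') (g : X ⟶ Y), p.IsPullbackHom q g' g →
          (bc f p).IsPullbackHom (bc f q) ((Pf S').map g') ((Pf S).map g)) ∧
      -- the base change isomorphisms are compatible with composition
      (∀ {S'' S' S : Over (Spec (CommRingCat.of k))} (f' : S'' ⟶ S') (f : S' ⟶ S)
        {X'' : SkewComplex S''.left} {X' : SkewComplex S'.left} {X : SkewComplex S.left}
        (p : X'.BaseChange f.left X) (q : X''.BaseChange f'.left X')
        (r : X''.BaseChange (f' ≫ f).left X), p.IsComp q r →
          (bc f p).IsComp (bc f' q) (bc (f' ≫ f) r)) ∧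
      -- the isomorphism `θ` is compatible with base change
      (∀ {S' S : Over (Spec (CommRingCat.of k))} (f : S' ⟶ S) {X' : SkewComplex S'.left}
        {X : SkewComplex S.left} (p : X'.BaseChange f.left X), p.IsCompatible
          (bc f p) (GradedLine.Hom.iso ((θ S').hom.app X')) (GradedLine.Hom.iso ((θ S).hom.app X))) ∧
      -- morphisms homotopic to the identity
      ∀ (S : Over (Spec (CommRingCat.of k))) (X : SkewComplex S.left) (f : X ⟶ X),
        SkewComplex.HomotopicToId f → (Pf S).map f = 𝟙 ((Pf S).obj X) := by
  exact ⟨fun S => SkewComplex.pfaffianFunctor (isUnit_two_of_over hk S),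
    fun S => determinantFunctor (isUnit_two_of_over hk S),
    fun S => thetaIso (isUnit_two_of_over hk S), fun f _ _ p => p.gradedDet (ZMod 2),
    fun S X => rfl,
    fun f _ _ _ _ p q g' g h => p.isPullbackHom_pfaffian _ _ q h,
    fun f' f _ _ _ p q r h => p.isComp_gradedDet (ZMod 2) q r h,
    fun f _ _ p => p.isCompatible_detSquareIso,
    fun S X f hf => GradedLine.Hom.ext
      (SkewComplex.pfaffianIso_of_homotopicToId (isUnit_two_of_over hk S) hf)⟩
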